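/- Let $m\ge 2$ and $g\ge 2$. Let $X$ be the closed oriented surface of genus $g$, obtained from a $4g$-gon with boundary word $e_1f_1e_1^{-1}f_1^{-1}\cdots e_gf_ge_g^{-1}f_g^{-1}$, and let $X^\circ$ be $X$ without the centre of the polygon, so that $\pi_1(X^\circ)$ is free on $e_1,f_1,\dots,e_g,f_g$ and $\prod_i[e_i,f_i]$ is the loop around the puncture. Let $H=\langle\sigma,\tau,\zeta \mid [\sigma,\tau]=\zeta,\ \zeta \text{ central},\ \sigma^m=\tau^m=\zeta^m=1\rangle$ be the Heisenberg group over $\mathbb Z/m$ and let $Q=\langle\zeta\rangle\cong\mathbb Z/m$. Let $W\to X$ be the branched covering with deck group $H$ that is obtained from the regular covering of $X^\circ$ given by $e_1\mapsto\sigma$, $f_1\mapsto\tau$, all other generators $\mapsto 1$, by filling in the punctures, and let $Z=W/\langle\tau\rangle$. Equivalently, $Z\to X$ has fibre $(\mathbb Z/m)^2$ over the base point and monodromy $e_1:(i,j)\mapsto(i+1,j)$, $f_1:(i,j)\mapsto(i,j+i)$, with all other generators acting trivially. The group $Q$ acts on $Z$ by $\zeta:(i,j)\mapsto(i,j+1)$.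 For a finite group $G$ acting on a surface with intersection form $(\cdot,\cdot)$, the Reidemeister pairing is $\langle x,y\rangle_G=\sum_{h\in G}(x,hy)\,h$. Let $M_m\subset H_1(W;\mathbb Q)$ and $N_m\subset H_1(Z;\mathbb Q)$ be the isotypic factors on which $\zeta$ acts with order $m$, i.e. the kernels of $\Phi_m(\zeta)$, where $\Phi_m$ is the $m$-th cyclotomic polynomial. Let $\mathbf G_m=\mathrm{Aut}_H(M_m,\langle\cdot,\cdot\rangle_H)$ and $\mathbf G_m^{nn}=\mathrm{Aut}_Q(N_m,\langle\cdot,\cdot\rangle_Q)$, regarded as algebraic groups over $\mathbb Q$, i.e. as functors on commutative $\mathbb Q$-algebras. 1. The transfer $t:H_1(Z;k)\to H_1(W;k)$ of the covering $W\to Z$ restricts to a bijection $N_m\to M_m^{\langle\tau\rangle}$, for every commutative $\mathbb Q$-algebra $k$ as coefficients. Under this identification, restriction of automorphisms to the $\tau$-invariants is an isomorphism $\alpha_m:\mathbf G_m\to\mathbf G_m^{nn}$: for every commutative $\mathbb Q$-algebra $k$ there is a group isomorphism $\alpha_m:\mathbf G_m(k)\to\mathbf G_m^{nn}(k)$ with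 $t(\alpha_m(f)(n))=f(t(n))$ for all $f$ and $n$, and it is natural in $k$. 2. Let $A_m\subset\mathbb Q[H]$ be the ideal on which $\zeta$ acts with order $m$ (the annihilator of $\Phi_m(\zeta)$), let $\zeta_m$ be a primitive $m$-th root of unity and let $\rho:\mathbb Q[H]\to M_m(\mathbb Q(\zeta_m))$ be given by $\rho(\sigma)e_j=e_{j+1}$, $\rho(\tau)e_j=\zeta_m^je_j$, $\rho(\zeta)=\zeta_m^{-1}$, with indices $j\in\mathbb Z/m$. Then $\rho$ maps $A_m$ isomorphically onto $M_m(\mathbb Q(\zeta_m))$, and $\zeta\mapsto\zeta_m^{-1}$ maps the corresponding ideal of $\mathbb Q[Q]$ isomorphically onto $\mathbb Q(\zeta_m)$; in this way $M_m$ is an $A_m$-module and $N_m$ a $\mathbb Q(\zeta_m)$-vector space. The $A_m$-module $M_m$ is free of rank $d=2g-1$. For every $A_m$-basis $x_1,\dots,x_d$ of $M_m$, the vectors $E_{0i}x_a$ (where $E_{ij}\in A_m$ are the matrix units under $\rho$, $1\le a\le d$, $i\in\mathbb Z/m$) correspond under $t$ to a $\mathbb Q(\zeta_m)$-basis $y_{(a,i)}$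 of $N_m$. Let $C=(\rho(\langle x_a,x_b\rangle_H)_{ij})_{(a,i),(b,j)}$ and $B=(\langle y_p,y_q\rangle_Q)_{p,q}$ be the Gram matrices in $M_{md}(\mathbb Q(\zeta_m))$ of the two Reidemeister forms. Then $C$ is a nonzero rational multiple of $B$, so that $B$ and $C$ define the same unitary group $\{A\in \mathrm{GL}_{md}(\mathbb Q(\zeta_m)): A^tB\bar A=B\}=\{A: A^tC\bar A=C\}$, where the bar is $\zeta_m\mapsto\zeta_m^{-1}$. Moreover, expressing automorphisms by matrices in these bases (an automorphism $f$ with $f(x_b)=\sum_a\gamma_{ab}x_a$, $\gamma_{ab}\in A_m$, has the matrix with entry $\rho(\gamma_{ab})_{ji}$ at $((a,i),(b,j))$) gives isomorphisms of $\mathbf G_m(\mathbb Q)$ and $\mathbf G_m^{nn}(\mathbb Q)$ with this unitary group, and $f$ and $\alpha_m(f)$ have the same matrix. -/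

import Mathlib

open Polynomial

/-! ### Closed oriented surfaces glued from polygons, and their homology -/

/-- A closed oriented surface (not necessarily connected) glued from finitely many oriented polygons.
A *dart* is a side of a polygon, directed along the boundary orientation of its polygon, i.e. a
directed edge of the cell structure with the polygon on its left. `face d` is the side that follows
`d` on the boundary of its polygon, and `rev d` is the side that is glued to `d` (with the opposite
direction). So polygons are the orbits of `face` and edges are the orbits of `rev`. -/
structure PolySurface where
  Dart : Type
  [fintypeDart : Fintype Dart]
  rev : Equiv.Perm Dart
  face : Equiv.Perm Dart
  rev_rev : ∀ d, rev (rev d) = d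
  rev_ne : ∀ d, rev d ≠ d

attribute [instance] PolySurface.fintypeDart

namespace PolySurface

/-- The next dart, counterclockwise, with the same initial vertex. Vertices are the orbits. -/
def rot (M : PolySurface) : Equiv.Perm M.Dart := M.face.symm.trans M.rev

/-- The number of darts that issue from the initial vertex of `d`. -/
noncomputable def deg (M : PolySurface) (d : M.Dart) : ℕ := Function.minimalPeriod M.rot d

section Homology

variable (k : Type) [CommRing k]

/-- Cellular 1-cycles. A 1-chain is a function `c` on darts with `c (rev d) = - c d` (the coefficient
of the directed edge `d`); its boundary at a vertex vanishes iff the sum of `c` over the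
darts that issue from this vertex does. -/
def cycles (M : PolySurface) : Submodule k (M.Dart → k) where
  carrier := {c | (∀ d, c (M.rev d) = - c d) ∧
    ∀ d, ∑ j ∈ Finset.range (M.deg d), c ((M.rot ^ j) d) = 0}
  zero_mem' := by simp
  add_mem' := by
    rintro x y ⟨hx, hx'⟩ ⟨hy, hy'⟩
    refine ⟨fun d => ?_, fun d => ?_⟩
    · simp only [Pi.add_apply, hx, hy]; ring
    · simp only [Pi.add_apply, Finset.sum_add_distrib, hx', hy', add_zero]
  smul_mem' := by
    rintro r x ⟨hx, hx'⟩
    refine ⟨fun d => ?_, fun d => ?_⟩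
    · simp only [Pi.smul_apply, hx, smul_neg]
    · simp only [Pi.smul_apply, ← Finset.smul_sum, hx', smul_zero]

/-- Cellular 1-boundaries. A 2-chain is a function `u` on darts that is constant on each polygon; the
coefficient of the directed edge `d` in its boundary is the value of `u` on the polygon on the
left of `d` minus the value on the polygon on the right. -/
def boundaries (M : PolySurface) : Submodule k (M.Dart → k) where
  carrier := {c | ∃ u : M.Dart → k, (∀ d, u (M.face d) = u d) ∧ ∀ d, c d = u d - u (M.rev d)}
  zero_mem' := ⟨0, by simp⟩
  add_mem' := by
    rintro x y ⟨u, hu, hu'⟩ ⟨v, hv, hv'⟩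
    refine ⟨u + v, fun d => ?_, fun d => ?_⟩
    · simp [hu, hv]
    · simp only [Pi.add_apply, hu', hv']; ring
  smul_mem' := by
    rintro r x ⟨u, hu, hu'⟩
    refine ⟨r • u, fun d => ?_, fun d => ?_⟩
    · simp [hu]
    · simp only [Pi.smul_apply, hu', smul_sub]

/-- The first homology `H₁(M; k)`. -/
abbrev H1 (M : PolySurface) : Type := M.cycles k ⧸ (M.boundaries k).submoduleOf (M.cycles k)

end Homology

/-- Boundaries are cycles. -/
theorem boundaries_le_cycles (k : Type) [CommRing k] (M : PolySurface) :
    M.boundaries k ≤ M.cycles k := by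
  rintro c ⟨u, hu, hc⟩
  have key : ∀ d, u (M.rev (M.rot d)) = u d := by
    intro d
    have h := hu (M.face.symm d)
    simp only [Equiv.apply_symm_apply] at h
    simp [rot, M.rev_rev, h]
  refine ⟨fun d => by rw [hc, hc, M.rev_rev]; ring, fun d => ?_⟩
  have h1 : ∀ n, ∑ j ∈ Finset.range n, c ((M.rot ^ j) d) =
      u ((M.rot ^ n) (M.rot.symm d)) - u (M.rot.symm d) := by
    intro n
    induction n with
    | zero => simp
    | succ n ih =>
      rw [Finset.sum_range_succ, ih, hc]
      have e1 : (M.rot ^ (n + 1)) (M.rot.symm d) = (M.rot ^ n) d := by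
        rw [pow_succ, Equiv.Perm.mul_apply, Equiv.apply_symm_apply]
      have e2 : (M.rot ^ n) d = M.rot ((M.rot ^ n) (M.rot.symm d)) := by
        rw [← e1, pow_succ', Equiv.Perm.mul_apply]
      rw [e1]
      have e3 := key ((M.rot ^ n) (M.rot.symm d))
      rw [← e2] at e3
      rw [e3]; ring
  rw [h1]
  have e : (M.rot ^ M.deg d) d = d := by
    have := Function.iterate_minimalPeriod (f := M.rot) (x := d)
    rwa [← Equiv.Perm.coe_pow] at this
  have : (M.rot ^ M.deg d) (M.rot.symm d) = M.rot.symm d := by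
    apply M.rot.injective
    rw [← Equiv.Perm.mul_apply, ← pow_succ', pow_succ, Equiv.Perm.mul_apply,
      Equiv.apply_symm_apply, e]
  rw [this, sub_self]

section Intersection

variable (k : Type) [CommRing k] [Algebra ℚ k]

/-- The crossing form of 1-chains. At a vertex with darts `d₀, …, dₙ₋₁` in counterclockwise order,
cycles `x`, `y` cross `½ ∑_{i < j} (x(dᵢ) y(dⱼ) - x(dⱼ) y(dᵢ))` times; this does not depend on the
dart from which one starts to count. Averaged over the `n` possible starts, the weight of
`x(d) y(rotʲ d)`, `0 < j < n`, is `½ (1 - 2 j / n)`. -/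
noncomputable def crossing (M : PolySurface) : LinearMap.BilinForm k (M.Dart → k) :=
  LinearMap.mk₂ k
    (fun x y => ∑ d, ∑ j ∈ Finset.Ico 1 (M.deg d),
      ((1 / 2 : ℚ) * (1 - 2 * (j : ℚ) / (M.deg d : ℚ))) • (x d * y ((M.rot ^ j) d)))
    (fun x x' y => by simp only [Pi.add_apply, add_mul, smul_add, Finset.sum_add_distrib])
    (fun r x y => by
      simp only [Pi.smul_apply, smul_mul_assoc, Finset.smul_sum]
      exact Finset.sum_congr rfl fun _ _ => Finset.sum_congr rfl fun _ _ => smul_comm _ _ _)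
    (fun x y y' => by simp only [Pi.add_apply, mul_add, smul_add, Finset.sum_add_distrib])
    (fun r x y => by
      simp only [Pi.smul_apply, mul_smul_comm, Finset.smul_sum]
      exact Finset.sum_congr rfl fun _ _ => Finset.sum_congr rfl fun _ _ => smul_comm _ _ _)

/-- The functional `L` with `crossing x y = ∑ d, x d * L d`. -/
noncomputable def crossFun (M : PolySurface) (y : M.Dart → k) (d : M.Dart) : k :=
  ∑ j ∈ Finset.Ico 1 (M.deg d),
    ((1 / 2 : ℚ) * (1 - 2 * (j : ℚ) / (M.deg d : ℚ))) • y ((M.rot ^ j) d)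

theorem deg_pos (M : PolySurface) (d : M.Dart) : 0 < M.deg d := by
  classical
  exact Function.minimalPeriod_pos_of_mem_periodicPts
    (M.rot.injective.mem_periodicPts d)

theorem deg_rot (M : PolySurface) (d : M.Dart) : M.deg (M.rot d) = M.deg d :=
  Function.minimalPeriod_apply (M.rot.injective.mem_periodicPts d)

theorem deg_rot_pow (M : PolySurface) (d : M.Dart) (j : ℕ) :
    M.deg ((M.rot ^ j) d) = M.deg d := by
  induction j with
  | zero => simp
  | succ j ih => rw [pow_succ', Equiv.Perm.mul_apply, deg_rot, ih]

theorem rot_pow_deg (M : PolySurface) (d : M.Dart) : (M.rot ^ M.deg d) d = d := by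
  have := Function.iterate_minimalPeriod (f := M.rot) (x := d)
  rwa [← Equiv.Perm.coe_pow] at this

theorem crossing_eq (M : PolySurface) (x y : M.Dart → k) :
    M.crossing k x y = ∑ d, x d * M.crossFun k y d := by
  simp only [crossing, crossFun, LinearMap.mk₂_apply, Finset.mul_sum, mul_smul_comm]

theorem crossFun_rot (M : PolySurface) (y : M.Dart → k) (hy : y ∈ M.cycles k)
    (d : M.Dart) : M.crossFun k y (M.rot d) =
      M.crossFun k y d - (1 / 2 : ℚ) • y d - (1 / 2 : ℚ) • y (M.rot d) := by
  obtain ⟨N, hN⟩ : ∃ N, M.deg d = N + 1 := ⟨M.deg d - 1, by have := M.deg_pos d; omega⟩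
  have hs := hy.2 d
  have hper := M.rot_pow_deg d
  simp only [crossFun, deg_rot]
  rw [hN] at hs hper ⊢
  rw [Finset.sum_Ico_eq_sum_range, Finset.sum_Ico_eq_sum_range]
  simp only [Nat.add_sub_cancel]
  have hN0 : ((N : ℚ) + 1) ≠ 0 := by positivity
  have hshift : ∀ j : ℕ, (M.rot ^ j) (M.rot d) = (M.rot ^ (j + 1)) d := fun j => by
    rw [pow_succ, Equiv.Perm.mul_apply]
  simp only [hshift]
  set f : ℕ → k := fun j => y ((M.rot ^ j) d) with hf
  have hf0 : y d = f 0 := by simp [hf]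
  have hf1 : y (M.rot d) = f 1 := by simp [hf]
  have hfN : f (N + 1) = f 0 := by simp only [hf]; rw [hper]; simp
  have e1 : ∀ j, y ((M.rot ^ j) d) = f j := fun _ => rfl
  simp only [e1] at hs ⊢
  rw [hf0, hf1]
  rw [Finset.sum_range_succ'] at hs
  set w : ℕ → ℚ := fun j => 1 / 2 * (1 - 2 * (j : ℚ) / ((N + 1 : ℕ) : ℚ)) with hw
  have hA : ∑ x ∈ Finset.range N, w (1 + x) • f (1 + x + 1) =
      ∑ x ∈ Finset.range N, w x • f (x + 1) + w N • f (N + 1) - w 0 • f 1 := by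
    rw [← Finset.sum_range_succ (fun x => w x • f (x + 1)), Finset.sum_range_succ']
    simp [add_comm 1]
  have hB : ∑ x ∈ Finset.range N, w x • f (x + 1) =
      ∑ x ∈ Finset.range N, w (1 + x) • f (1 + x) +
        (1 / ((N : ℚ) + 1)) • ∑ x ∈ Finset.range N, f (x + 1) := by
    rw [Finset.smul_sum, ← Finset.sum_add_distrib]
    refine Finset.sum_congr rfl fun x _ => ?_
    rw [add_comm 1 x, ← add_smul]
    congr 1
    simp only [hw]; push_cast; field_simp; ring
  have hs' : ∑ x ∈ Finset.range N, f (x + 1) = - f 0 := eq_neg_of_add_eq_zero_left hs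
  have hwN : w N = 1 / ((N : ℚ) + 1) - 1 / 2 := by
    simp only [hw]; push_cast; field_simp; ring
  have hw0 : w 0 = 1 / 2 := by simp [hw]
  change ∑ x ∈ Finset.range N, w (1 + x) • f (1 + x + 1) =
    ∑ x ∈ Finset.range N, w (1 + x) • f (1 + x) - _ - _
  rw [hA, hB, hs', hfN, hwN, hw0, sub_smul, smul_neg]
  abel

theorem crossing_boundary_left (M : PolySurface) {x y : M.Dart → k}
    (hx : x ∈ M.boundaries k) (hy : y ∈ M.cycles k) : M.crossing k x y = 0 := by
  obtain ⟨u, hu, hx⟩ := hx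
  rw [crossing_eq]
  have hrot : ∀ d, M.rot (M.face d) = M.rev d := fun d => by simp [rot]
  have key : ∀ d, M.crossFun k y (M.rev d) =
      M.crossFun k y (M.face d) - (1 / 2 : ℚ) • y (M.face d) + (1 / 2 : ℚ) • y d := fun d => by
    rw [← hrot, crossFun_rot k M y hy, hrot, hy.1, smul_neg]; abel
  have h1 : ∑ d, u (M.rev d) * M.crossFun k y d = ∑ d, u d * M.crossFun k y (M.rev d) := by
    rw [← Equiv.sum_comp M.rev]
    simp [M.rev_rev]
  have h2 : ∀ F : M.Dart → k, ∑ d, u d * F (M.face d) = ∑ d, u d * F d := fun F => by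
    rw [← Equiv.sum_comp M.face (fun d => u d * F d)]
    simp [hu]
  simp only [hx, sub_mul, Finset.sum_sub_distrib, h1, key, mul_add, mul_sub,
    Finset.sum_add_distrib]
  rw [h2, h2 (fun d => (1 / 2 : ℚ) • y d)]
  abel

/-- The crossing form is alternating. -/
theorem crossing_neg (M : PolySurface) (x y : M.Dart → k) :
    M.crossing k y x = - M.crossing k x y := by
  simp only [crossing, LinearMap.mk₂_apply]
  rw [← Finset.sum_neg_distrib]
  simp only [← Finset.sum_neg_distrib]
  rw [Finset.sum_sigma', Finset.sum_sigma']
  refine Finset.sum_bij' (fun p _ => ⟨(M.rot ^ p.2) p.1, M.deg p.1 - p.2⟩)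
    (fun p _ => ⟨(M.rot ^ p.2) p.1, M.deg p.1 - p.2⟩) ?_ ?_ ?_ ?_ ?_
  · rintro ⟨d, j⟩ h
    simp only [Finset.mem_sigma, Finset.mem_univ, Finset.mem_Ico, true_and, deg_rot_pow] at h ⊢
    omega
  · rintro ⟨d, j⟩ h
    simp only [Finset.mem_sigma, Finset.mem_univ, Finset.mem_Ico, true_and, deg_rot_pow] at h ⊢
    omega
  · rintro ⟨d, j⟩ h
    simp only [Finset.mem_sigma, Finset.mem_univ, Finset.mem_Ico, true_and] at h
    simp only [deg_rot_pow, Sigma.mk.injEq, heq_eq_eq]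
    refine ⟨?_, by omega⟩
    rw [← Equiv.Perm.mul_apply, ← pow_add, Nat.sub_add_cancel h.2.le, rot_pow_deg]
  · rintro ⟨d, j⟩ h
    simp only [Finset.mem_sigma, Finset.mem_univ, Finset.mem_Ico, true_and] at h
    simp only [deg_rot_pow, Sigma.mk.injEq, heq_eq_eq]
    refine ⟨?_, by omega⟩
    rw [← Equiv.Perm.mul_apply, ← pow_add, Nat.sub_add_cancel h.2.le, rot_pow_deg]
  · rintro ⟨d, j⟩ h
    simp only [Finset.mem_sigma, Finset.mem_univ, Finset.mem_Ico, true_and] at h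
    simp only [deg_rot_pow]
    rw [← Equiv.Perm.mul_apply, ← pow_add, Nat.sub_add_cancel h.2.le, rot_pow_deg, ← neg_smul,
      mul_comm (y d)]
    congr 1
    have : (M.deg d : ℚ) ≠ 0 := by
      have := M.deg_pos d
      positivity
    rw [Nat.cast_sub h.2.le]
    field_simp
    ring

/-- The algebraic intersection form on `H₁(M; k)`. -/
noncomputable def intersection (M : PolySurface) : LinearMap.BilinForm k (M.H1 k) :=
  ((M.boundaries k).submoduleOf (M.cycles k)).liftQ
    { toFun := fun x => ((M.boundaries k).submoduleOf (M.cycles k)).liftQ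
        ((M.crossing k x.1).comp (M.cycles k).subtype) (fun y hy => by
          rw [LinearMap.mem_ker, LinearMap.comp_apply, crossing_neg,
            crossing_boundary_left k M hy (by exact x.2), neg_zero])
      map_add' := fun x x' => by
        refine LinearMap.ext fun q => Submodule.Quotient.induction_on _ q fun y => ?_
        simp
      map_smul' := fun r x => by
        refine LinearMap.ext fun q => Submodule.Quotient.induction_on _ q fun y => ?_
        simp }
    (fun x hx => by
      refine LinearMap.ext fun q => Submodule.Quotient.induction_on _ q fun y => ?_
      exact crossing_boundary_left k M hx y.2)

end Intersection

/-! ### Branched coverings -/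

/-- An orientation-preserving cellular branched covering `M' → M` (branched at most over
centres of polygons and over vertices). -/
structure Cover (M' M : PolySurface) where
  toFun : M'.Dart → M.Dart
  map_rev : ∀ d, toFun (M'.rev d) = M.rev (toFun d)
  map_face : ∀ d, toFun (M'.face d) = M.face (toFun d)

namespace Cover

variable {M' M : PolySurface}

theorem map_rot (p : Cover M' M) (d : M'.Dart) : p.toFun (M'.rot d) = M.rot (p.toFun d) := by
  have h := p.map_face (M'.face.symm d)
  rw [Equiv.apply_symm_apply] at h
  simp [rot, p.map_rev, h]

theorem map_rot_pow (p : Cover M' M) (j : ℕ) (d : M'.Dart) :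
    p.toFun ((M'.rot ^ j) d) = (M.rot ^ j) (p.toFun d) := by
  induction j with
  | zero => simp
  | succ j ih => rw [pow_succ', pow_succ', Equiv.Perm.mul_apply, Equiv.Perm.mul_apply, map_rot, ih]

variable (k : Type) [CommRing k]

theorem comp_mem_cycles (p : Cover M' M) {c : M.Dart → k} (hc : c ∈ M.cycles k) :
    c ∘ p.toFun ∈ M'.cycles k := by
  refine ⟨fun d => by simp [p.map_rev, hc.1], fun d => ?_⟩
  simp only [Function.comp_apply, map_rot_pow]
  have hdvd : M.deg (p.toFun d) ∣ M'.deg d := by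
    refine Function.IsPeriodicPt.minimalPeriod_dvd ?_
    have := p.map_rot_pow (M'.deg d) d
    rw [rot_pow_deg] at this
    rw [Function.IsPeriodicPt, Function.IsFixedPt, ← Equiv.Perm.coe_pow, ← this]
  obtain ⟨q, hq⟩ := hdvd
  rw [hq]
  clear hq
  induction q with
  | zero => simp
  | succ q ih =>
    rw [Nat.mul_succ, Finset.sum_range_add, ih, zero_add]
    refine Eq.trans (Finset.sum_congr rfl fun j _ => ?_) (hc.2 (p.toFun d))
    congr 1
    have hfix : ∀ q : ℕ, (M.rot ^ (M.deg (p.toFun d) * q)) (p.toFun d) = p.toFun d := by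
      intro q
      induction q with
      | zero => simp
      | succ q ih => rw [Nat.mul_succ, pow_add, Equiv.Perm.mul_apply, rot_pow_deg, ih]
    rw [add_comm, pow_add, Equiv.Perm.mul_apply, hfix]

/-- The transfer `H₁(M; k) → H₁(M'; k)`: it sends an edge to the sum of the edges above it, so on the
level of coefficient functions it is the composition with the covering map. -/
def transfer (p : Cover M' M) : M.H1 k →ₗ[k] M'.H1 k :=
  Submodule.mapQ _ _
    ((LinearMap.funLeft k k p.toFun).restrict fun _ hc => p.comp_mem_cycles k hc)
    (by
      rintro c ⟨u, hu, hc⟩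
      refine ⟨u ∘ p.toFun, fun d => by simp [p.map_face, hu], fun d => ?_⟩
      have := hc (p.toFun d)
      rw [Function.comp_apply, Function.comp_apply, p.map_rev]
      exact this)

end Cover

/-- The homomorphism `H₁(M; k) → H₁(M; k')` that is induced by a homomorphism `k → k'`. -/
def mapCoeff (M : PolySurface) {k k' : Type} [CommRing k] [CommRing k'] (φ : k →+* k') :
    M.H1 k →+ M.H1 k' :=
  QuotientAddGroup.map _ _
    { toFun := fun c => (⟨fun d => φ (c.1 d), by
        refine ⟨fun d => ?_, fun d => ?_⟩
        · have := c.2.1 d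
          simp [this]
        · have := c.2.2 d
          rw [← map_sum, this, map_zero]⟩ : M.cycles k')
      map_zero' := by ext; simp
      map_add' := fun x y => by ext; simp }
    (by
      rintro c ⟨u, hu, hc⟩
      refine ⟨fun d => φ (u d), fun d => by simp [hu], fun d => ?_⟩
      have := hc d
      exact (congrArg φ this).trans (map_sub φ _ _))

/-- The closed oriented surface of genus `g`: one polygon with `4 g` sides and boundary word
`e₁ f₁ e₁⁻¹ f₁⁻¹ ⋯ e_g f_g e_g⁻¹ f_g⁻¹`. The sides `(i, 0), (i, 1), (i, 2), (i, 3)` are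
`e, f, e⁻¹, f⁻¹` of the `i`-th handle. It has one vertex, and the punctured surface `X°` (the
centre of the polygon removed) has the fundamental group that is freely generated by the loops
`e_i, f_i`, with `∏ [e_i, f_i]` the loop `c` around the puncture. -/
def standard (g : ℕ) : PolySurface where
  Dart := Fin g × Fin 4
  rev := Equiv.prodCongr (Equiv.refl _) (Equiv.addRight 2)
  face :=
    { toFun := fun d => if d.2 = 3 then (finRotate g d.1, 0) else (d.1, d.2 + 1)
      invFun := fun d => if d.2 = 0 then ((finRotate g).symm d.1, 3) else (d.1, d.2 - 1)
      left_inv := by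
        rintro ⟨i, j⟩
        fin_cases j
        · simp
        · simp
        · simp
        · exact Prod.ext ((finRotate g).symm_apply_apply i) rfl
      right_inv := by
        rintro ⟨i, j⟩
        fin_cases j
        · exact Prod.ext ((finRotate g).apply_symm_apply i) rfl
        · exact Prod.ext rfl rfl
        · exact Prod.ext rfl rfl
        · exact Prod.ext rfl rfl }
  rev_rev := by
    rintro ⟨i, j⟩
    fin_cases j <;> simp
  rev_ne := by
    rintro ⟨i, j⟩
    fin_cases j <;> simp

section Monodromy

variable {S S' : Type}

/-- The covering of `M`, branched over the centres of the polygons, with fibre `S` over the vertices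
and monodromy `v`: the lift of the directed edge `d` that starts at the point `s` of the fibre
ends at the point `v d s`. All punctures of the covering of the punctured surface are filled in,
so each orbit of lifted polygon sides bounds one disc. -/
def branchedCover [Fintype S] (M : PolySurface) (v : M.Dart → Equiv.Perm S)
    (hv : ∀ d, v (M.rev d) = (v d)⁻¹) : PolySurface where
  Dart := M.Dart × S
  rev := Equiv.prodShear M.rev v
  face := Equiv.prodShear M.face v
  rev_rev := by
    rintro ⟨d, s⟩
    simp [Equiv.prodShear, hv, M.rev_rev]
  rev_ne := by
    rintro ⟨d, s⟩ h
    exact M.rev_ne d (congrArg Prod.fst h)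

/-- A map of fibres that commutes with the monodromies induces a covering. -/
def coverOfFibre [Fintype S] [Fintype S'] {M : PolySurface}
    {v : M.Dart → Equiv.Perm S} {v' : M.Dart → Equiv.Perm S'}
    {hv : ∀ d, v (M.rev d) = (v d)⁻¹} {hv' : ∀ d, v' (M.rev d) = (v' d)⁻¹}
    (T : S → S') (hT : ∀ d s, T (v d s) = v' d (T s)) :
    Cover (M.branchedCover v hv) (M.branchedCover v' hv') where
  toFun := fun x => (x.1, T x.2)
  map_rev := fun x => Prod.ext rfl (hT x.1 x.2)
  map_face := fun x => Prod.ext rfl (hT x.1 x.2)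

/-- A group `G` that acts on the fibre and commutes with the monodromy acts on the covering surface
by deck transformations, and hence on its homology. The map induced by the homeomorphism
`h` is the transfer of `h⁻¹`. -/
def deckRep [Fintype S] (k : Type) [CommRing k] {G : Type} [Group G] (M : PolySurface)
    (v : M.Dart → Equiv.Perm S) (hv : ∀ d, v (M.rev d) = (v d)⁻¹)
    (act : G →* Equiv.Perm S) (hact : ∀ h d s, act h (v d s) = v d (act h s)) :
    Representation k G ((M.branchedCover v hv).H1 k) where
  toFun := fun h => (coverOfFibre (hv := hv) (hv' := hv) (act h⁻¹) (hact h⁻¹)).transfer k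
  map_one' := by
    refine LinearMap.ext fun q => Submodule.Quotient.induction_on _ q fun c => ?_
    refine congrArg (Submodule.Quotient.mk) (Subtype.ext (funext fun d => ?_))
    change c.1 (d.1, act 1⁻¹ d.2) = c.1 d
    rw [inv_one, map_one]
    rfl
  map_mul' := fun h h' => by
    refine LinearMap.ext fun q => Submodule.Quotient.induction_on _ q fun c => ?_
    refine congrArg (Submodule.Quotient.mk) (Subtype.ext (funext fun d => ?_))
    change c.1 (d.1, act (h * h')⁻¹ d.2) = c.1 (d.1, act h'⁻¹ (act h⁻¹ d.2))
    rw [mul_inv_rev, map_mul, Equiv.Perm.mul_apply]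

/-- The monodromy with `e₁ ↦ a`, `f₁ ↦ b`, all other generators of `π₁(X°)` acting trivially. -/
def handle (g : ℕ) (a b : Equiv.Perm S) : (standard g).Dart → Equiv.Perm S :=
  fun d : Fin g × Fin 4 => if d.1.val = 0 then ![a, b, a⁻¹, b⁻¹] d.2 else 1

theorem handle_rev (g : ℕ) (a b : Equiv.Perm S) (d : (standard g).Dart) :
    handle g a b ((standard g).rev d) = (handle g a b d)⁻¹ := by
  obtain ⟨i, j⟩ := d
  change (if i.val = 0 then ![a, b, a⁻¹, b⁻¹] (j + 2) else 1) =
    (if i.val = 0 then ![a, b, a⁻¹, b⁻¹] j else 1)⁻¹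
  by_cases h : i.val = 0
  · rw [if_pos h, if_pos h]
    fin_cases j <;> simp
  · rw [if_neg h, if_neg h, inv_one]

theorem handle_comm {g : ℕ} {a b : Equiv.Perm S} {a' b' : Equiv.Perm S'} {T : S → S'}
    (ha : ∀ s, T (a s) = a' (T s)) (hb : ∀ s, T (b s) = b' (T s)) (d : (standard g).Dart) (s : S) :
    T (handle g a b d s) = handle g a' b' d (T s) := by
  have ha' : ∀ s, T (a⁻¹ s) = a'⁻¹ (T s) := fun s => by
    rw [Equiv.Perm.eq_inv_iff_eq, ← ha]; simp
  have hb' : ∀ s, T (b⁻¹ s) = b'⁻¹ (T s) := fun s => by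
    rw [Equiv.Perm.eq_inv_iff_eq, ← hb]; simp
  obtain ⟨i, j⟩ := d
  change T ((if i.val = 0 then ![a, b, a⁻¹, b⁻¹] j else 1) s) =
    (if i.val = 0 then ![a', b', a'⁻¹, b'⁻¹] j else 1) (T s)
  by_cases h : i.val = 0
  · rw [if_pos h, if_pos h]
    fin_cases j
    · exact ha s
    · exact hb s
    · exact ha' s
    · exact hb' s
  · rw [if_neg h, if_neg h]
    rfl

end Monodromy

end PolySurface

/-! ### The Heisenberg group and the surfaces `W` and `Z` -/

/-- The Heisenberg group over `ℤ/m`. The triple `(a, b, c)` stands for `τ^a σ^b ζ^c`,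
where `σ τ σ⁻¹ τ⁻¹ = ζ` is central. -/
@[ext]
structure Heis (m : ℕ) where
  a : ZMod m
  b : ZMod m
  c : ZMod m

namespace Heis

variable {m : ℕ}

instance : Group (Heis m) where
  mul x y := ⟨x.a + y.a, x.b + y.b, x.c + y.c + x.b * y.a⟩
  one := ⟨0, 0, 0⟩
  inv x := ⟨-x.a, -x.b, -x.c + x.b * x.a⟩
  mul_assoc x y z := by
    apply Heis.ext
    · exact add_assoc _ _ _
    · exact add_assoc _ _ _
    · change x.c + y.c + x.b * y.a + z.c + (x.b + y.b) * z.a =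
        x.c + (y.c + z.c + y.b * z.a) + x.b * (y.a + z.a)
      ring
  one_mul x := by
    apply Heis.ext
    · exact zero_add _
    · exact zero_add _
    · change 0 + x.c + 0 * x.a = x.c
      ring
  mul_one x := by
    apply Heis.ext
    · exact add_zero _
    · exact add_zero _
    · change x.c + 0 + x.b * 0 = x.c
      ring
  inv_mul_cancel x := by
    apply Heis.ext
    · exact neg_add_cancel _
    · exact neg_add_cancel _
    · change -x.c + x.b * x.a + x.c + -x.b * x.a = 0
      ring

/-- The triples `(a, b, c)`. -/
def equivProd (m : ℕ) : Heis m ≃ ZMod m × ZMod m × ZMod m where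
  toFun x := (x.a, x.b, x.c)
  invFun x := ⟨x.1, x.2.1, x.2.2⟩
  left_inv _ := rfl
  right_inv _ := rfl

instance [NeZero m] : Fintype (Heis m) := Fintype.ofEquiv _ (equivProd m).symm

theorem mul_def (x y : Heis m) :
    x * y = ⟨x.a + y.a, x.b + y.b, x.c + y.c + x.b * y.a⟩ := rfl

/-- The generator `τ`. -/
def tau (m : ℕ) : Heis m := ⟨1, 0, 0⟩
/-- The generator `σ`. -/
def sigma (m : ℕ) : Heis m := ⟨0, 1, 0⟩
/-- The central generator `ζ`. -/
def zeta (m : ℕ) : Heis m := ⟨0, 0, 1⟩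

theorem sigma_mul_tau : sigma m * tau m = zeta m * (tau m * sigma m) := by
  ext <;> simp [mul_def, sigma, tau, zeta]

theorem mul_zeta (h : Heis m) : h * zeta m = zeta m * h := by
  ext <;> simp [mul_def, zeta, add_comm]

end Heis

/-- The cyclic group `Q = ⟨ζ⟩` of order `m`. -/
abbrev CycQ (m : ℕ) : Type := Multiplicative (ZMod m)

/-- The generator `ζ` of `Q`. -/
def CycQ.zeta (m : ℕ) : CycQ m := Multiplicative.ofAdd 1

section Surfaces

open PolySurface

variable (g m : ℕ) [NeZero m]

/-- The normal branched covering `W → X` with deck group `H = Heis m`: the regular `H`-covering of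
`X°` given by `π₁(X°) → H`, `e₁ ↦ σ`, `f₁ ↦ τ` and all other generators to `1`, with the
punctures filled in. The loop around the puncture of `X°` goes to `ζ`. -/
abbrev surfaceW : PolySurface :=
  (standard g).branchedCover
    (handle g (Equiv.mulRight (Heis.sigma m)) (Equiv.mulRight (Heis.tau m)))
    (handle_rev g _ _)

/-- The monodromy of `Z → X` along `e₁`. -/
def monodromyE : Equiv.Perm (ZMod m × ZMod m) :=
  Equiv.prodCongr (Equiv.addRight 1) (Equiv.refl _)

/-- The monodromy of `Z → X` along `f₁`. -/
def monodromyF : Equiv.Perm (ZMod m × ZMod m) :=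
  Equiv.prodShear (Equiv.refl _) (fun i => Equiv.addRight i)

/-- The fibre `Z` of the Atiyah-Kodaira bundle. The point `(i, j)` of the fibre of `Z → X` lies over
the `i`-th point of the cyclic unbranched covering `Y → X` (where `e₁` acts by `i ↦ i + 1`) and on
the `j`-th sheet of the cyclic branched covering `Z → Y`; along the lift of `f₁` at `i`
the sheet changes from `j` to `j + i`. -/
abbrev surfaceZ : PolySurface :=
  (standard g).branchedCover (handle g (monodromyE m) (monodromyF m)) (handle_rev g _ _)

/-- The unbranched covering `r : W → Z` with deck group `⟨τ⟩`: the point `τ^a σ^i ζ^j` of the fibre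
of `W` lies over the point `(i, j)` of the fibre of `Z`. -/
def coverWZ : Cover (surfaceW g m) (surfaceZ g m) :=
  coverOfFibre (fun h : Heis m => (h.b, h.c))
    (handle_comm (T := fun h : Heis m => (h.b, h.c))
      (fun s => by simp [monodromyE, Heis.mul_def, Heis.sigma])
      (fun s => by simp [monodromyF, Heis.mul_def, Heis.tau, Equiv.prodShear]))

variable (k : Type) [CommRing k]

/-- The action of the deck group `H` of `W → X` on `H₁(W; k)`; `h ∈ H` moves the point `s` of
the fibre to `h s`. -/
def repW : Representation k (Heis m) ((surfaceW g m).H1 k) :=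
  deckRep k _ _ _ (MulAction.toPermHom (Heis m) (Heis m)) (fun h => handle_comm
    (fun s => by simp [mul_assoc]) (fun s => by simp [mul_assoc]))

/-- The action of the deck group `Q` of `Z → Y` on `H₁(Z; k)`; `ζ` moves the point `(i, j)` of
the fibre to `(i, j + 1)`. -/
def repZ : Representation k (CycQ m) ((surfaceZ g m).H1 k) :=
  deckRep k _ _ _
    { toFun := fun q => Equiv.prodCongr (Equiv.refl _) (Equiv.addLeft q.toAdd)
      map_one' := by ext s <;> simp
      map_mul' := fun q q' => by ext s <;> simp [add_assoc] }
    (fun q => handle_comm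
      (fun s => rfl)
      (fun s => by simp [monodromyF, Equiv.prodShear, add_assoc]))

end Surfaces

/-! ### Isotypic factors, Reidemeister pairings and unitary groups -/

section Reidemeister

variable {k G V : Type} [CommRing k] [Group G] [AddCommGroup V] [Module k V]

/-- The part of `V` where the central element `z` acts with (exact) order `m`: the
isotypic factor, for the group `⟨z⟩`, of the simple `ℚ[⟨z⟩]`-module `ℚ[t]/Φ_m(t) = ℚ(ζ_m)`
(and the base change of this factor to `k` in general). -/
noncomputable def orderPart (ρ : Representation k G V) (z : G) (m : ℕ) : Submodule k V :=
  LinearMap.ker (aeval (ρ z) (cyclotomic m k))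

theorem orderPart_invariant (ρ : Representation k G V) (z : G) (m : ℕ) (hz : ∀ g, g * z = z * g)
    (g : G) {x : V} (hx : x ∈ orderPart ρ z m) : ρ g x ∈ orderPart ρ z m := by
  have hc : Commute (ρ g) (ρ z) := by
    rw [Commute, SemiconjBy, ← map_mul, hz, map_mul]
  have hc' : Commute (ρ g) (aeval (ρ z) (cyclotomic m k)) := by
    rw [aeval_eq_sum_range]
    exact Commute.sum_right _ _ _ fun i _ => (hc.pow_right i).smul_right _
  have hx' : aeval (ρ z) (cyclotomic m k) x = 0 := hx
  change aeval (ρ z) (cyclotomic m k) (ρ g x) = 0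
  have := LinearMap.congr_fun hc'.eq x
  rw [Module.End.mul_apply, Module.End.mul_apply, hx', map_zero] at this
  exact this.symm

/-- The representation of `G` on `orderPart ρ z m`, for a central element `z`. -/
noncomputable def orderRep (ρ : Representation k G V) (z : G) (m : ℕ)
    (hz : ∀ g, g * z = z * g) : Representation k G (orderPart ρ z m) where
  toFun := fun g => (ρ g).restrict fun _ hx => orderPart_invariant ρ z m hz g hx
  map_one' := by ext x; simp
  map_mul' := fun g h => by ext x; simp

/-- The Reidemeister pairing `⟨x, y⟩_G = ∑_g (x, g y) g`. -/
noncomputable def reidemeister [Fintype G] (ρ : Representation k G V) (B : LinearMap.BilinForm k V)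
    (x y : V) : MonoidAlgebra k G :=
  ∑ g, MonoidAlgebra.single g (B x (ρ g y))

/-- The group `Aut_G(V, ⟨·,·⟩_G)` of `G`-equivariant automorphisms that preserve the
Reidemeister pairing. -/
def reidAut [Fintype G] (ρ : Representation k G V) (B : LinearMap.BilinForm k V) :
    Subgroup (V ≃ₗ[k] V) where
  carrier := {f | (∀ g x, f (ρ g x) = ρ g (f x)) ∧
    ∀ x y, reidemeister ρ B (f x) (f y) = reidemeister ρ B x y}
  one_mem' := ⟨fun _ _ => rfl, fun _ _ => rfl⟩
  mul_mem' := by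
    rintro f f' ⟨h1, h2⟩ ⟨h1', h2'⟩
    refine ⟨fun g x => ?_, fun x y => ?_⟩
    · simp only [LinearEquiv.mul_apply, h1, h1']
    · simp only [LinearEquiv.mul_apply, h2, h2']
  inv_mem' := by
    rintro f ⟨h1, h2⟩
    refine ⟨fun g x => ?_, fun x y => ?_⟩
    · apply f.injective
      rw [h1]
      simp only [← LinearEquiv.mul_apply, mul_inv_cancel]
      rfl
    · rw [← h2]
      simp only [← LinearEquiv.mul_apply, mul_inv_cancel]
      rfl

/-- The two-sided ideal of the group algebra on which the central element `z` acts with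
order `m`. For `ℚ[Q]` and `ℚ[H]` and `z = ζ` of order `m` it is a simple factor of the Wedderburn
decomposition. -/
noncomputable def topFactor (k : Type) [CommRing k] (z : G) (m : ℕ) :
    Submodule k (MonoidAlgebra k G) :=
  LinearMap.ker (LinearMap.mulLeft k (aeval (MonoidAlgebra.of k G z) (cyclotomic m k)))

/-- `x` is a basis of `V` over the factor `topFactor k z m` of the group algebra: each vector is
`∑ aᵢ xᵢ` for unique coefficients `aᵢ` in the factor. -/
def IsFactorBasis {ι : Type} [Fintype ι] (ρ : Representation k G V) (z : G) (m : ℕ)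
    (x : ι → V) : Prop :=
  Function.Bijective fun a : ι → topFactor k z m => ∑ i, ρ.asAlgebraHom (a i).1 (x i)

end Reidemeister

section TopComponent

variable (g m : ℕ) [NeZero m] (k : Type) [CommRing k]

/-- `M_m ⊆ H₁(W; k)`. -/
noncomputable abbrev topM : Submodule k ((surfaceW g m).H1 k) :=
  orderPart (repW g m k) (Heis.zeta m) m

/-- The `H`-action on `M_m`. -/
noncomputable abbrev topMRep : Representation k (Heis m) (topM g m k) :=
  orderRep (repW g m k) (Heis.zeta m) m Heis.mul_zeta

/-- `N_m ⊆ H₁(Z; k)`. -/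
noncomputable abbrev topN : Submodule k ((surfaceZ g m).H1 k) :=
  orderPart (repZ g m k) (CycQ.zeta m) m

/-- The `Q`-action on `N_m`. -/
noncomputable abbrev topNRep : Representation k (CycQ m) (topN g m k) :=
  orderRep (repZ g m k) (CycQ.zeta m) m (fun _ => mul_comm _ _)

variable [Algebra ℚ k]

/-- The intersection form of `W` on `M_m`. -/
noncomputable abbrev topMForm : LinearMap.BilinForm k (topM g m k) :=
  ((surfaceW g m).intersection k).restrict (topM g m k)

/-- The intersection form of `Z` on `N_m`. -/
noncomputable abbrev topNForm : LinearMap.BilinForm k (topN g m k) :=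
  ((surfaceZ g m).intersection k).restrict (topN g m k)

/-- The `k`-points of the algebraic `ℚ`-group `G_m = Aut_H(M_m, ⟨·,·⟩_H)`. -/
noncomputable abbrev GroupG : Subgroup (topM g m k ≃ₗ[k] topM g m k) :=
  reidAut (topMRep g m k) (topMForm g m k)

/-- The `k`-points of the algebraic `ℚ`-group `G_m^{nn} = Aut_Q(N_m, ⟨·,·⟩_Q)`. -/
noncomputable abbrev GroupGnn : Subgroup (topN g m k ≃ₗ[k] topN g m k) :=
  reidAut (topNRep g m k) (topNForm g m k)

end TopComponent

/-! ### Matrices over the cyclotomic field -/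

section Cyclotomic

variable (m : ℕ) [NeZero m]

instance instCyclotomicRat : IsCyclotomicExtension {m} ℚ (CyclotomicField m ℚ) :=
  CyclotomicField.isCyclotomicExtension m ℚ

/-- The character `a ↦ ζ_m ^ a` of `ℤ/m` with values in `ℚ(ζ_m)`. -/
noncomputable def rootChar : AddChar (ZMod m) (CyclotomicField m ℚ) :=
  AddChar.zmodChar m (IsCyclotomicExtension.zeta_spec m ℚ (CyclotomicField m ℚ)).pow_eq_one

/-- The automorphism `ζ_m ↦ ζ_m⁻¹` of `ℚ(ζ_m)`. -/
noncomputable def cycConj : CyclotomicField m ℚ ≃ₐ[ℚ] CyclotomicField m ℚ :=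
  (IsCyclotomicExtension.autEquivPow (CyclotomicField m ℚ)
    (cyclotomic.irreducible_rat (NeZero.pos m))).symm (-1)

/-- The `m`-dimensional representation of `H` over `ℚ(ζ_m)` in which `σ` maps `e_j` to `e_{j+1}`,
`τ` maps `e_j` to `ζ_m ^ j e_j` and `ζ` is the scalar `ζ_m⁻¹`. -/
noncomputable def heisMatrix : Heis m →* Matrix (ZMod m) (ZMod m) (CyclotomicField m ℚ) where
  toFun h := Matrix.of fun i j => if i = j + h.b then rootChar m (h.a * i - h.c) else 0
  map_one' := by
    ext i j
    change (if i = j + 0 then rootChar m (0 * i - 0) else 0) = _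
    simp [Matrix.one_apply]
  map_mul' h h' := by
    ext i l
    rw [Matrix.mul_apply]
    simp only [Matrix.of_apply, Heis.mul_def]
    rw [Finset.sum_eq_single (i - h.b)]
    · by_cases hi : i = l + (h.b + h'.b)
      · have h1 : i - h.b = l + h'.b := by rw [hi]; ring
        rw [if_pos hi, if_pos (by ring), if_pos h1, ← AddChar.map_add_eq_mul]
        congr 1
        ring
      · have h1 : ¬ (i - h.b = l + h'.b) := fun h2 => hi (by rw [← sub_add_cancel i h.b, h2]; ring)
        rw [if_neg hi, if_neg h1, mul_zero]
    · intro j _ hj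
      rw [if_neg (fun h2 => hj (by rw [h2]; ring)), zero_mul]
    · simp

/-- The induced homomorphism `ℚ[H] → M_m(ℚ(ζ_m))`. -/
noncomputable def heisAlg :
    MonoidAlgebra ℚ (Heis m) →ₐ[ℚ] Matrix (ZMod m) (ZMod m) (CyclotomicField m ℚ) :=
  MonoidAlgebra.lift ℚ _ _ (heisMatrix m)

/-- The homomorphism `ℚ[Q] → ℚ(ζ_m)`, `ζ ↦ ζ_m⁻¹`, the restriction of `heisAlg` to
the central subgroup `Q` (with scalar matrices identified with scalars). -/
noncomputable def cycAlg : MonoidAlgebra ℚ (CycQ m) →ₐ[ℚ] CyclotomicField m ℚ :=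
  MonoidAlgebra.lift ℚ _ _
    { toFun := fun q => rootChar m (-q.toAdd)
      map_one' := by simp
      map_mul' := fun q q' => by
        rw [← AddChar.map_add_eq_mul, toAdd_mul, neg_add] }

/-- The unitary group `{A | Aᵗ S Ā = S}` of a matrix `S` over `ℚ(ζ_m)`. -/
noncomputable def matrixUnitary {ι : Type} [Fintype ι] [DecidableEq ι]
    (S : Matrix ι ι (CyclotomicField m ℚ)) : Subgroup (GL ι (CyclotomicField m ℚ)) where
  carrier := {A | A.1.transpose * S * A.1.map (cycConj m) = S}
  one_mem' := by simp
  mul_mem' := by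
    intro A A' hA hA'
    simp only [Set.mem_ofPred_eq] at hA hA' ⊢
    rw [Units.val_mul, Matrix.transpose_mul, Matrix.map_mul]
    calc _ = A'.1.transpose * (A.1.transpose * S * A.1.map (cycConj m)) * A'.1.map (cycConj m) := by
            simp only [Matrix.mul_assoc]
      _ = S := by rw [hA, hA']
  inv_mem' := by
    intro A hA
    simp only [Set.mem_ofPred_eq] at hA ⊢
    have h1 : (A⁻¹).1.transpose * A.1.transpose = 1 := by
      rw [← Matrix.transpose_mul, ← Units.val_mul, mul_inv_cancel]; simp
    have h2 : A.1.map (cycConj m) * (A⁻¹).1.map (cycConj m) = 1 := by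
      rw [← Matrix.map_mul, ← Units.val_mul, mul_inv_cancel]; simp
    calc _ = (A⁻¹).1.transpose * (A.1.transpose * S * A.1.map (cycConj m)) *
              (A⁻¹).1.map (cycConj m) := by rw [hA]
      _ = ((A⁻¹).1.transpose * A.1.transpose) * S *
            (A.1.map (cycConj m) * (A⁻¹).1.map (cycConj m)) := by simp only [Matrix.mul_assoc]
      _ = S := by rw [h1, h2]; simp

variable (g : ℕ) {ι : Type}

/-- The Gram matrix of `⟨·,·⟩_H` for the vectors `x_a` of `M_m`, an `ι × ι` matrix over
`A_m`, as a matrix over `ℚ(ζ_m)` through `A_m ≅ M_m(ℚ(ζ_m))`. -/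
noncomputable def gramH (x : ι → topM g m ℚ) :
    Matrix (ι × ZMod m) (ι × ZMod m) (CyclotomicField m ℚ) :=
  Matrix.of fun p q =>
    heisAlg m (reidemeister (topMRep g m ℚ) (topMForm g m ℚ) (x p.1) (x q.1)) p.2 q.2

/-- The Gram matrix over `ℚ(ζ_m)` of `⟨·,·⟩_Q` for the vectors `y_p` of `N_m`. -/
noncomputable def gramQ (y : ι → topN g m ℚ) : Matrix ι ι (CyclotomicField m ℚ) :=
  Matrix.of fun p q =>
    cycAlg m (reidemeister (topNRep g m ℚ) (topNForm g m ℚ) (y p) (y q))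

end Cyclotomic

/-!
If `ζ` has order `m` on a representation `V` of the Heisenberg group, then conjugating `τ` by `σ^j`
multiplies it by a power of `ζ`, so `σ` permutes cyclically the eigenspaces of `τ` and
`V = ⨁ σ^j V^τ`. Everything about `V` is therefore determined by the representation `V^τ` of `⟨ζ⟩`:
an `H`-automorphism is `m` copies of its restriction, and the pairing of `V` is that of `V^τ`
repeated `m` times, because distinct summands are orthogonal. As the transfer multiplies the
intersection form by `m`, it identifies `N_m` with `M_m^τ` compatibly with the Reidemeister
pairings up to a rational factor. In terms of `A_m ≅ M_m(ℚ(ζ_m))` this is Morita equivalence: an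
`A_m`-basis `x_a` of `M_m` corresponds to the `ℚ(ζ_m)`-basis `E_{0i} x_a` of `E_{00} M_m = M_m^τ`,
with the same Gram matrix up to the factor `m²`.

For the rank, a Fourier transform along the orbits of `ζ` describes `N_m` by one element of
`ℚ(ζ_m)` for each of the `2gm` orbits of lifted edges. The faces of `Z` contribute no boundaries
since `ζ` preserves each of them, and the cycle conditions at the vertices reduce to `m` independent
linear equations, so `N_m` has dimension `(2g - 1)m`.
-/

/-! ### The character `ζ_m^a` and the trace of the cyclotomic field -/

section RootChar

variable (m : ℕ) [NeZero m]

instance isGalois_cyclotomicField_rat : IsGalois ℚ (CyclotomicField m ℚ) :=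
  IsCyclotomicExtension.isGalois {m} ℚ (CyclotomicField m ℚ)

theorem natCast_cyclotomicField_ne_zero : (m : CyclotomicField m ℚ) ≠ 0 :=
  Nat.cast_ne_zero.2 (NeZero.ne m)

theorem rootChar_apply (a : ZMod m) :
    rootChar m a = IsCyclotomicExtension.zeta m ℚ (CyclotomicField m ℚ) ^ a.val :=
  AddChar.zmodChar_apply _ _

theorem rootChar_one : rootChar m 1 = IsCyclotomicExtension.zeta m ℚ (CyclotomicField m ℚ) := by
  simpa [rootChar] using AddChar.zmodChar_apply'
    (IsCyclotomicExtension.zeta_spec m ℚ (CyclotomicField m ℚ)).pow_eq_one 1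

theorem rootChar_eq_one_iff {a : ZMod m} : rootChar m a = 1 ↔ a = 0 := by
  refine ⟨fun h => ?_, fun h => h ▸ AddChar.map_zero_eq_one _⟩
  rw [rootChar_apply, (IsCyclotomicExtension.zeta_spec m ℚ _).pow_eq_one_iff_dvd] at h
  rw [← ZMod.val_eq_zero]
  exact Nat.eq_zero_of_dvd_of_lt h (ZMod.val_lt a)

theorem rootChar_mul_rootChar_neg (a : ZMod m) : rootChar m a * rootChar m (-a) = 1 := by
  rw [← AddChar.map_add_eq_mul, add_neg_cancel, AddChar.map_zero_eq_one]

theorem isPrimitive_rootChar : (rootChar m).IsPrimitive :=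
  AddChar.zmodChar_primitive_of_primitive_root m
    (IsCyclotomicExtension.zeta_spec m ℚ (CyclotomicField m ℚ))

theorem sum_rootChar_mul (b : ZMod m) :
    ∑ a, rootChar m (a * b) = if b = 0 then (m : CyclotomicField m ℚ) else 0 := by
  rw [AddChar.sum_mulShift b (isPrimitive_rootChar m), ZMod.card, Nat.cast_ite, Nat.cast_zero]

theorem isPrimitiveRoot_rootChar_neg_one : IsPrimitiveRoot (rootChar m (-1)) m := by
  rw [AddChar.map_neg_eq_inv, rootChar_one]
  exact (IsCyclotomicExtension.zeta_spec m ℚ _).inv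

theorem rootChar_neg_one_pow (a : ZMod m) : rootChar m (-1) ^ a.val = rootChar m (-a) := by
  rw [← AddChar.map_nsmul_eq_pow, smul_neg, nsmul_one, ZMod.natCast_rightInverse]

theorem cyclotomic_eq_minpoly_rootChar_neg_one :
    cyclotomic m ℚ = minpoly ℚ (rootChar m (-1)) :=
  cyclotomic_eq_minpoly_rat (isPrimitiveRoot_rootChar_neg_one m) (NeZero.pos m)

theorem subalgebra_eq_top_of_rootChar_mem {S : Subalgebra ℚ (CyclotomicField m ℚ)}
    (hS : rootChar m (-1) ∈ S) : S = ⊤ := by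
  rw [eq_top_iff, ← IsCyclotomicExtension.adjoin_primitive_root_eq_top
    (isPrimitiveRoot_rootChar_neg_one m)]
  exact Algebra.adjoin_le (Set.singleton_subset_iff.2 hS)

theorem cycConj_rootChar (a : ZMod m) : cycConj m (rootChar m a) = rootChar m (-a) := by
  have hz := IsCyclotomicExtension.zeta_spec m ℚ (CyclotomicField m ℚ)
  have hpow : hz.autToPow ℚ (cycConj m) = -1 :=
    (IsCyclotomicExtension.autEquivPow (CyclotomicField m ℚ)
      (cyclotomic.irreducible_rat (NeZero.pos m))).apply_symm_apply (-1)
  have hspec := hz.autToPow_spec ℚ (cycConj m)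
  rw [hpow, ← rootChar_apply, Units.val_neg, Units.val_one] at hspec
  rw [rootChar_apply, map_pow, ← hspec, rootChar_neg_one_pow]

theorem algEquiv_eq_one_of_map_rootChar {φ : CyclotomicField m ℚ ≃ₐ[ℚ] CyclotomicField m ℚ}
    (h : ∀ a, φ (rootChar m a) = rootChar m a) : φ = 1 := by
  have hz := IsCyclotomicExtension.zeta_spec m ℚ (CyclotomicField m ℚ)
  refine AlgEquiv.coe_toAlgHom_injective ((hz.powerBasis ℚ).algHom_ext ?_)
  rw [IsPrimitiveRoot.powerBasis_gen, ← rootChar_one]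
  exact h 1

theorem sum_map_rootChar_mul_rootChar_neg
    (φ : CyclotomicField m ℚ ≃ₐ[ℚ] CyclotomicField m ℚ) [Decidable (φ = 1)] :
    ∑ j, φ (rootChar m j) * rootChar m (-j) = if φ = 1 then (m : CyclotomicField m ℚ) else 0 := by
  split_ifs with hφ
  · simp [hφ, rootChar_mul_rootChar_neg]
  · let ψ : AddChar (ZMod m) (CyclotomicField m ℚ) :=
      (φ : CyclotomicField m ℚ →* CyclotomicField m ℚ).compAddChar (rootChar m) * (rootChar m)⁻¹
    have hψ : ψ ≠ 1 := fun hψ => hφ (algEquiv_eq_one_of_map_rootChar m fun a => by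
      have h : φ (rootChar m a) * rootChar m (-a) = 1 := DFunLike.congr_fun hψ a
      rw [AddChar.map_neg_eq_inv] at h
      exact eq_of_mul_inv_eq_one h)
    exact AddChar.sum_eq_zero_of_ne_one hψ

theorem sum_trace_mul_rootChar (κ : CyclotomicField m ℚ) :
    ∑ j, ((Algebra.trace ℚ (CyclotomicField m ℚ) (κ * rootChar m j) : ℚ) : CyclotomicField m ℚ) *
      rootChar m (-j) = (m : CyclotomicField m ℚ) * κ := by
  classical
  have htrace (x : CyclotomicField m ℚ) :
      ((Algebra.trace ℚ (CyclotomicField m ℚ) x : ℚ) : CyclotomicField m ℚ) =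
        ∑ φ : CyclotomicField m ℚ ≃ₐ[ℚ] CyclotomicField m ℚ, φ x := by
    rw [← trace_eq_sum_automorphisms, eq_ratCast]
  simp only [htrace, map_mul, Finset.sum_mul, mul_assoc]
  rw [Finset.sum_comm]
  simp only [← Finset.mul_sum, sum_map_rootChar_mul_rootChar_neg]
  simp [mul_comm]

/-- The coefficients `Tr(ζ_m^j) / m` of the idempotent of `ℚ[ℤ/m]` that belongs to `ℚ(ζ_m)`. -/
noncomputable def idemCoeff (j : ZMod m) : ℚ :=
  Algebra.trace ℚ (CyclotomicField m ℚ) (rootChar m j) / m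

/-- The polynomial whose value at an operator of order dividing `m` is the projection to the part
where this operator has exact order `m`. -/
noncomputable def idemPoly : ℚ[X] := ∑ j : ZMod m, C (idemCoeff m j) * X ^ j.val

theorem aeval_idemPoly {A : Type*} [Ring A] [Algebra ℚ A] (z : A) :
    aeval z (idemPoly m) = ∑ j : ZMod m, idemCoeff m j • z ^ j.val := by
  simp [idemPoly, Algebra.smul_def]

theorem aeval_rootChar_idemPoly : aeval (rootChar m (-1)) (idemPoly m) = 1 := by
  have h := sum_trace_mul_rootChar m 1
  simp only [one_mul, mul_one] at h
  simp only [aeval_idemPoly, rootChar_neg_one_pow, Rat.smul_def, idemCoeff, Rat.cast_div,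
    Rat.cast_natCast, div_mul_eq_mul_div, ← Finset.sum_div, h]
  exact div_self (natCast_cyclotomicField_ne_zero m)

end RootChar

section CyclotomicOperator

variable {m : ℕ} [NeZero m] {k V : Type*} [CommRing k] [Algebra ℚ k] [AddCommGroup V] [Module k V]

theorem cyclotomic_dvd_sub_of_aeval_rootChar_eq {p q : ℚ[X]}
    (hpq : aeval (rootChar m (-1)) p = aeval (rootChar m (-1)) q) : cyclotomic m ℚ ∣ p - q := by
  rw [cyclotomic_eq_minpoly_rootChar_neg_one]
  exact minpoly.dvd _ _ (by rw [map_sub, hpq, sub_self])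

theorem aeval_map_apply_eq_of_aeval_rootChar_eq {T : Module.End k V} {v : V}
    (hT : aeval T (cyclotomic m k) v = 0) {p q : ℚ[X]}
    (hpq : aeval (rootChar m (-1)) p = aeval (rootChar m (-1)) q) :
    aeval T (p.map (algebraMap ℚ k)) v = aeval T (q.map (algebraMap ℚ k)) v := by
  obtain ⟨r, hr⟩ := cyclotomic_dvd_sub_of_aeval_rootChar_eq hpq
  rw [← sub_eq_zero, ← LinearMap.sub_apply, ← map_sub, ← Polynomial.map_sub, hr, mul_comm,
    Polynomial.map_mul, map_cyclotomic, map_mul, Module.End.mul_apply, hT, map_zero]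

theorem sum_smul_pow_apply_eq_zero_of_sum_rootChar {ι : Type*} [Fintype ι] {T : Module.End k V}
    {v : V} (hT : aeval T (cyclotomic m k) v = 0) (c : ι → ℚ) (n : ι → ZMod m)
    (hc : ∑ i, (c i : CyclotomicField m ℚ) * rootChar m (-n i) = 0) :
    ∑ i, algebraMap ℚ k (c i) • (T ^ (n i).val) v = 0 := by
  have h := aeval_map_apply_eq_of_aeval_rootChar_eq hT (p := ∑ i, C (c i) * X ^ (n i).val) (q := 0)
    (by simpa [rootChar_neg_one_pow] using hc)
  simpa only [Polynomial.map_sum, Polynomial.map_mul, map_C, Polynomial.map_pow, map_X, map_sum,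
    map_mul, aeval_C, map_pow, aeval_X, ← Algebra.smul_def, LinearMap.sum_apply,
    LinearMap.smul_apply, Polynomial.map_zero, map_zero, LinearMap.zero_apply] using h

end CyclotomicOperator

/-! ### The simple factors of the group algebras -/

section Factors

variable {G : Type} [Group G]

theorem sum_single_coeff {k M : Type*} [Semiring k] [Fintype M] (a : MonoidAlgebra k M) :
    ∑ g, MonoidAlgebra.single g (a.coeff g) = a := by
  classical
  ext g
  simp [MonoidAlgebra.coeff_sum]

theorem mem_topFactor_iff {k : Type} [CommRing k] {z : G} {m : ℕ} {a : MonoidAlgebra k G} :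
    a ∈ topFactor k z m ↔ aeval (MonoidAlgebra.of k G z) (cyclotomic m k) * a = 0 :=
  Iff.rfl

/-- The idempotent of `ℚ[G]` that projects to the factor on which `z` has order `m`. -/
noncomputable def topIdempotent (z : G) (m : ℕ) [NeZero m] : MonoidAlgebra ℚ G :=
  aeval (MonoidAlgebra.of ℚ G z) (idemPoly m)

variable {m : ℕ} [NeZero m] {z : G}

theorem topIdempotent_eq_sum :
    topIdempotent z m = ∑ j : ZMod m, MonoidAlgebra.single (z ^ j.val) (idemCoeff m j) := by
  simp [topIdempotent, aeval_idemPoly, MonoidAlgebra.single_pow]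

theorem topIdempotent_mul_of_mem_topFactor {a : MonoidAlgebra ℚ G} (ha : a ∈ topFactor ℚ z m) :
    topIdempotent z m * a = a := by
  have haeval (p : ℚ[X]) : aeval (LinearMap.mulLeft ℚ (MonoidAlgebra.of ℚ G z)) p a =
      aeval (MonoidAlgebra.of ℚ G z) p * a :=
    LinearMap.congr_fun (aeval_algHom_apply (Algebra.lmul ℚ (MonoidAlgebra ℚ G)) _ p) a
  have h := aeval_map_apply_eq_of_aeval_rootChar_eq (m := m)
    ((haeval _).trans (mem_topFactor_iff.1 ha)) (p := idemPoly m) (q := 1)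
    (by rw [aeval_rootChar_idemPoly, map_one])
  simpa only [topIdempotent, Algebra.algebraMap_self, Polynomial.map_id, haeval, map_one,
    Module.End.one_apply] using h

/-- The dual of a homomorphism `r : ℚ[G] → S` with respect to a functional `θ` on `S`, that is
`s ↦ ∑ θ(s r(g⁻¹)) g`. -/
noncomputable def dualSection [Fintype G] {S : Type*} [Ring S] [Algebra ℚ S]
    (r : MonoidAlgebra ℚ G →ₐ[ℚ] S) (θ : S →ₗ[ℚ] ℚ) : S →ₗ[ℚ] MonoidAlgebra ℚ G :=
  ∑ g, MonoidAlgebra.lsingle g ∘ₗ θ ∘ₗ LinearMap.mulRight ℚ (r (MonoidAlgebra.of ℚ G g⁻¹))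

section DualSection

variable [Fintype G] {S : Type*} [Ring S] [Algebra ℚ S] {r : MonoidAlgebra ℚ G →ₐ[ℚ] S}
  {θ : S →ₗ[ℚ] ℚ}

theorem dualSection_apply (s : S) : dualSection r θ s =
    ∑ g, MonoidAlgebra.single g (θ (s * r (MonoidAlgebra.of ℚ G g⁻¹))) := by
  simp [dualSection, LinearMap.sum_apply]

theorem dualSection_mul (s : S) (a : MonoidAlgebra ℚ G) :
    dualSection r θ (s * r a) = dualSection r θ s * a := by
  induction a using MonoidAlgebra.induction_on with
  | of h =>
    simp only [dualSection_apply, Finset.sum_mul, MonoidAlgebra.of_apply,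
      MonoidAlgebra.single_mul_single, mul_one, mul_assoc s, ← map_mul]
    refine (Fintype.sum_equiv (Equiv.mulRight h) _ _ fun g => ?_).symm
    simp
  | add a b ha hb => rw [map_add, mul_add, map_add, ha, hb, mul_add]
  | smul c a ha => rw [map_smul, mul_smul_comm, map_smul, ha, mul_smul_comm]

theorem bijOn_topFactor (hr : Function.Surjective r)
    (hz : aeval (r (MonoidAlgebra.of ℚ G z)) (cyclotomic m ℚ) = 0)
    (hθ : dualSection r θ 1 = topIdempotent z m) :
    Set.BijOn r (topFactor ℚ z m) Set.univ := by
  have hdual (a : MonoidAlgebra ℚ G) : dualSection r θ (r a) = topIdempotent z m * a := by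
    rw [← hθ, ← dualSection_mul, one_mul]
  have hinj : Set.InjOn r (topFactor ℚ z m) := fun a ha b hb hab => by
    rw [← topIdempotent_mul_of_mem_topFactor ha, ← topIdempotent_mul_of_mem_topFactor hb,
      ← hdual, ← hdual, hab]
  have hr_idem : r (topIdempotent z m) = 1 := by
    obtain ⟨q, hq⟩ := cyclotomic_dvd_sub_of_aeval_rootChar_eq (m := m) (p := idemPoly m) (q := 1)
      (by rw [aeval_rootChar_idemPoly, map_one])
    rw [topIdempotent, ← aeval_algHom_apply, sub_eq_iff_eq_add.1 hq, map_add, map_mul, hz,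
      zero_mul, zero_add, map_one]
  have hcomm : Commute (aeval (MonoidAlgebra.of ℚ G z) (cyclotomic m ℚ)) (topIdempotent z m) :=
    (Commute.all (cyclotomic m ℚ) (idemPoly m)).map (aeval (MonoidAlgebra.of ℚ G z))
  refine ⟨fun _ _ => Set.mem_univ _, hinj, fun s _ => ?_⟩
  obtain ⟨a, rfl⟩ := hr s
  refine ⟨topIdempotent z m * a, ?_, by rw [map_mul, hr_idem, one_mul]⟩
  rw [SetLike.mem_coe, mem_topFactor_iff, ← mul_assoc, hcomm.eq, mul_assoc, ← hdual, map_mul,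
    ← aeval_algHom_apply, hz, zero_mul, map_zero]

end DualSection

end Factors

section CyclicFactor

variable (m : ℕ) [NeZero m]

theorem CycQ.zeta_pow_val (j : ZMod m) : CycQ.zeta m ^ j.val = Multiplicative.ofAdd j := by
  rw [CycQ.zeta, ← ofAdd_nsmul, nsmul_one, ZMod.natCast_rightInverse]

theorem cycAlg_single (q : CycQ m) (r : ℚ) :
    cycAlg m (MonoidAlgebra.single q r) = (r : CyclotomicField m ℚ) * rootChar m (-q.toAdd) := by
  rw [cycAlg, MonoidAlgebra.lift_single, Rat.smul_def]
  rfl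

theorem cycAlg_zeta : cycAlg m (MonoidAlgebra.of ℚ _ (CycQ.zeta m)) = rootChar m (-1) := by
  simp [MonoidAlgebra.of_apply, cycAlg_single, CycQ.zeta]

theorem cycAlg_surjective : Function.Surjective (cycAlg m) := by
  rw [← AlgHom.range_eq_top]
  exact subalgebra_eq_top_of_rootChar_mem m ⟨_, cycAlg_zeta m⟩

theorem dualSection_cycAlg_one :
    dualSection (cycAlg m) ((m : ℚ)⁻¹ • Algebra.trace ℚ (CyclotomicField m ℚ)) 1 =
      topIdempotent (CycQ.zeta m) m := by
  rw [dualSection_apply, topIdempotent_eq_sum]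
  refine Fintype.sum_equiv Multiplicative.toAdd _ _ fun q => ?_
  simp [CycQ.zeta_pow_val, MonoidAlgebra.of_apply, cycAlg_single, idemCoeff, div_eq_inv_mul]

theorem cycAlg_bijOn : Set.BijOn (cycAlg m) (topFactor ℚ (CycQ.zeta m) m) Set.univ := by
  refine bijOn_topFactor (cycAlg_surjective m) ?_ (dualSection_cycAlg_one m)
  rw [cycAlg_zeta, cyclotomic_eq_minpoly_rootChar_neg_one, minpoly.aeval]

end CyclicFactor

section HeisenbergFactor

variable (m : ℕ)

theorem Heis.zeta_pow (n : ℕ) : Heis.zeta m ^ n = ⟨0, 0, n⟩ := by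
  induction n with
  | zero => rw [pow_zero, Nat.cast_zero]; rfl
  | succ n ih => rw [pow_succ, ih]; simp [Heis.mul_def, Heis.zeta]

variable [NeZero m]

theorem Heis.zeta_pow_val (j : ZMod m) : Heis.zeta m ^ j.val = ⟨0, 0, j⟩ := by
  rw [Heis.zeta_pow, ZMod.natCast_rightInverse]

theorem Heis.sum_eq {A : Type*} [AddCommMonoid A] (f : Heis m → A) :
    ∑ h, f h = ∑ b, ∑ a, ∑ c, f ⟨a, b, c⟩ := by
  rw [Fintype.sum_equiv (Heis.equivProd m) f (fun p => f ⟨p.1, p.2.1, p.2.2⟩) fun _ => rfl]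
  simp only [Fintype.sum_prod_type]
  rw [Finset.sum_comm]

theorem heisMatrix_apply (h : Heis m) (i j : ZMod m) :
    heisMatrix m h i j = if i = j + h.b then rootChar m (h.a * i - h.c) else 0 :=
  rfl

theorem heisAlg_single (h : Heis m) (r : ℚ) (i j : ZMod m) :
    heisAlg m (MonoidAlgebra.single h r) i j =
      if i = j + h.b then (r : CyclotomicField m ℚ) * rootChar m (h.a * i - h.c) else 0 := by
  simp [heisAlg, MonoidAlgebra.lift_single, heisMatrix_apply, Rat.smul_def]

theorem heisAlg_of (h : Heis m) : heisAlg m (MonoidAlgebra.of ℚ _ h) = heisMatrix m h :=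
  MonoidAlgebra.lift_of _ _

theorem trace_heisMatrix (h : Heis m) : (heisMatrix m h).trace =
    if h.a = 0 ∧ h.b = 0 then (m : CyclotomicField m ℚ) * rootChar m (-h.c) else 0 := by
  simp only [Matrix.trace, Matrix.diag_apply, heisMatrix_apply, left_eq_add, sub_eq_add_neg,
    AddChar.map_add_eq_mul, mul_comm h.a]
  by_cases hb : h.b = 0
  · simp only [hb, if_true, and_true, ← Finset.sum_mul, sum_rootChar_mul, ite_mul, zero_mul]
  · simp [hb]

theorem heisAlg_zeta : heisAlg m (MonoidAlgebra.of ℚ _ (Heis.zeta m)) =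
    algebraMap (CyclotomicField m ℚ) _ (rootChar m (-1)) := by
  ext i j
  rw [heisAlg_of, heisMatrix_apply, Matrix.algebraMap_matrix_apply]
  simp [Heis.zeta]

theorem algebraMap_mem_range_heisAlg (κ : CyclotomicField m ℚ) :
    algebraMap _ (Matrix (ZMod m) (ZMod m) (CyclotomicField m ℚ)) κ ∈ (heisAlg m).range := by
  have htop : (heisAlg m).range.comap (IsScalarTower.toAlgHom ℚ (CyclotomicField m ℚ) _) = ⊤ :=
    subalgebra_eq_top_of_rootChar_mem m ⟨_, heisAlg_zeta m⟩
  exact (Subalgebra.mem_comap _ _ _).1 (htop ▸ Algebra.mem_top)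

theorem single_eq_sum_mul_heisMatrix (i j : ZMod m) (κ : CyclotomicField m ℚ) :
    Matrix.single i j κ =
      ∑ a, algebraMap _ _ (κ / m * rootChar m (-(a * i))) * heisMatrix m ⟨a, i - j, 0⟩ := by
  ext l n
  have hterm (a : ZMod m) : (algebraMap _ (Matrix (ZMod m) (ZMod m) (CyclotomicField m ℚ))
      (κ / m * rootChar m (-(a * i))) * heisMatrix m ⟨a, i - j, 0⟩) l n =
      if l = n + (i - j) then κ / m * rootChar m (a * (l - i)) else 0 := by
    rw [Matrix.algebraMap_eq_diagonal, Matrix.diagonal_mul, heisMatrix_apply, mul_ite, mul_zero,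
      mul_sub, sub_zero, sub_eq_neg_add (a * l), AddChar.map_add_eq_mul, ← mul_assoc]
    rfl
  simp only [Matrix.sum_apply, hterm]
  rw [Matrix.single_apply]
  by_cases hl : l = i
  · have hn : j = n ↔ i = n + (i - j) := by rw [← sub_eq_iff_eq_add, sub_sub_cancel]
    simp [hl, hn, mul_div_cancel₀ κ (natCast_cyclotomicField_ne_zero m)]
  · simp [hl, Ne.symm hl, ← Finset.mul_sum, sum_rootChar_mul, sub_eq_zero]

theorem heisAlg_surjective : Function.Surjective (heisAlg m) := by
  intro s
  rw [← AlgHom.mem_range, Matrix.matrix_eq_sum_single s]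
  refine sum_mem fun i _ => sum_mem fun j _ => ?_
  rw [single_eq_sum_mul_heisMatrix]
  exact sum_mem fun a _ => mul_mem (algebraMap_mem_range_heisAlg m _) ⟨_, heisAlg_of m _⟩

theorem dualSection_heisAlg_one : dualSection (heisAlg m) (((m : ℚ) ^ 2)⁻¹ •
      (Algebra.trace ℚ (CyclotomicField m ℚ) ∘ₗ Matrix.traceLinearMap (ZMod m) ℚ _)) 1 =
    topIdempotent (Heis.zeta m) m := by
  have hcoeff (h : Heis m) : ((m : ℚ) ^ 2)⁻¹ *
      Algebra.trace ℚ (CyclotomicField m ℚ) (heisMatrix m h⁻¹).trace =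
      if h.a = 0 ∧ h.b = 0 then idemCoeff m h.c else 0 := by
    have hm : (m : ℚ) ≠ 0 := Nat.cast_ne_zero.2 (NeZero.ne m)
    rw [trace_heisMatrix, show h⁻¹ = ⟨-h.a, -h.b, -h.c + h.b * h.a⟩ from rfl]
    by_cases hh : h.a = 0 ∧ h.b = 0
    · simp only [hh, neg_zero, and_self, if_true, mul_zero, add_zero, neg_neg, ← nsmul_eq_mul,
        map_nsmul, idemCoeff]
      rw [nsmul_eq_mul]
      field_simp
    · simp [hh]
  simp only [dualSection_apply, topIdempotent_eq_sum, Heis.zeta_pow_val, one_mul, heisAlg_of,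
    LinearMap.smul_apply, LinearMap.comp_apply, Matrix.traceLinearMap_apply, smul_eq_mul, hcoeff]
  rw [Heis.sum_eq, Finset.sum_eq_single 0, Finset.sum_eq_single 0]
  all_goals simp +contextual

theorem heisAlg_bijOn : Set.BijOn (heisAlg m) (topFactor ℚ (Heis.zeta m) m) Set.univ := by
  refine bijOn_topFactor (heisAlg_surjective m) ?_ (dualSection_heisAlg_one m)
  rw [heisAlg_zeta, aeval_algebraMap_apply, cyclotomic_eq_minpoly_rootChar_neg_one,
    minpoly.aeval, map_zero]

end HeisenbergFactor

/-! ### Representations of the Heisenberg group and their `τ`-invariants -/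

section Reidemeister

variable {k G V : Type} [CommRing k] [Group G] [Fintype G] [AddCommGroup V] [Module k V]
  {ρ : Representation k G V} {B : LinearMap.BilinForm k V}

theorem coeff_reidemeister (x y : V) (g : G) :
    (reidemeister ρ B x y).coeff g = B x (ρ g y) := by
  classical
  simp [reidemeister, MonoidAlgebra.coeff_sum, Finsupp.single_apply]

theorem mem_reidAut_iff {f : V ≃ₗ[k] V} :
    f ∈ reidAut ρ B ↔ (∀ g x, f (ρ g x) = ρ g (f x)) ∧ ∀ x y, B (f x) (f y) = B x y := by
  refine and_congr_right fun hf => ⟨fun h x y => ?_, fun h x y => ?_⟩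
  · simpa only [coeff_reidemeister, map_one, Module.End.one_apply] using
      congrArg (fun a => a.coeff 1) (h x y)
  · ext g
    rw [coeff_reidemeister, coeff_reidemeister, ← hf, h]

end Reidemeister

theorem map_aeval_apply {k V N : Type*} [CommRing k] [AddCommGroup V] [Module k V] [AddCommGroup N]
    [Module k N] {t : N →ₗ[k] V} {A : Module.End k N} {A' : Module.End k V}
    (h : ∀ n, t (A n) = A' (t n)) (p : k[X]) (n : N) : t (aeval A p n) = aeval A' p (t n) := by
  have hpow (j : ℕ) : t ((A ^ j) n) = (A' ^ j) (t n) :=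
    (LinearMap.congr_fun (Module.End.commute_pow_left_of_commute (LinearMap.ext fun n => (h n).symm)
      j) n).symm
  simp only [aeval_eq_sum_range, LinearMap.sum_apply, LinearMap.smul_apply, map_sum, map_smul, hpow]

theorem isUnit_natCast_of_ratAlgebra (m : ℕ) [NeZero m] (k : Type*) [CommRing k] [Algebra ℚ k] :
    IsUnit (m : k) := by
  have h : IsUnit (m : ℚ) := (Nat.cast_ne_zero.2 (NeZero.ne m)).isUnit
  simpa using h.map (algebraMap ℚ k)

theorem Heis.tau_pow (m n : ℕ) : Heis.tau m ^ n = ⟨n, 0, 0⟩ := by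
  induction n with
  | zero => rw [pow_zero, Nat.cast_zero]; rfl
  | succ n ih => rw [pow_succ, ih]; simp [Heis.mul_def, Heis.tau]

section HeisenbergRepresentation

variable {m : ℕ} {k V : Type*} [CommRing k] [AddCommGroup V] [Module k V]
  {ρ : Representation k (Heis m) V}

theorem rho_zero_apply (v : V) : ρ ⟨0, 0, 0⟩ v = v :=
  LinearMap.congr_fun ρ.map_one v

variable [NeZero m]

theorem rho_tau_pow_apply_of_fixed {v : V} (hv : ρ (Heis.tau m) v = v) (a : ZMod m) :
    ρ ⟨a, 0, 0⟩ v = v := by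
  rw [← ZMod.natCast_zmod_val a, ← Heis.tau_pow, map_pow, Module.End.pow_apply]
  exact Function.iterate_fixed hv _

theorem sum_rho_zeta_mul [Algebra ℚ k] (hρ : aeval (ρ (Heis.zeta m)) (cyclotomic m k) = 0)
    (l : ZMod m) (v : V) :
    ∑ a, ρ ⟨0, 0, a * l⟩ v = if l = 0 then (m : k) • v else 0 := by
  split_ifs with hl
  · simp [hl, rho_zero_apply, Nat.cast_smul_eq_nsmul]
  · have h := sum_smul_pow_apply_eq_zero_of_sum_rootChar (T := ρ (Heis.zeta m)) (v := v)
      (by rw [hρ, LinearMap.zero_apply]) (fun _ => 1) (fun a => a * l) (by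
        simp only [← mul_neg, Rat.cast_one, one_mul, sum_rootChar_mul, neg_eq_zero, if_neg hl])
    simpa [← map_pow, Heis.zeta_pow_val] using h

variable (ρ) in
/-- The operator `∑ τ^a`, which is `m` times the projection to the `τ`-invariants. -/
noncomputable def tauSum : Module.End k V :=
  ∑ a : ZMod m, ρ ⟨a, 0, 0⟩

theorem tauSum_apply (v : V) : tauSum ρ v = ∑ a, ρ ⟨a, 0, 0⟩ v := by
  rw [tauSum, LinearMap.sum_apply]

theorem rho_tau_tauSum (v : V) : ρ (Heis.tau m) (tauSum ρ v) = tauSum ρ v := by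
  rw [tauSum_apply, map_sum]
  refine Fintype.sum_equiv (Equiv.addLeft 1) _ _ fun a => ?_
  rw [← Module.End.mul_apply, ← map_mul]
  simp [Heis.mul_def, Heis.tau]

theorem sum_rho_sigma_tauSum [Algebra ℚ k] (hρ : aeval (ρ (Heis.zeta m)) (cyclotomic m k) = 0)
    (v : V) : ∑ j, ρ ⟨0, j, 0⟩ (tauSum ρ (ρ ⟨0, -j, 0⟩ v)) = (m : k) • v := by
  have hcomm (j a : ZMod m) : ρ ⟨0, j, 0⟩ (ρ ⟨a, 0, 0⟩ (ρ ⟨0, -j, 0⟩ v)) =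
      ρ ⟨a, 0, 0⟩ (ρ ⟨0, 0, j * a⟩ v) := by
    simp only [← Module.End.mul_apply, ← map_mul]
    congr 2
    ext <;> simp [Heis.mul_def]
  simp only [tauSum_apply, map_sum, hcomm]
  rw [Finset.sum_comm]
  simp only [← map_sum, sum_rho_zeta_mul hρ]
  simp [apply_ite, rho_zero_apply]

end HeisenbergRepresentation

section Descent

variable {m : ℕ} {k V N : Type} [CommRing k] [AddCommGroup V] [Module k V]
  [AddCommGroup N] [Module k N]

/-- The map `t` identifies the representation `ρ'` of `⟨ζ⟩` with the `τ`-invariants of the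
representation `ρ` of the Heisenberg group, on which `ζ` acts with order `m`. -/
structure IsTauDescent (ρ : Representation k (Heis m) V) (ρ' : Representation k (CycQ m) N)
    (t : N →ₗ[k] V) : Prop where
  cyclotomic_zeta : aeval (ρ (Heis.zeta m)) (cyclotomic m k) = 0
  injective : Function.Injective t
  mem_range_iff : ∀ v, v ∈ LinearMap.range t ↔ ρ (Heis.tau m) v = v
  zeta_apply : ∀ n, t (ρ' (CycQ.zeta m) n) = ρ (Heis.zeta m) (t n)

namespace IsTauDescent

variable {ρ : Representation k (Heis m) V} {ρ' : Representation k (CycQ m) N} {t : N →ₗ[k] V}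

theorem cyclotomic_zeta' (H : IsTauDescent ρ ρ' t) :
    aeval (ρ' (CycQ.zeta m)) (cyclotomic m k) = 0 := by
  ext n
  apply H.injective
  rw [map_aeval_apply H.zeta_apply, H.cyclotomic_zeta, LinearMap.zero_apply, LinearMap.zero_apply,
    map_zero]

variable [NeZero m]

theorem rho_zeta_pow_apply (H : IsTauDescent ρ ρ' t) (c : ZMod m) (n : N) :
    ρ ⟨0, 0, c⟩ (t n) = t (ρ' (Multiplicative.ofAdd c) n) := by
  have h := map_aeval_apply H.zeta_apply (X ^ c.val) n
  rw [map_pow, map_pow, aeval_X, aeval_X, ← map_pow, ← map_pow, Heis.zeta_pow_val,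
    CycQ.zeta_pow_val] at h
  exact h.symm

theorem rho_tau_pow_apply (H : IsTauDescent ρ ρ' t) (a : ZMod m) (n : N) :
    ρ ⟨a, 0, 0⟩ (t n) = t n :=
  rho_tau_pow_apply_of_fixed ((H.mem_range_iff _).1 ⟨n, rfl⟩) a

theorem rho_rho_sigma_apply (H : IsTauDescent ρ ρ' t) (h : Heis m) (j : ZMod m) (n : N) :
    ρ h (ρ ⟨0, j, 0⟩ (t n)) =
      ρ ⟨0, j + h.b, 0⟩ (t (ρ' (Multiplicative.ofAdd (h.c - h.a * (j + h.b))) n)) := by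
  rw [← H.rho_zeta_pow_apply]
  conv_rhs => rw [← H.rho_tau_pow_apply h.a n]
  simp only [← Module.End.mul_apply, ← map_mul]
  congr 2
  ext <;> simp only [Heis.mul_def] <;> ring

variable (ρ t) in
/-- The map `(n_j) ↦ ∑ σ^j t(n_j)`. -/
noncomputable def sumMap : (ZMod m → N) →ₗ[k] V :=
  ∑ j, ρ ⟨0, j, 0⟩ ∘ₗ t ∘ₗ LinearMap.proj j

theorem sumMap_apply (f : ZMod m → N) : sumMap ρ t f = ∑ j, ρ ⟨0, j, 0⟩ (t (f j)) := by
  simp [sumMap, LinearMap.sum_apply]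

variable [Algebra ℚ k]

theorem sum_rho'_mul (H : IsTauDescent ρ ρ' t) (l : ZMod m) (n : N) :
    ∑ a, ρ' (Multiplicative.ofAdd (a * l)) n = if l = 0 then (m : k) • n else 0 := by
  apply H.injective
  rw [map_sum]
  simp only [← H.rho_zeta_pow_apply, sum_rho_zeta_mul H.cyclotomic_zeta]
  split_ifs <;> simp

theorem tauSum_rho_sigma_apply (H : IsTauDescent ρ ρ' t) (j : ZMod m) (n : N) :
    tauSum ρ (ρ ⟨0, j, 0⟩ (t n)) = if j = 0 then (m : k) • t n else 0 := by
  have h := congrArg (fun v => ρ ⟨0, j, 0⟩ (t v)) (H.sum_rho'_mul (-j) n)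
  simp only [tauSum_apply, H.rho_rho_sigma_apply, add_zero, zero_sub, ← mul_neg]
  rw [← map_sum, ← map_sum, h]
  split_ifs with hj hj' hj'
  all_goals simp_all [rho_zero_apply]

theorem tauSum_rho_neg_sumMap (H : IsTauDescent ρ ρ' t) (f : ZMod m → N) (i : ZMod m) :
    tauSum ρ (ρ ⟨0, -i, 0⟩ (sumMap ρ t f)) = (m : k) • t (f i) := by
  simp only [sumMap_apply, map_sum, H.rho_rho_sigma_apply, H.tauSum_rho_sigma_apply,
    add_neg_eq_zero]
  simp

theorem sumMap_injective (H : IsTauDescent ρ ρ' t) : Function.Injective (sumMap ρ t) := by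
  intro f f' hff'
  ext i
  have h := H.tauSum_rho_neg_sumMap f i
  rw [hff', H.tauSum_rho_neg_sumMap, (isUnit_natCast_of_ratAlgebra m k).smul_left_cancel] at h
  exact H.injective h.symm

theorem sumMap_surjective (H : IsTauDescent ρ ρ' t) : Function.Surjective (sumMap ρ t) := by
  intro v
  choose f hf using fun j => (H.mem_range_iff _).2 (rho_tau_tauSum (ρ := ρ) (ρ ⟨0, -j, 0⟩ v))
  have hsum : sumMap ρ t f = (m : k) • v := by
    simp only [sumMap_apply, hf, sum_rho_sigma_tauSum H.cyclotomic_zeta]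
  obtain ⟨r, hr⟩ := (isUnit_natCast_of_ratAlgebra m k).exists_left_inv
  exact ⟨r • f, by rw [map_smul, hsum, smul_smul, hr, one_smul]⟩

/-- The decomposition of `V` as the direct sum of the `σ^j t(N)`. -/
noncomputable def decomp (H : IsTauDescent ρ ρ' t) : (ZMod m → N) ≃ₗ[k] V :=
  LinearEquiv.ofBijective (sumMap ρ t) ⟨H.sumMap_injective, H.sumMap_surjective⟩

theorem decomp_apply (H : IsTauDescent ρ ρ' t) (f : ZMod m → N) :
    H.decomp f = ∑ j, ρ ⟨0, j, 0⟩ (t (f j)) :=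
  sumMap_apply f

theorem decomp_single (H : IsTauDescent ρ ρ' t) (j : ZMod m) (n : N) :
    H.decomp (Pi.single j n) = ρ ⟨0, j, 0⟩ (t n) := by
  rw [decomp_apply, Finset.sum_eq_single j]
  · rw [Pi.single_eq_same]
  · intro i _ hi
    rw [Pi.single_eq_of_ne hi, map_zero, map_zero]
  · simp

theorem exists_eq_sum (H : IsTauDescent ρ ρ' t) (v : V) :
    ∃ f : ZMod m → N, v = ∑ j, ρ ⟨0, j, 0⟩ (t (f j)) :=
  ⟨H.decomp.symm v, by rw [← H.decomp_apply, LinearEquiv.apply_symm_apply]⟩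

theorem equivariant_ext (H : IsTauDescent ρ ρ' t) {f f' : V →ₗ[k] V}
    (hf : ∀ h x, f (ρ h x) = ρ h (f x)) (hf' : ∀ h x, f' (ρ h x) = ρ h (f' x))
    (hff' : ∀ n, f (t n) = f' (t n)) : f = f' := by
  ext v
  obtain ⟨c, rfl⟩ := H.exists_eq_sum v
  simp only [map_sum, hf, hf', hff']

section Form

variable {B : LinearMap.BilinForm k V} {B' : LinearMap.BilinForm k N}

theorem form_rho_sigma (H : IsTauDescent ρ ρ' t)
    (hB : ∀ h x y, B (ρ h x) (ρ h y) = B x y) (hBt : ∀ x y, B (t x) (t y) = (m : k) * B' x y)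
    (i j : ZMod m) (n n' : N) :
    B (ρ ⟨0, i, 0⟩ (t n)) (ρ ⟨0, j, 0⟩ (t n')) = if i = j then (m : k) * B' n n' else 0 := by
  split_ifs with hij
  · rw [hij, hB, hBt]
  · have htwist (a : ZMod m) : B (ρ ⟨0, i, 0⟩ (t n)) (ρ ⟨0, j, 0⟩ (t n')) =
        B (ρ ⟨0, i, 0⟩ (t n)) (ρ ⟨0, j, 0⟩ (t (ρ' (Multiplicative.ofAdd (a * (i - j))) n'))) := by
      rw [← hB ⟨a, 0, a * i⟩, H.rho_rho_sigma_apply, H.rho_rho_sigma_apply]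
      simp only [add_zero, sub_self, ofAdd_zero, map_one, Module.End.one_apply, mul_sub]
    refine (isUnit_natCast_of_ratAlgebra m k).mul_right_eq_zero.1 ?_
    calc (m : k) * B (ρ ⟨0, i, 0⟩ (t n)) (ρ ⟨0, j, 0⟩ (t n'))
        = ∑ _a : ZMod m, B (ρ ⟨0, i, 0⟩ (t n)) (ρ ⟨0, j, 0⟩ (t n')) := by simp
      _ = B (ρ ⟨0, i, 0⟩ (t n)) (ρ ⟨0, j, 0⟩
            (t (∑ a, ρ' (Multiplicative.ofAdd (a * (i - j))) n'))) := by
          simp only [map_sum, ← htwist]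
      _ = 0 := by rw [H.sum_rho'_mul, if_neg (sub_ne_zero.2 hij), map_zero, map_zero, map_zero]

theorem form_rho' (H : IsTauDescent ρ ρ' t)
    (hB : ∀ h x y, B (ρ h x) (ρ h y) = B x y) (hBt : ∀ x y, B (t x) (t y) = (m : k) * B' x y)
    (q : CycQ m) (x y : N) : B' (ρ' q x) (ρ' q y) = B' x y := by
  have h := hB ⟨0, 0, q.toAdd⟩ (t x) (t y)
  rw [H.rho_zeta_pow_apply, H.rho_zeta_pow_apply, hBt, hBt] at h
  exact (isUnit_natCast_of_ratAlgebra m k).mul_left_cancel h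

theorem exists_restrict (H : IsTauDescent ρ ρ' t) (hBt : ∀ x y, B (t x) (t y) = (m : k) * B' x y)
    {f : V ≃ₗ[k] V} (hf : f ∈ reidAut ρ B) :
    ∃ f' ∈ reidAut ρ' B', ∀ n, t (f' n) = f (t n) := by
  obtain ⟨hf_comm, hf_form⟩ := mem_reidAut_iff.1 hf
  have hrange : (LinearMap.range t).map f.toLinearMap = LinearMap.range t := by
    ext v
    rw [Submodule.mem_map_equiv, H.mem_range_iff, H.mem_range_iff, ← f.injective.eq_iff, hf_comm,
      LinearEquiv.apply_symm_apply]
  let e := LinearEquiv.ofInjective t H.injective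
  let f' : N ≃ₗ[k] N := e ≪≫ₗ f.ofSubmodules _ _ hrange ≪≫ₗ e.symm
  have hf' (n : N) : t (f' n) = f (t n) :=
    LinearEquiv.ofInjective_symm_apply (f := t) (h := H.injective) _
  refine ⟨f', mem_reidAut_iff.2 ⟨fun q x => ?_, fun x y => ?_⟩, hf'⟩
  · apply H.injective
    rw [← ofAdd_toAdd q, ← H.rho_zeta_pow_apply, hf', hf', ← H.rho_zeta_pow_apply, hf_comm]
  · apply (isUnit_natCast_of_ratAlgebra m k).mul_left_cancel
    rw [← hBt, hf', hf', hf_form, hBt]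

theorem exists_extend (H : IsTauDescent ρ ρ' t)
    (hB : ∀ h x y, B (ρ h x) (ρ h y) = B x y) (hBt : ∀ x y, B (t x) (t y) = (m : k) * B' x y)
    {f' : N ≃ₗ[k] N} (hf' : f' ∈ reidAut ρ' B') :
    ∃ f ∈ reidAut ρ B, ∀ n, t (f' n) = f (t n) := by
  obtain ⟨hf'_comm, hf'_form⟩ := mem_reidAut_iff.1 hf'
  let f : V ≃ₗ[k] V := H.decomp.symm ≪≫ₗ LinearEquiv.piCongrRight (fun _ => f') ≪≫ₗ H.decomp
  have hf (j : ZMod m) (n : N) : f (ρ ⟨0, j, 0⟩ (t n)) = ρ ⟨0, j, 0⟩ (t (f' n)) := by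
    rw [← H.decomp_single, ← H.decomp_single]
    simp only [f, LinearEquiv.trans_apply, LinearEquiv.symm_apply_apply]
    congr 1
    ext i
    exact Pi.apply_single (fun _ => f') (fun _ => map_zero f') j n i
  refine ⟨f, mem_reidAut_iff.2 ⟨fun h x => ?_, fun x y => ?_⟩, fun n => ?_⟩
  · obtain ⟨c, rfl⟩ := H.exists_eq_sum x
    simp only [map_sum, H.rho_rho_sigma_apply, hf, hf'_comm]
  · obtain ⟨c, rfl⟩ := H.exists_eq_sum x
    obtain ⟨c', rfl⟩ := H.exists_eq_sum y
    simp only [map_sum, LinearMap.sum_apply, hf, H.form_rho_sigma hB hBt, hf'_form]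
  · simpa only [rho_zero_apply] using (hf 0 n).symm

theorem exists_mulEquiv (H : IsTauDescent ρ ρ' t)
    (hB : ∀ h x y, B (ρ h x) (ρ h y) = B x y) (hBt : ∀ x y, B (t x) (t y) = (m : k) * B' x y) :
    ∃ α : reidAut ρ B ≃* reidAut ρ' B',
      ∀ (f : reidAut ρ B) (n : N), t ((α f).1 n) = f.1 (t n) := by
  choose r hr hrt using fun f : reidAut ρ B => H.exists_restrict hBt f.2
  let α : reidAut ρ B →* reidAut ρ' B' := MonoidHom.mk' (fun f => ⟨r f, hr f⟩) fun f f' =>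
    Subtype.ext (LinearEquiv.ext fun n => H.injective ((hrt (f * f') n).trans (by
      rw [Subgroup.coe_mul, LinearEquiv.mul_apply, ← hrt f', ← hrt f]
      rfl)))
  have hα (f : reidAut ρ B) (n : N) : t ((α f).1 n) = f.1 (t n) := hrt f n
  have hinj : Function.Injective α := fun f f' hff' =>
    Subtype.ext (LinearEquiv.toLinearMap_injective (H.equivariant_ext f.2.1 f'.2.1 fun n => by
      rw [LinearEquiv.coe_coe, LinearEquiv.coe_coe, ← hα, ← hα, hff']))
  have hsurj : Function.Surjective α := fun f' => by
    obtain ⟨f, hf, hft⟩ := H.exists_extend hB hBt f'.2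
    exact ⟨⟨f, hf⟩, Subtype.ext (LinearEquiv.ext fun n =>
      H.injective ((hα ⟨f, hf⟩ n).trans (hft n).symm))⟩
  exact ⟨MulEquiv.ofBijective α ⟨hinj, hsurj⟩, hα⟩

end Form

end IsTauDescent

end Descent

/-! ### Sesquilinearity of the Reidemeister pairing -/

theorem map_asAlgebraHom_of_equivariant {k G V : Type*} [CommRing k] [Group G] [AddCommGroup V]
    [Module k V] {ρ : Representation k G V} {f : V →ₗ[k] V} (hf : ∀ g x, f (ρ g x) = ρ g (f x))
    (a : MonoidAlgebra k G) (x : V) : f (ρ.asAlgebraHom a x) = ρ.asAlgebraHom a (f x) := by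
  induction a using MonoidAlgebra.induction_linear with
  | zero => simp
  | add a b ha hb => simp [ha, hb]
  | single g r => simp [Representation.asAlgebraHom_single, hf]

section Sesquilinear

variable {k G V : Type} [CommRing k] [Group G] [Fintype G] [AddCommGroup V] [Module k V]
  (ρ : Representation k G V) (B : LinearMap.BilinForm k V)

/-- The Reidemeister pairing as a `k`-bilinear map. -/
noncomputable def reidBilin : V →ₗ[k] V →ₗ[k] MonoidAlgebra k G :=
  LinearMap.mk₂ k (reidemeister ρ B)
    (fun x x' y => by simp [reidemeister, MonoidAlgebra.single_add, Finset.sum_add_distrib])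
    (fun r x y => by simp [reidemeister, Finset.smul_sum])
    (fun x y y' => by simp [reidemeister, MonoidAlgebra.single_add, Finset.sum_add_distrib])
    (fun r x y => by simp [reidemeister, Finset.smul_sum])

theorem reidBilin_apply (x y : V) : reidBilin ρ B x y = reidemeister ρ B x y := rfl

variable {ρ B}

theorem reidemeister_smul_left (hB : ∀ g x y, B (ρ g x) (ρ g y) = B x y)
    (a : MonoidAlgebra k G) (x y : V) :
    reidemeister ρ B (ρ.asAlgebraHom a x) y = a * reidemeister ρ B x y := by
  rw [← sum_single_coeff a, map_sum, LinearMap.sum_apply, ← reidBilin_apply, map_sum,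
    LinearMap.sum_apply, Finset.sum_mul]
  refine Finset.sum_congr rfl fun g _ => ?_
  rw [Representation.asAlgebraHom_single, LinearMap.smul_apply, map_smul, LinearMap.smul_apply,
    reidBilin_apply, reidemeister, reidemeister, Finset.smul_sum, Finset.mul_sum]
  refine Fintype.sum_equiv (Equiv.mulLeft g⁻¹) _ _ fun h => ?_
  rw [MonoidAlgebra.smul_single, MonoidAlgebra.single_mul_single, smul_eq_mul, Equiv.coe_mulLeft,
    mul_inv_cancel_left, ← hB g x, ← Module.End.mul_apply (ρ g), ← map_mul, mul_inv_cancel_left]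

theorem reidemeister_smul_right (a : MonoidAlgebra k G) (x y : V) :
    reidemeister ρ B x (ρ.asAlgebraHom a y) =
      reidemeister ρ B x y * ∑ g, MonoidAlgebra.single g⁻¹ (a.coeff g) := by
  conv_lhs => rw [← sum_single_coeff a]
  rw [map_sum, LinearMap.sum_apply, ← reidBilin_apply, map_sum, Finset.mul_sum]
  refine Finset.sum_congr rfl fun g _ => ?_
  rw [Representation.asAlgebraHom_single, LinearMap.smul_apply, map_smul,
    reidBilin_apply, reidemeister, reidemeister, Finset.smul_sum, Finset.sum_mul]
  refine Fintype.sum_equiv (Equiv.mulRight g) _ _ fun h => ?_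
  rw [MonoidAlgebra.smul_single, MonoidAlgebra.single_mul_single, smul_eq_mul, Equiv.coe_mulRight,
    mul_inv_cancel_right, map_mul, Module.End.mul_apply, mul_comm]

theorem reidemeister_mem_topFactor (hB : ∀ g x y, B (ρ g x) (ρ g y) = B x y) {z : G} {m : ℕ}
    (hz : aeval (ρ z) (cyclotomic m k) = 0) (x y : V) :
    reidemeister ρ B x y ∈ topFactor k z m := by
  rw [mem_topFactor_iff, ← reidemeister_smul_left hB, ← aeval_algHom_apply, MonoidAlgebra.of_apply,
    Representation.asAlgebraHom_single_one, hz, ← reidBilin_apply, LinearMap.zero_apply, map_zero,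
    LinearMap.zero_apply]

end Sesquilinear

section Involution

variable (m : ℕ) [NeZero m]

theorem cycAlg_inv (a : MonoidAlgebra ℚ (CycQ m)) :
    cycAlg m (∑ g, MonoidAlgebra.single g⁻¹ (a.coeff g)) = cycConj m (cycAlg m a) := by
  conv_rhs => rw [← sum_single_coeff a]
  simp only [map_sum, cycAlg_single, map_mul, map_ratCast, cycConj_rootChar, toAdd_inv]

theorem heisAlg_inv (a : MonoidAlgebra ℚ (Heis m)) :
    heisAlg m (∑ g, MonoidAlgebra.single g⁻¹ (a.coeff g)) =
      (heisAlg m a).transpose.map (cycConj m) := by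
  ext i j
  conv_rhs => rw [← sum_single_coeff a]
  simp only [map_sum, Matrix.sum_apply, Matrix.map_apply, Matrix.transpose_apply, heisAlg_single]
  refine Finset.sum_congr rfl fun h _ => ?_
  have hinv : h⁻¹ = ⟨-h.a, -h.b, -h.c + h.b * h.a⟩ := rfl
  rw [hinv]
  by_cases hij : j = i + h.b
  · subst hij
    rw [if_pos rfl, if_pos (by ring), map_mul, map_ratCast, cycConj_rootChar]
    congr 2
    ring
  · rw [if_neg hij, if_neg (fun h1 => hij (by rw [h1]; ring)), map_zero]

end Involution

/-! ### Modules over the simple factors -/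

section FactorAction

variable {G V S : Type} [Group G] [AddCommGroup V] [Module ℚ V] [Ring S] [Algebra ℚ S]
  {ρ : Representation ℚ G V} {r : MonoidAlgebra ℚ G →ₐ[ℚ] S}

/-- The action of a quotient `r : ℚ[G] → S` of the group algebra on a representation that
factors through it. -/
noncomputable def factorAction (hr : Function.Surjective r)
    (hρ : ∀ a, r a = 0 → ρ.asAlgebraHom a = 0) : S →ₐ[ℚ] Module.End ℚ V :=
  { r.toRingHom.liftOfSurjective hr ⟨ρ.asAlgebraHom.toRingHom, hρ⟩ with
    commutes' := fun c => by
      rw [← r.commutes, ← ρ.asAlgebraHom.commutes]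
      exact RingHom.liftOfSurjective_comp_apply r.toRingHom hr
        ⟨ρ.asAlgebraHom.toRingHom, hρ⟩ (algebraMap ℚ _ c) }

theorem factorAction_apply (hr : Function.Surjective r)
    (hρ : ∀ a, r a = 0 → ρ.asAlgebraHom a = 0) (a : MonoidAlgebra ℚ G) :
    factorAction hr hρ (r a) = ρ.asAlgebraHom a :=
  RingHom.liftOfSurjective_comp_apply r.toRingHom hr ⟨ρ.asAlgebraHom.toRingHom, hρ⟩ a

theorem map_factorAction_of_equivariant (hr : Function.Surjective r)
    (hρ : ∀ a, r a = 0 → ρ.asAlgebraHom a = 0) {f : V →ₗ[ℚ] V}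
    (hf : ∀ g x, f (ρ g x) = ρ g (f x)) (s : S) (v : V) :
    f (factorAction hr hρ s v) = factorAction hr hρ s (f v) := by
  obtain ⟨a, rfl⟩ := hr s
  rw [factorAction_apply, map_asAlgebraHom_of_equivariant hf]

theorem isFactorBasis_iff {ι : Type} [Fintype ι] {z : G} {m : ℕ}
    (hr : Set.BijOn r (topFactor ℚ z m) Set.univ) {act : S →ₐ[ℚ] Module.End ℚ V}
    (hact : ∀ a, act (r a) = ρ.asAlgebraHom a) (x : ι → V) :
    IsFactorBasis ρ z m x ↔ Function.Bijective fun s : ι → S => ∑ i, act (s i) (x i) := by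
  let e : (ι → topFactor ℚ z m) ≃ (ι → S) :=
    Equiv.piCongrRight fun _ => (hr.equiv r).trans (Equiv.Set.univ S)
  have hcomp : (fun a : ι → topFactor ℚ z m => ∑ i, ρ.asAlgebraHom (a i).1 (x i)) =
      (fun s : ι → S => ∑ i, act (s i) (x i)) ∘ e := by
    ext a
    exact Finset.sum_congr rfl fun i _ => by rw [← hact]; rfl
  rw [IsFactorBasis, hcomp, e.bijective.of_comp_iff]

end FactorAction

section MatrixGroup

variable {K N ι : Type} [CommRing K] [AddCommGroup N] [Module K N] [Fintype ι] [DecidableEq ι]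
  {y : ι → N}

theorem exists_mulEquiv_generalLinear (hy : Function.Bijective fun κ : ι → K => ∑ p, κ p • y p) :
    ∃ Ω : (N ≃ₗ[K] N) ≃* GL ι K, ∀ φ q, φ (y q) = ∑ p, (Ω φ).1 p q • y p := by
  let L : (ι → K) ≃ₗ[K] N := LinearEquiv.ofBijective (Fintype.linearCombination K y) hy
  let b : Module.Basis ι K N := Module.Basis.ofEquivFun L.symm
  have hb (p : ι) : b p = y p := by
    rw [Module.Basis.coe_ofEquivFun, LinearEquiv.symm_symm]
    exact (Fintype.linearCombination_apply_single K y p 1).trans (one_smul K (y p))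
  refine ⟨(LinearMap.GeneralLinearGroup.generalLinearEquiv K N).symm.trans
    (Units.mapEquiv (LinearMap.toMatrixAlgEquiv b).toMulEquiv), fun φ q => ?_⟩
  have hφ := b.sum_repr (φ (b q))
  simp only [hb] at hφ
  refine hφ.symm.trans (Finset.sum_congr rfl fun p _ => ?_)
  rw [← hb q]
  exact congrArg (· • y p) (LinearMap.toMatrixAlgEquiv_apply b φ.toLinearMap p q).symm

theorem exists_mulEquiv_of_mem_iff [Module ℚ N]
    (hy : Function.Bijective fun κ : ι → K => ∑ p, κ p • y p)
    {R : Subgroup (N ≃ₗ[ℚ] N)} {P : Subgroup (GL ι K)}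
    (hR : ∀ f ∈ R, ∀ (κ : K) (n : N), f (κ • n) = κ • f n)
    (hRP : ∀ (f : N ≃ₗ[ℚ] N) (A : GL ι K), (∀ (κ : K) (n : N), f (κ • n) = κ • f n) →
      (∀ q, f (y q) = ∑ p, A.1 p q • y p) → (f ∈ R ↔ A ∈ P)) :
    ∃ ν : R ≃* P, ∀ (f : R) (q : ι), f.1 (y q) = ∑ p, (ν f).1.1 p q • y p := by
  obtain ⟨Ω, hΩ⟩ := exists_mulEquiv_generalLinear hy
  let lin (f : R) : N ≃ₗ[K] N := { f.1.toAddEquiv with map_smul' := hR f.1 f.2 }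
  let F : R →* P := MonoidHom.mk'
    (fun f => ⟨Ω (lin f), (hRP f.1 _ (hR f.1 f.2) (hΩ (lin f))).1 f.2⟩)
    fun f f' => Subtype.ext (Ω.map_mul (lin f) (lin f'))
  have hinj : Function.Injective F := fun f f' hff' => by
    have hlin : lin f = lin f' := Ω.injective (congrArg Subtype.val hff')
    exact Subtype.ext (LinearEquiv.ext fun n => LinearEquiv.congr_fun hlin n)
  have hsurj : Function.Surjective F := fun A => by
    let φ := Ω.symm A.1
    have hφ : Ω φ = A.1 := Ω.apply_symm_apply _
    let f : N ≃ₗ[ℚ] N := { φ.toAddEquiv with map_smul' := map_rat_smul φ.toAddEquiv }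
    have hf : f ∈ R := (hRP f A.1 φ.map_smul fun q => hφ ▸ hΩ φ q).2 A.2
    exact ⟨⟨f, hf⟩, Subtype.ext hφ⟩
  exact ⟨MulEquiv.ofBijective F ⟨hinj, hsurj⟩, fun f => hΩ (lin f)⟩

end MatrixGroup

section Scalars

variable {m : ℕ} {ι : Type}

-- The `ℚ`-action on `CyclotomicField m ℚ` comes from its construction as a splitting field, so
-- `Rat.smul_def` does not apply.
theorem rat_smul_matrix_eq (c : ℚ) (S : Matrix ι ι (CyclotomicField m ℚ)) :
    c • S = (c : CyclotomicField m ℚ) • S := by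
  ext p q
  refine (Algebra.smul_def c (S p q)).trans ?_
  rw [eq_ratCast, Matrix.smul_apply, smul_eq_mul]

theorem matrixUnitary_rat_smul [NeZero m] [Fintype ι] [DecidableEq ι] {c : ℚ} (hc : c ≠ 0)
    (S : Matrix ι ι (CyclotomicField m ℚ)) : matrixUnitary m (c • S) = matrixUnitary m S := by
  ext A
  change A.1.transpose * (c • S) * A.1.map (cycConj m) = c • S ↔
    A.1.transpose * S * A.1.map (cycConj m) = S
  rw [rat_smul_matrix_eq, Matrix.mul_smul, Matrix.smul_mul]
  exact (smul_right_injective _ (Rat.cast_ne_zero.2 hc)).eq_iff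

end Scalars

section CycModule

variable {m : ℕ} [NeZero m] {N : Type} [AddCommGroup N] [Module ℚ N]
  {ρ' : Representation ℚ (CycQ m) N}

theorem asAlgebraHom_eq_zero_of_cycAlg (hρ : aeval (ρ' (CycQ.zeta m)) (cyclotomic m ℚ) = 0)
    (a : MonoidAlgebra ℚ (CycQ m)) (ha : cycAlg m a = 0) : ρ'.asAlgebraHom a = 0 := by
  ext n
  have h := sum_smul_pow_apply_eq_zero_of_sum_rootChar (T := ρ' (CycQ.zeta m)) (v := n)
    (by rw [hρ, LinearMap.zero_apply]) (fun q : CycQ m => a.coeff q) (fun q => q.toAdd) (by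
      rw [← sum_single_coeff a, map_sum] at ha
      simpa only [cycAlg_single] using ha)
  simp only [← map_pow, CycQ.zeta_pow_val, ofAdd_toAdd] at h
  rw [← sum_single_coeff a, map_sum, LinearMap.sum_apply, LinearMap.zero_apply, ← h]
  simp only [Representation.asAlgebraHom_single, LinearMap.smul_apply, Algebra.algebraMap_self,
    RingHom.id_apply]

/-- The action of `ℚ(ζ_m)` on a representation of `⟨ζ⟩` in which `ζ` has order `m`; it is
normalized as in `cycAlg`, so that `ζ_m` acts as `ζ⁻¹`. -/
noncomputable def cycAction (hρ : aeval (ρ' (CycQ.zeta m)) (cyclotomic m ℚ) = 0) :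
    CyclotomicField m ℚ →ₐ[ℚ] Module.End ℚ N :=
  factorAction (cycAlg_surjective m) (asAlgebraHom_eq_zero_of_cycAlg hρ)

/-- The Gram matrix over `ℚ(ζ_m)` of the Reidemeister pairing of a representation of `⟨ζ⟩`;
`gramQ` is the case of `N_m`. -/
noncomputable def cycGram {ι : Type} (ρ' : Representation ℚ (CycQ m) N)
    (B' : LinearMap.BilinForm ℚ N) (y : ι → N) : Matrix ι ι (CyclotomicField m ℚ) :=
  Matrix.of fun p q => cycAlg m (reidemeister ρ' B' (y p) (y q))

variable (hρ : aeval (ρ' (CycQ.zeta m)) (cyclotomic m ℚ) = 0)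

theorem cycAction_cycAlg (a : MonoidAlgebra ℚ (CycQ m)) :
    cycAction hρ (cycAlg m a) = ρ'.asAlgebraHom a :=
  factorAction_apply _ _ a

theorem cycAction_rootChar (j : ZMod m) :
    cycAction hρ (rootChar m j) = ρ' (Multiplicative.ofAdd (-j)) := by
  simpa [cycAlg_single] using
    cycAction_cycAlg hρ (MonoidAlgebra.single (Multiplicative.ofAdd (-j)) 1)

variable {B' : LinearMap.BilinForm ℚ N}

theorem cycAlg_reidemeister_left (hB : ∀ g x y, B' (ρ' g x) (ρ' g y) = B' x y)
    (κ : CyclotomicField m ℚ) (x y : N) :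
    cycAlg m (reidemeister ρ' B' (cycAction hρ κ x) y) =
      κ * cycAlg m (reidemeister ρ' B' x y) := by
  obtain ⟨a, rfl⟩ := cycAlg_surjective m κ
  rw [cycAction_cycAlg, reidemeister_smul_left hB, map_mul]

theorem cycAlg_reidemeister_right (κ : CyclotomicField m ℚ) (x y : N) :
    cycAlg m (reidemeister ρ' B' x (cycAction hρ κ y)) =
      cycAlg m (reidemeister ρ' B' x y) * cycConj m κ := by
  obtain ⟨a, rfl⟩ := cycAlg_surjective m κ
  rw [cycAction_cycAlg, reidemeister_smul_right, map_mul, cycAlg_inv]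

variable {ι : Type} [Fintype ι] {y : ι → N}

theorem cycAlg_reidemeister_sum (hB : ∀ g x y, B' (ρ' g x) (ρ' g y) = B' x y)
    (c d : ι → CyclotomicField m ℚ) :
    cycAlg m (reidemeister ρ' B' (∑ p, cycAction hρ (c p) (y p))
      (∑ p, cycAction hρ (d p) (y p))) =
    ∑ p, ∑ q, c p * cycGram ρ' B' y p q * cycConj m (d q) := by
  simp only [← reidBilin_apply, map_sum, LinearMap.sum_apply]
  rw [Finset.sum_comm]
  refine Finset.sum_congr rfl fun p _ => Finset.sum_congr rfl fun q _ => ?_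
  rw [reidBilin_apply, cycAlg_reidemeister_left hρ hB, cycAlg_reidemeister_right, mul_assoc]
  rfl

theorem cycGram_sum (hB : ∀ g x y, B' (ρ' g x) (ρ' g y) = B' x y)
    (A : Matrix ι ι (CyclotomicField m ℚ)) :
    cycGram ρ' B' (fun q => ∑ p, cycAction hρ (A p q) (y p)) =
      A.transpose * cycGram ρ' B' y * A.map (cycConj m) := by
  ext q q'
  rw [cycGram, Matrix.of_apply, cycAlg_reidemeister_sum hρ hB, Finset.sum_comm]
  simp only [Matrix.mul_apply, Matrix.transpose_apply, Matrix.map_apply, Finset.sum_mul]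

theorem mem_reidAut_iff_cycGram_eq (hB : ∀ g x y, B' (ρ' g x) (ρ' g y) = B' x y)
    (hy : Function.Bijective fun κ : ι → CyclotomicField m ℚ => ∑ p, cycAction hρ (κ p) (y p))
    {f : N ≃ₗ[ℚ] N} (hf : ∀ κ n, f (cycAction hρ κ n) = cycAction hρ κ (f n)) :
    f ∈ reidAut ρ' B' ↔ cycGram ρ' B' (fun q => f (y q)) = cycGram ρ' B' y := by
  refine ⟨fun h => ?_, fun h => ⟨fun q n => ?_, fun x x' => ?_⟩⟩
  · ext q q'
    simp only [cycGram, Matrix.of_apply, h.2]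
  · have hq := hf (rootChar m (-q.toAdd)) n
    rwa [cycAction_rootChar, neg_neg, ofAdd_toAdd] at hq
  · have hz := reidemeister_mem_topFactor (m := m) hB hρ
    apply (cycAlg_bijOn m).injOn (hz _ _) (hz _ _)
    obtain ⟨c, rfl⟩ := hy.2 x
    obtain ⟨d, rfl⟩ := hy.2 x'
    simp only [map_sum, hf]
    rw [cycAlg_reidemeister_sum hρ hB, cycAlg_reidemeister_sum hρ hB, h]

theorem exists_mulEquiv_matrixUnitary [DecidableEq ι]
    (hB : ∀ g x y, B' (ρ' g x) (ρ' g y) = B' x y)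
    (hy : Function.Bijective fun κ : ι → CyclotomicField m ℚ => ∑ p, cycAction hρ (κ p) (y p)) :
    ∃ ν : reidAut ρ' B' ≃* matrixUnitary m (cycGram ρ' B' y),
      ∀ (f : reidAut ρ' B') (q : ι), f.1 (y q) = ∑ p, cycAction hρ ((ν f).1.1 p q) (y p) := by
  let _ : Module (CyclotomicField m ℚ) N := Module.compHom N (cycAction hρ).toRingHom
  refine exists_mulEquiv_of_mem_iff (K := CyclotomicField m ℚ) hy
    (fun f hf => map_factorAction_of_equivariant (cycAlg_surjective m)
      (asAlgebraHom_eq_zero_of_cycAlg hρ) (f := f.toLinearMap) hf.1) fun f A hf hA => ?_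
  have hfy : (fun q => f (y q)) = fun q => ∑ p, cycAction hρ (A.1 p q) (y p) := funext hA
  rw [mem_reidAut_iff_cycGram_eq hρ hB hy hf, hfy, cycGram_sum hρ hB]
  rfl

end CycModule

/-! ### Bases and Gram matrices under descent -/

theorem single_mul_eq_sum {n R : Type*} [Fintype n] [DecidableEq n] [Semiring R] (i j : n)
    (s : Matrix n n R) : Matrix.single i j 1 * s = ∑ l, Matrix.single i l (s j l) := by
  ext a b
  by_cases h : i = a
  · subst h
    simp [Matrix.sum_apply, Matrix.single_apply]
  · simp [Matrix.sum_apply, h, Matrix.single_mul_apply_of_ne _ _ _ _ _ (Ne.symm h)]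

/-- The Gram matrix of the Reidemeister pairing of a representation of the Heisenberg group, with
the blocks `ρ(⟨x_a, x_b⟩)` written out as matrices over `ℚ(ζ_m)`; `gramH` is the case of `M_m`. -/
noncomputable def heisGram {m : ℕ} [NeZero m] {V ι : Type} [AddCommGroup V] [Module ℚ V]
    (ρ : Representation ℚ (Heis m) V) (B : LinearMap.BilinForm ℚ V) (x : ι → V) :
    Matrix (ι × ZMod m) (ι × ZMod m) (CyclotomicField m ℚ) :=
  Matrix.of fun p q => heisAlg m (reidemeister ρ B (x p.1) (x q.1)) p.2 q.2

namespace IsTauDescent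

variable {m : ℕ} [NeZero m] {V N : Type} [AddCommGroup V] [Module ℚ V]
  [AddCommGroup N] [Module ℚ N] {ρ : Representation ℚ (Heis m) V}
  {ρ' : Representation ℚ (CycQ m) N} {t : N →ₗ[ℚ] V}

theorem asAlgebraHom_rho_sigma_apply (H : IsTauDescent ρ ρ' t) (a : MonoidAlgebra ℚ (Heis m))
    (j : ZMod m) (n : N) :
    ρ.asAlgebraHom a (ρ ⟨0, j, 0⟩ (t n)) =
      ∑ i, ρ ⟨0, i, 0⟩ (t (cycAction H.cyclotomic_zeta' (heisAlg m a i j) n)) := by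
  have hrat (r : ℚ) : cycAction H.cyclotomic_zeta' (r : CyclotomicField m ℚ) =
      algebraMap ℚ _ r := by
    rw [← eq_ratCast (algebraMap ℚ (CyclotomicField m ℚ)), AlgHom.commutes]
  rw [← sum_single_coeff a]
  simp only [map_sum, LinearMap.sum_apply, Matrix.sum_apply]
  rw [Finset.sum_comm]
  refine Finset.sum_congr rfl fun h _ => ?_
  rw [Representation.asAlgebraHom_single, LinearMap.smul_apply, H.rho_rho_sigma_apply,
    Finset.sum_eq_single (j + h.b)]
  · rw [heisAlg_single, if_pos rfl, map_mul, cycAction_rootChar, neg_sub, Module.End.mul_apply,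
      hrat, Module.algebraMap_end_apply, map_smul, map_smul]
  · intro i _ hi
    simp [heisAlg_single, hi]
  · simp

theorem asAlgebraHom_eq_zero_of_heisAlg (H : IsTauDescent ρ ρ' t) (a : MonoidAlgebra ℚ (Heis m))
    (ha : heisAlg m a = 0) : ρ.asAlgebraHom a = 0 := by
  ext v
  obtain ⟨f, rfl⟩ := H.exists_eq_sum v
  simp [map_sum, H.asAlgebraHom_rho_sigma_apply, ha]

/-- The action of the matrix algebra `M_m(ℚ(ζ_m))`, as a quotient of `ℚ[H]` through `heisAlg`. -/
noncomputable def matAction (H : IsTauDescent ρ ρ' t) :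
    Matrix (ZMod m) (ZMod m) (CyclotomicField m ℚ) →ₐ[ℚ] Module.End ℚ V :=
  factorAction (heisAlg_surjective m) H.asAlgebraHom_eq_zero_of_heisAlg

theorem matAction_heisAlg (H : IsTauDescent ρ ρ' t) (a : MonoidAlgebra ℚ (Heis m)) :
    H.matAction (heisAlg m a) = ρ.asAlgebraHom a :=
  factorAction_apply _ _ a

theorem matAction_rho_sigma_apply (H : IsTauDescent ρ ρ' t)
    (s : Matrix (ZMod m) (ZMod m) (CyclotomicField m ℚ)) (j : ZMod m) (n : N) :
    H.matAction s (ρ ⟨0, j, 0⟩ (t n)) =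
      ∑ i, ρ ⟨0, i, 0⟩ (t (cycAction H.cyclotomic_zeta' (s i j) n)) := by
  obtain ⟨a, rfl⟩ := heisAlg_surjective m s
  rw [matAction_heisAlg, H.asAlgebraHom_rho_sigma_apply]

theorem matAction_single_rho_sigma_apply (H : IsTauDescent ρ ρ' t) (i j : ZMod m)
    (κ : CyclotomicField m ℚ) (n : N) :
    H.matAction (Matrix.single 0 i κ) (ρ ⟨0, j, 0⟩ (t n)) =
      if i = j then t (cycAction H.cyclotomic_zeta' κ n) else 0 := by
  rw [matAction_rho_sigma_apply, Finset.sum_eq_single 0]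
  · split_ifs with hij
    · rw [hij, Matrix.single_apply_same, rho_zero_apply]
    · simp [Matrix.single_apply_of_col_ne _ _ hij]
  · intro l _ hl
    simp [Matrix.single_apply_of_row_ne hl.symm]
  · simp

theorem matAction_single_apply (H : IsTauDescent ρ ρ' t) (κ : CyclotomicField m ℚ) (n : N) :
    H.matAction (Matrix.single 0 0 κ) (t n) = t (cycAction H.cyclotomic_zeta' κ n) := by
  simpa [rho_zero_apply] using H.matAction_single_rho_sigma_apply 0 0 κ n

theorem exists_eq_matAction_single (H : IsTauDescent ρ ρ' t) (i : ZMod m) (v : V) :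
    ∃ n, t n = H.matAction (Matrix.single 0 i 1) v := by
  obtain ⟨f, rfl⟩ := H.exists_eq_sum v
  refine ⟨f i, ?_⟩
  simp [map_sum, H.matAction_single_rho_sigma_apply]

section Basis

variable {ι : Type} {x : ι → V} {y : ι × ZMod m → N}

theorem transfer_cycAction (H : IsTauDescent ρ ρ' t)
    (hxy : ∀ a i, t (y (a, i)) = H.matAction (Matrix.single 0 i 1) (x a))
    (κ : CyclotomicField m ℚ) (a : ι) (i : ZMod m) :
    t (cycAction H.cyclotomic_zeta' κ (y (a, i))) = H.matAction (Matrix.single 0 i κ) (x a) := by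
  rw [← matAction_single_apply, hxy, ← Module.End.mul_apply, ← map_mul,
    Matrix.single_mul_single_same, mul_one]

variable [Fintype ι]

theorem transfer_sum_cycAction (H : IsTauDescent ρ ρ' t)
    (hxy : ∀ a i, t (y (a, i)) = H.matAction (Matrix.single 0 i 1) (x a))
    (κ : ι × ZMod m → CyclotomicField m ℚ) :
    t (∑ p, cycAction H.cyclotomic_zeta' (κ p) (y p)) =
      ∑ a, H.matAction (∑ i, Matrix.single 0 i (κ (a, i))) (x a) := by
  rw [map_sum, Fintype.sum_prod_type]
  simp only [map_sum, LinearMap.sum_apply, H.transfer_cycAction hxy]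

theorem transfer_sum_cycAction_row (H : IsTauDescent ρ ρ' t)
    (hxy : ∀ a i, t (y (a, i)) = H.matAction (Matrix.single 0 i 1) (x a))
    (s : ι → Matrix (ZMod m) (ZMod m) (CyclotomicField m ℚ)) (j : ZMod m) :
    t (∑ p : ι × ZMod m, cycAction H.cyclotomic_zeta' (s p.1 j p.2) (y p)) =
      H.matAction (Matrix.single 0 j 1) (∑ a, H.matAction (s a) (x a)) := by
  rw [H.transfer_sum_cycAction hxy]
  simp only [← single_mul_eq_sum, map_mul, Module.End.mul_apply, map_sum]

theorem bijective_sum_cycAction (H : IsTauDescent ρ ρ' t)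
    (hxy : ∀ a i, t (y (a, i)) = H.matAction (Matrix.single 0 i 1) (x a))
    (hx : Function.Bijective fun s : ι → Matrix (ZMod m) (ZMod m) (CyclotomicField m ℚ) =>
      ∑ a, H.matAction (s a) (x a)) :
    Function.Bijective fun κ : ι × ZMod m → CyclotomicField m ℚ =>
      ∑ p, cycAction H.cyclotomic_zeta' (κ p) (y p) := by
  refine ⟨fun κ κ' h => ?_, fun n => ?_⟩
  · have ht := congrArg t h
    simp only [H.transfer_sum_cycAction hxy] at ht
    ext ⟨a, i⟩
    simpa [Matrix.sum_apply, Matrix.single_apply] using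
      congrFun (congrFun (congrFun (hx.1 ht) a) 0) i
  · obtain ⟨s, hs⟩ := hx.2 (t n)
    refine ⟨fun p => s p.1 0 p.2, H.injective ?_⟩
    rw [H.transfer_sum_cycAction_row hxy]
    simp only [hs, matAction_single_apply, map_one, Module.End.one_apply]

theorem bijective_sum_matAction (H : IsTauDescent ρ ρ' t)
    (hy : Function.Bijective fun κ : ι × ZMod m → CyclotomicField m ℚ =>
      ∑ p, cycAction H.cyclotomic_zeta' (κ p) (y p)) :
    Function.Bijective fun s : ι → Matrix (ZMod m) (ZMod m) (CyclotomicField m ℚ) =>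
      ∑ a, H.matAction (s a) (∑ i, ρ ⟨0, i, 0⟩ (t (y (a, i)))) := by
  let e : (ι → Matrix (ZMod m) (ZMod m) (CyclotomicField m ℚ)) ≃
      (ZMod m → ι × ZMod m → CyclotomicField m ℚ) :=
    { toFun := fun s j p => s p.1 j p.2
      invFun := fun f a => Matrix.of fun j i => f j (a, i) }
  have hcomp : (fun s : ι → Matrix (ZMod m) (ZMod m) (CyclotomicField m ℚ) =>
      ∑ a, H.matAction (s a) (∑ i, ρ ⟨0, i, 0⟩ (t (y (a, i))))) =
      H.decomp ∘ (fun f j => ∑ p, cycAction H.cyclotomic_zeta' (f j p) (y p)) ∘ e := by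
    ext s
    simp only [Function.comp_apply, H.decomp_apply, map_sum, H.matAction_rho_sigma_apply,
      Fintype.sum_prod_type]
    rw [Finset.sum_congr rfl fun a _ => Finset.sum_comm, Finset.sum_comm]
    rfl
  rw [hcomp]
  exact H.decomp.bijective.comp ((Function.Bijective.piMap fun _ => hy).comp e.bijective)

theorem matrix_restrict_apply (H : IsTauDescent ρ ρ' t)
    (hxy : ∀ a i, t (y (a, i)) = H.matAction (Matrix.single 0 i 1) (x a))
    (hy : Function.Bijective fun κ : ι × ZMod m → CyclotomicField m ℚ =>
      ∑ p, cycAction H.cyclotomic_zeta' (κ p) (y p))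
    {f : V →ₗ[ℚ] V} (hf : ∀ h v, f (ρ h v) = ρ h (f v)) {f' : N → N}
    (hff' : ∀ n, t (f' n) = f (t n))
    {A : Matrix (ι × ZMod m) (ι × ZMod m) (CyclotomicField m ℚ)}
    (hA : ∀ q, f' (y q) = ∑ p, cycAction H.cyclotomic_zeta' (A p q) (y p))
    {γ : ι → ι → Matrix (ZMod m) (ZMod m) (CyclotomicField m ℚ)}
    (hγ : ∀ b, f (x b) = ∑ a, H.matAction (γ a b) (x a)) (p q : ι × ZMod m) :
    A p q = γ p.1 q.1 q.2 p.2 := by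
  have hcol : (fun p => A p q) = fun p : ι × ZMod m => γ p.1 q.1 q.2 p.2 := by
    refine hy.1 (H.injective ?_)
    beta_reduce
    rw [← hA, H.transfer_sum_cycAction_row hxy (fun a => γ a q.1), hff', hxy, ← hγ]
    exact map_factorAction_of_equivariant _ _ hf _ _
  exact congrFun hcol p

end Basis

section Gram

variable {B : LinearMap.BilinForm ℚ V} {B' : LinearMap.BilinForm ℚ N}

theorem heisAlg_reidemeister_transfer (H : IsTauDescent ρ ρ' t)
    (hB : ∀ h x y, B (ρ h x) (ρ h y) = B x y) (hBt : ∀ x y, B (t x) (t y) = (m : ℚ) * B' x y)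
    (n n' : N) : heisAlg m (reidemeister ρ B (t n) (t n')) 0 0 =
      (m : CyclotomicField m ℚ) ^ 2 * cycAlg m (reidemeister ρ' B' n n') := by
  have hform (a c : ZMod m) : B (t n) (ρ ⟨a, 0, c⟩ (t n')) =
      (m : ℚ) * B' n (ρ' (Multiplicative.ofAdd c) n') := by
    have h := hB ⟨a, 0, 0⟩ (t n) (ρ ⟨0, 0, c⟩ (t n'))
    rw [H.rho_tau_pow_apply, ← Module.End.mul_apply (ρ ⟨a, 0, 0⟩), ← map_mul,
      H.rho_zeta_pow_apply, hBt] at h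
    rw [← h]
    simp [Heis.mul_def]
  simp only [reidemeister, map_sum, Matrix.sum_apply, heisAlg_single, cycAlg_single]
  rw [Heis.sum_eq, Finset.sum_eq_single 0]
  · simp only [hform, add_zero, if_true, mul_zero, zero_sub, Finset.sum_const, Finset.card_univ,
      ZMod.card, nsmul_eq_mul, Rat.cast_mul, Rat.cast_natCast, mul_assoc, ← Finset.mul_sum]
    rw [pow_two, mul_assoc]
    congr 2
    exact Fintype.sum_equiv Multiplicative.ofAdd _ _ fun _ => rfl
  · intro b _ hb
    simp [hb.symm]
  · simp

theorem heisGram_eq_smul_cycGram (H : IsTauDescent ρ ρ' t)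
    (hB : ∀ h x y, B (ρ h x) (ρ h y) = B x y) (hBt : ∀ x y, B (t x) (t y) = (m : ℚ) * B' x y)
    {ι : Type} {x : ι → V} {y : ι × ZMod m → N}
    (hxy : ∀ a i, t (y (a, i)) = H.matAction (Matrix.single 0 i 1) (x a)) :
    heisGram ρ B x = (m : ℚ) ^ 2 • cycGram ρ' B' y := by
  ext p q
  rw [rat_smul_matrix_eq, Rat.cast_pow, Rat.cast_natCast, Matrix.smul_apply, smul_eq_mul, heisGram,
    cycGram, Matrix.of_apply, Matrix.of_apply,
    ← H.heisAlg_reidemeister_transfer hB hBt, hxy p.1 p.2, hxy q.1 q.2]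
  obtain ⟨a, ha⟩ := heisAlg_surjective m (Matrix.single 0 p.2 1)
  obtain ⟨b, hb⟩ := heisAlg_surjective m (Matrix.single 0 q.2 1)
  rw [← ha, ← hb, matAction_heisAlg, matAction_heisAlg, reidemeister_smul_left hB,
    reidemeister_smul_right, map_mul, map_mul, heisAlg_inv, ha, hb, Matrix.transpose_single,
    Matrix.map_single, map_one]
  simp

end Gram

section FactorBasis

variable {ι : Type} [Fintype ι]

theorem isFactorBasis_heis_iff (H : IsTauDescent ρ ρ' t) (x : ι → V) :
    IsFactorBasis ρ (Heis.zeta m) m x ↔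
      Function.Bijective fun s : ι → Matrix (ZMod m) (ZMod m) (CyclotomicField m ℚ) =>
        ∑ a, H.matAction (s a) (x a) :=
  isFactorBasis_iff (heisAlg_bijOn m) H.matAction_heisAlg x

theorem isFactorBasis_cyc_iff (H : IsTauDescent ρ ρ' t) (y : ι → N) :
    IsFactorBasis ρ' (CycQ.zeta m) m y ↔
      Function.Bijective fun κ : ι → CyclotomicField m ℚ =>
        ∑ p, cycAction H.cyclotomic_zeta' (κ p) (y p) :=
  isFactorBasis_iff (cycAlg_bijOn m) (cycAction_cycAlg H.cyclotomic_zeta') y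

variable {B : LinearMap.BilinForm ℚ V} {B' : LinearMap.BilinForm ℚ N}

theorem exists_mulEquiv_matrixUnitary_cycGram [DecidableEq ι] (H : IsTauDescent ρ ρ' t)
    (hB : ∀ h x y, B (ρ h x) (ρ h y) = B x y) (hBt : ∀ x y, B (t x) (t y) = (m : ℚ) * B' x y)
    {α : reidAut ρ B ≃* reidAut ρ' B'} (hα : ∀ f n, t ((α f).1 n) = f.1 (t n))
    {x : ι → V} (hx : IsFactorBasis ρ (Heis.zeta m) m x) {y : ι × ZMod m → N}
    (hxy : ∀ a i, t (y (a, i)) = H.matAction (Matrix.single 0 i 1) (x a)) :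
    ∃ ν : reidAut ρ' B' ≃* matrixUnitary m (cycGram ρ' B' y),
      (∀ f : reidAut ρ B, ∃ γ : ι → ι → topFactor ℚ (Heis.zeta m) m,
        (∀ b, f.1 (x b) = ∑ a, ρ.asAlgebraHom (γ a b).1 (x a)) ∧
        ∀ p q, (ν (α f)).1.1 p q = heisAlg m (γ p.1 q.1).1 q.2 p.2) ∧
      ∀ f : reidAut ρ' B', ∃ η : ι × ZMod m → ι × ZMod m → topFactor ℚ (CycQ.zeta m) m,
        (∀ q, f.1 (y q) = ∑ p, ρ'.asAlgebraHom (η p q).1 (y p)) ∧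
        ∀ p q, (ν f).1.1 p q = cycAlg m (η p q).1 := by
  have hy := H.bijective_sum_cycAction hxy ((H.isFactorBasis_heis_iff x).1 hx)
  obtain ⟨ν, hν⟩ := exists_mulEquiv_matrixUnitary H.cyclotomic_zeta' (H.form_rho' hB hBt) hy
  refine ⟨ν, fun f => ?_, fun f => ?_⟩
  · choose c hc using fun b => hx.2 (f.1 (x b))
    have hγ (b : ι) : f.1 (x b) = ∑ a, ρ.asAlgebraHom (c b a).1 (x a) := (hc b).symm
    refine ⟨fun a b => c b a, hγ, H.matrix_restrict_apply hxy hy (f := f.1.toLinearMap) f.2.1 (hα f)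
      (hν _) (γ := fun a b => heisAlg m (c b a).1) fun b => ?_⟩
    simpa only [H.matAction_heisAlg, LinearEquiv.coe_coe] using hγ b
  · choose η hη hην using fun p q => (cycAlg_bijOn m).surjOn (Set.mem_univ ((ν f).1.1 p q))
    refine ⟨fun p q => ⟨η p q, hη p q⟩, fun q => ?_, fun p q => (hην p q).symm⟩
    simp only [hν, ← cycAction_cycAlg H.cyclotomic_zeta', hην]

end FactorBasis

end IsTauDescent

/-! ### Coverings, transfer and the intersection form -/

namespace PolySurface

section Fibre

variable {S : Type} [Fintype S] {M : PolySurface} {v : M.Dart → Equiv.Perm S}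
  {hv : ∀ d, v (M.rev d) = (v d)⁻¹}

theorem branchedCover_rot_pow (j : ℕ) (d : M.Dart) (s : S) :
    ((M.branchedCover v hv).rot ^ j) (d, s) = ((M.rot ^ j) d, s) := by
  have rot_apply (d : M.Dart) (s : S) : (M.branchedCover v hv).rot (d, s) = (M.rot d, s) :=
    Prod.ext rfl (Equiv.apply_symm_apply _ _)
  induction j with
  | zero => rfl
  | succ j ih =>
    rw [pow_succ', pow_succ']
    exact (congrArg (M.branchedCover v hv).rot ih).trans (rot_apply _ _)

theorem branchedCover_deg (d : M.Dart) (s : S) : (M.branchedCover v hv).deg (d, s) = M.deg d := by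
  refine Function.minimalPeriod_eq_minimalPeriod_iff.2 fun n => ?_
  unfold Function.IsPeriodicPt Function.IsFixedPt
  rw [← Equiv.Perm.coe_pow, ← Equiv.Perm.coe_pow, branchedCover_rot_pow]
  exact ⟨fun h => congrArg Prod.fst h, fun h => Prod.ext h rfl⟩

variable {k : Type} [CommRing k]

theorem mem_cycles_branchedCover {c : M.Dart × S → k} :
    c ∈ (M.branchedCover v hv).cycles k ↔ (∀ d s, c (M.rev d, v d s) = - c (d, s)) ∧
      ∀ d s, ∑ j ∈ Finset.range (M.deg d), c ((M.rot ^ j) d, s) = 0 := by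
  refine and_congr Prod.forall (Prod.forall.trans (forall₂_congr fun d s => ?_))
  rw [branchedCover_deg]
  simp only [branchedCover_rot_pow]

theorem mem_boundaries_branchedCover {c : M.Dart × S → k} :
    c ∈ (M.branchedCover v hv).boundaries k ↔ ∃ u : M.Dart × S → k,
      (∀ d s, u (M.face d, v d s) = u (d, s)) ∧
      ∀ d s, c (d, s) = u (d, s) - u (M.rev d, v d s) :=
  ⟨fun ⟨u, h1, h2⟩ => ⟨u, fun d s => h1 (d, s), fun d s => h2 (d, s)⟩,
    fun ⟨u, h1, h2⟩ => ⟨u, fun p => h1 p.1 p.2, fun p => h2 p.1 p.2⟩⟩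

end Fibre

section Covering

variable {S S' : Type} [Fintype S] {M : PolySurface}
  {v : M.Dart → Equiv.Perm S} {v' : M.Dart → Equiv.Perm S'}
  {hv : ∀ d, v (M.rev d) = (v d)⁻¹} {hv' : ∀ d, v' (M.rev d) = (v' d)⁻¹}
  {T : S → S'} {k : Type} [CommRing k]

theorem intersection_transfer [Fintype S'] (hT : ∀ d s, T (v d s) = v' d (T s)) [Algebra ℚ k]
    {n : k} (hn : ∀ F : S' → k, ∑ s, F (T s) = n * ∑ s, F s)
    (x y : (M.branchedCover v' hv').H1 k) :
    (M.branchedCover v hv).intersection k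
      ((coverOfFibre (hv := hv) (hv' := hv') T hT).transfer k x)
      ((coverOfFibre (hv := hv) (hv' := hv') T hT).transfer k y) =
    n * (M.branchedCover v' hv').intersection k x y := by
  obtain ⟨a, rfl⟩ := Submodule.Quotient.mk_surjective _ x
  obtain ⟨b, rfl⟩ := Submodule.Quotient.mk_surjective _ y
  have crossFun_comp (d : M.Dart) (s : S) :
      (M.branchedCover v hv).crossFun k (fun p : M.Dart × S => b.1 (p.1, T p.2)) (d, s) =
        (M.branchedCover v' hv').crossFun k b.1 (d, T s) := by
    simp only [crossFun, branchedCover_deg, branchedCover_rot_pow]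
  have sum_comp : ∑ p : M.Dart × S, a.1 (p.1, T p.2) * (M.branchedCover v hv).crossFun k
      (fun p : M.Dart × S => b.1 (p.1, T p.2)) p =
      n * ∑ p : M.Dart × S', a.1 p * (M.branchedCover v' hv').crossFun k b.1 p := by
    rw [Fintype.sum_prod_type, Fintype.sum_prod_type, Finset.mul_sum]
    refine Finset.sum_congr rfl fun d _ => ?_
    simp only [crossFun_comp]
    exact hn fun s => a.1 (d, s) * (M.branchedCover v' hv').crossFun k b.1 (d, s)
  change (M.branchedCover v hv).crossing k (fun p : M.Dart × S => a.1 (p.1, T p.2))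
    (fun p : M.Dart × S => b.1 (p.1, T p.2)) = n * (M.branchedCover v' hv').crossing k a.1 b.1
  exact (crossing_eq k _ _ _).trans
    (sum_comp.trans (congrArg (n * ·) (crossing_eq k (M.branchedCover v' hv') a.1 b.1).symm))

section PushForward

variable [DecidableEq S']

/-- The push-forward of chains along the covering that is induced by a map `T` of fibres: the sum
over the fibres of `T`. -/
def pushChain (M : PolySurface) (T : S → S') (c : M.Dart × S → k) (p : M.Dart × S') : k :=
  ∑ s, if T s = p.2 then c (p.1, s) else 0

theorem pushChain_shear (hT : ∀ d s, T (v d s) = v' d (T s)) (φ : M.Dart → M.Dart)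
    (c : M.Dart × S → k) (d : M.Dart) (s : S') :
    pushChain M T c (φ d, v' d s) = pushChain M T (fun p => c (φ p.1, v p.1 p.2)) (d, s) := by
  refine (Fintype.sum_equiv (v d) _ _ fun s' => ?_).symm
  simp only [hT, EmbeddingLike.apply_eq_iff_eq]

theorem pushChain_mem_cycles [Fintype S'] (hT : ∀ d s, T (v d s) = v' d (T s)) {c : M.Dart × S → k}
    (hc : c ∈ (M.branchedCover v hv).cycles k) :
    pushChain M T c ∈ (M.branchedCover v' hv').cycles k := by
  rw [mem_cycles_branchedCover] at hc ⊢
  refine ⟨fun d s => ?_, fun d s => ?_⟩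
  · rw [pushChain_shear hT M.rev]
    simp only [pushChain, hc.1, ← Finset.sum_neg_distrib]
    exact Finset.sum_congr rfl fun s' _ => by split_ifs <;> simp
  · simp only [pushChain]
    rw [Finset.sum_comm]
    refine Finset.sum_eq_zero fun s' _ => ?_
    split_ifs
    · exact hc.2 d s'
    · simp

theorem pushChain_mem_boundaries [Fintype S'] (hT : ∀ d s, T (v d s) = v' d (T s))
    {c : M.Dart × S → k}
    (hc : c ∈ (M.branchedCover v hv).boundaries k) :
    pushChain M T c ∈ (M.branchedCover v' hv').boundaries k := by
  rw [mem_boundaries_branchedCover] at hc ⊢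
  obtain ⟨u, hu, hc⟩ := hc
  refine ⟨pushChain M T u, fun d s => ?_, fun d s => ?_⟩
  · rw [pushChain_shear hT M.face]
    simp only [pushChain, hu]
  · rw [pushChain_shear hT M.rev]
    simp only [pushChain, hc, ← Finset.sum_sub_distrib]
    exact Finset.sum_congr rfl fun s' _ => by split_ifs <;> simp

theorem pushChain_comp [Fintype S'] {n : k} (hn : ∀ F : S' → k, ∑ s, F (T s) = n * ∑ s, F s)
    (c : M.Dart × S' → k) : pushChain M T (fun p => c (p.1, T p.2)) = n • c := by
  ext ⟨d, s⟩
  simp only [pushChain, Pi.smul_apply, smul_eq_mul]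
  rw [hn fun s' => if s' = s then c (d, s') else 0]
  simp

end PushForward

theorem transfer_injective [Fintype S'] (hT : ∀ d s, T (v d s) = v' d (T s)) {n : k} (hu : IsUnit n)
    (hn : ∀ F : S' → k, ∑ s, F (T s) = n * ∑ s, F s) :
    Function.Injective ((coverOfFibre (hv := hv) (hv' := hv') T hT).transfer k) := by
  classical
  rw [injective_iff_map_eq_zero]
  intro x hx
  obtain ⟨c, rfl⟩ := Submodule.Quotient.mk_surjective _ x
  have comp_mem : (fun p : M.Dart × S => c.1 (p.1, T p.2)) ∈ (M.branchedCover v hv).boundaries k :=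
    (Submodule.Quotient.mk_eq_zero
      (((M.branchedCover v hv).boundaries k).submoduleOf ((M.branchedCover v hv).cycles k))).1 hx
  have smul_mem : n • c.1 ∈ (M.branchedCover v' hv').boundaries k :=
    pushChain_comp (M := M) hn c.1 ▸ pushChain_mem_boundaries (hv := hv) (hv' := hv') hT comp_mem
  exact (Submodule.Quotient.mk_eq_zero _).2 ((Submodule.smul_mem_iff_of_isUnit _ hu).1 smul_mem)

variable [Fintype S'] [DecidableEq S'] {A : Type} [Fintype A] {act : A → Equiv.Perm S}

theorem transfer_mk_pushChain (hT : ∀ d s, T (v d s) = v' d (T s))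
    (hact : ∀ a d s, act a (v d s) = v d (act a s))
    (hfib : ∀ (F : S → k) (s : S), ∑ a, F (act a s) = ∑ s', if T s' = T s then F s' else 0)
    (c : (M.branchedCover v hv).cycles k) :
    (coverOfFibre (hv := hv) (hv' := hv') T hT).transfer k
        (Submodule.Quotient.mk ⟨pushChain M T c.1, pushChain_mem_cycles hT c.2⟩) =
      ∑ a, (coverOfFibre (hv := hv) (hv' := hv) (act a) (hact a)).transfer k
        (Submodule.Quotient.mk c) := by
  let w (a : A) : (M.branchedCover v hv).cycles k :=
    ⟨fun p : M.Dart × S => c.1 (p.1, act a p.2),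
      (coverOfFibre (hv := hv) (hv' := hv) (act a) (hact a)).comp_mem_cycles k c.2⟩
  have transfer_mk (a : A) : (coverOfFibre (hv := hv) (hv' := hv) (act a) (hact a)).transfer k
      (Submodule.Quotient.mk c) = Submodule.mkQ _ (w a) := rfl
  simp only [transfer_mk]
  rw [← map_sum]
  refine congrArg (Submodule.mkQ _) (Subtype.ext (funext fun ⟨d, s⟩ => ?_))
  exact (hfib (fun s => c.1 (d, s)) s).symm.trans
    (map_sum ((LinearMap.proj (R := k) (φ := fun _ => k) (d, s)).comp
      ((M.branchedCover v hv).cycles k).subtype) w Finset.univ).symm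

theorem exists_transfer_eq_of_invariant (hT : ∀ d s, T (v d s) = v' d (T s))
    (hact : ∀ a d s, act a (v d s) = v d (act a s))
    (hfib : ∀ (F : S → k) (s : S), ∑ a, F (act a s) = ∑ s', if T s' = T s then F s' else 0)
    (hA : IsUnit (Fintype.card A : k)) (x : (M.branchedCover v hv).H1 k)
    (hx : ∀ a, (coverOfFibre (hv := hv) (hv' := hv) (act a) (hact a)).transfer k x = x) :
    ∃ y, (coverOfFibre (hv := hv) (hv' := hv') T hT).transfer k y = x := by
  obtain ⟨r, hr⟩ := hA.exists_left_inv
  obtain ⟨c, rfl⟩ := Submodule.Quotient.mk_surjective _ x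
  refine ⟨r • Submodule.Quotient.mk ⟨pushChain M T c.1, pushChain_mem_cycles hT c.2⟩, ?_⟩
  rw [map_smul, transfer_mk_pushChain hT hact hfib]
  simp only [hx, Finset.sum_const, Finset.card_univ]
  rw [← Nat.cast_smul_eq_nsmul k, smul_smul, hr, one_smul]

end Covering

theorem mapCoeff_transfer {M' M : PolySurface} (p : Cover M' M) {k k' : Type} [CommRing k]
    [CommRing k'] (φ : k →+* k') (x : M.H1 k) :
    M'.mapCoeff φ (p.transfer k x) = p.transfer k' (M.mapCoeff φ x) :=
  Submodule.Quotient.induction_on _ x fun _ => rfl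

end PolySurface

theorem aeval_orderRep {k G V : Type} [CommRing k] [Group G] [AddCommGroup V] [Module k V]
    (ρ : Representation k G V) (z : G) (m : ℕ) (hz : ∀ g, g * z = z * g) :
    aeval (orderRep ρ z m hz z) (cyclotomic m k) = 0 := by
  ext x
  exact (map_aeval_apply (t := (orderPart ρ z m).subtype) (A := orderRep ρ z m hz z)
    (A' := ρ z) (fun _ => rfl) (cyclotomic m k) x).trans x.2

theorem Heis.inv_def {m : ℕ} (x : Heis m) : x⁻¹ = ⟨-x.a, -x.b, -x.c + x.b * x.a⟩ := rfl

section Surfaces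

open PolySurface

variable (g m : ℕ) [NeZero m]

theorem sum_fibre_WZ {k : Type} [CommRing k] (F : ZMod m × ZMod m → k) :
    ∑ h : Heis m, F (h.b, h.c) = (m : k) * ∑ s, F s := by
  rw [Heis.sum_eq, Fintype.sum_prod_type, Finset.mul_sum]
  simp

variable (k : Type) [CommRing k]

theorem transfer_repZ_zeta (x : (surfaceZ g m).H1 k) :
    (coverWZ g m).transfer k (repZ g m k (CycQ.zeta m) x) =
      repW g m k (Heis.zeta m) ((coverWZ g m).transfer k x) := by
  refine Submodule.Quotient.induction_on _ x fun c => ?_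
  refine congrArg Submodule.Quotient.mk (Subtype.ext (funext fun ⟨d, s⟩ => ?_))
  have fibre_eq : (s.b, (CycQ.zeta m)⁻¹.toAdd + s.c) =
      (((Heis.zeta m)⁻¹ * s).b, ((Heis.zeta m)⁻¹ * s).c) := by
    simp [Heis.inv_def, Heis.mul_def, CycQ.zeta, Heis.zeta]
  exact congrArg (fun s => c.1 (d, s)) fibre_eq

theorem repW_tau_transfer (x : (surfaceZ g m).H1 k) :
    repW g m k (Heis.tau m) ((coverWZ g m).transfer k x) = (coverWZ g m).transfer k x := by
  refine Submodule.Quotient.induction_on _ x fun c => ?_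
  refine congrArg Submodule.Quotient.mk (Subtype.ext (funext fun ⟨d, s⟩ => ?_))
  have fibre_eq : (((Heis.tau m)⁻¹ * s).b, ((Heis.tau m)⁻¹ * s).c) = (s.b, s.c) := by
    simp [Heis.inv_def, Heis.mul_def, Heis.tau]
  exact congrArg (fun s => c.1 (d, s)) fibre_eq

theorem sum_tau_inv_mul (F : Heis m → k) (s : Heis m) :
    ∑ a : ZMod m, F ((⟨a, 0, 0⟩ : Heis m)⁻¹ * s) =
      ∑ s' : Heis m, if (s'.b, s'.c) = (s.b, s.c) then F s' else 0 := by
  refine Eq.trans ?_ ((Heis.sum_eq m _).trans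
    (Finset.sum_eq_single s.b (fun b _ hb => by simp [hb]) (by simp))).symm
  refine Fintype.sum_equiv ((Equiv.neg _).trans (Equiv.addRight s.a)) _ _ fun a => ?_
  simp [Heis.inv_def, Heis.mul_def]

variable [Algebra ℚ k]

theorem transferWZ_injective : Function.Injective ((coverWZ g m).transfer k) :=
  transfer_injective _ (isUnit_natCast_of_ratAlgebra m k) (sum_fibre_WZ m)

theorem exists_transferWZ_eq {x : (surfaceW g m).H1 k} (hx : repW g m k (Heis.tau m) x = x) :
    ∃ y, (coverWZ g m).transfer k y = x :=
  exists_transfer_eq_of_invariant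
    (act := fun a : ZMod m => MulAction.toPermHom (Heis m) (Heis m) (⟨a, 0, 0⟩⁻¹)) _
    (fun a => handle_comm (fun s => by simp [mul_assoc]) (fun s => by simp [mul_assoc]))
    (sum_tau_inv_mul m k) (by rw [ZMod.card]; exact isUnit_natCast_of_ratAlgebra m k) x
    (rho_tau_pow_apply_of_fixed hx)

theorem transferWZ_bijOn : Set.BijOn ((coverWZ g m).transfer k) (topN g m k)
    {x | x ∈ topM g m k ∧ repW g m k (Heis.tau m) x = x} := by
  have transfer_cyclotomic := map_aeval_apply (transfer_repZ_zeta g m k) (cyclotomic m k)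
  refine ⟨fun x hx => ⟨?_, repW_tau_transfer g m k x⟩, (transferWZ_injective g m k).injOn,
    fun x hx => ?_⟩
  · change aeval (repW g m k (Heis.zeta m)) (cyclotomic m k) _ = 0
    rw [← transfer_cyclotomic, LinearMap.mem_ker.1 hx, map_zero]
  · obtain ⟨y, rfl⟩ := exists_transferWZ_eq g m k hx.2
    refine ⟨y, ?_, rfl⟩
    apply transferWZ_injective g m k
    rw [transfer_cyclotomic, map_zero]
    exact hx.1

/-- The transfer `N_m → M_m`. -/
noncomputable def topTransfer : topN g m k →ₗ[k] topM g m k :=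
  ((coverWZ g m).transfer k).restrict fun _ hx => ((transferWZ_bijOn g m k).mapsTo hx).1

theorem coe_topTransfer (n : topN g m k) :
    (topTransfer g m k n : (surfaceW g m).H1 k) = (coverWZ g m).transfer k n := rfl

theorem isTauDescent_topTransfer :
    IsTauDescent (topMRep g m k) (topNRep g m k) (topTransfer g m k) where
  cyclotomic_zeta := aeval_orderRep _ _ _ _
  injective x y hxy := Subtype.ext (transferWZ_injective g m k (congrArg Subtype.val hxy))
  mem_range_iff v := by
    refine ⟨fun ⟨n, hn⟩ => hn ▸ Subtype.ext (repW_tau_transfer g m k n), fun hv => ?_⟩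
    obtain ⟨n, hn, hnv⟩ := (transferWZ_bijOn g m k).surjOn ⟨v.2, congrArg Subtype.val hv⟩
    exact ⟨⟨n, hn⟩, Subtype.ext hnv⟩
  zeta_apply n := Subtype.ext (transfer_repZ_zeta g m k n)

theorem topMForm_invariant (h : Heis m) (x y : topM g m k) :
    topMForm g m k (topMRep g m k h x) (topMRep g m k h y) = topMForm g m k x y := by
  have transfer_inv := intersection_transfer (M := standard g)
    (hv := handle_rev g (Equiv.mulRight (Heis.sigma m)) (Equiv.mulRight (Heis.tau m)))
    (hv' := handle_rev g (Equiv.mulRight (Heis.sigma m)) (Equiv.mulRight (Heis.tau m)))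
    (T := MulAction.toPermHom (Heis m) (Heis m) h⁻¹)
    (handle_comm (fun s => by simp [mul_assoc]) (fun s => by simp [mul_assoc]))
    (n := (1 : k)) (fun F => by rw [one_mul]; exact Equiv.sum_comp _ F) x.1 y.1
  rwa [one_mul] at transfer_inv

theorem topMForm_topTransfer (x y : topN g m k) :
    topMForm g m k (topTransfer g m k x) (topTransfer g m k y) = (m : k) * topNForm g m k x y :=
  intersection_transfer _ (sum_fibre_WZ m) x.1 y.1

end Surfaces

/-! ### Cycles and boundaries of coverings branched along one handle -/

theorem sum_range_minimalPeriod {α A : Type*} [Fintype α] [AddCommMonoid A] (f : Equiv.Perm α)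
    (hf : ∀ x y, f.SameCycle x y) (F : α → A) (x : α) :
    ∑ j ∈ Finset.range (Function.minimalPeriod f x), F ((f ^ j) x) = ∑ y, F y := by
  have period_pos : 0 < Function.minimalPeriod f x :=
    Function.minimalPeriod_pos_of_mem_periodicPts (f.injective.mem_periodicPts x)
  refine Finset.sum_bij (fun j _ => (f ^ j) x) (fun _ _ => Finset.mem_univ _) ?_ ?_ fun _ _ => rfl
  · intro a ha b hb hab
    rw [Equiv.Perm.coe_pow, Equiv.Perm.coe_pow] at hab
    exact Function.iterate_injOn_Iio_minimalPeriod (Finset.mem_range.1 ha) (Finset.mem_range.1 hb)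
      hab
  · intro y _
    obtain ⟨n, -, hn⟩ := (hf x y).exists_pow_eq'
    refine ⟨n % Function.minimalPeriod f x, Finset.mem_range.2 (Nat.mod_lt _ period_pos), ?_⟩
    rw [Equiv.Perm.coe_pow, Function.iterate_mod_minimalPeriod_eq, ← Equiv.Perm.coe_pow, hn]

theorem finRotate_induction {g : ℕ} {P : Fin g → Prop} (zero : ∀ i : Fin g, i.val = 0 → P i)
    (rotate : ∀ i, P i → P (finRotate g i)) (i : Fin g) : P i := by
  obtain ⟨n, hn⟩ := i
  induction n with
  | zero => exact zero _ rfl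
  | succ n ih =>
    obtain ⟨g', rfl⟩ : ∃ g', g = g' + 1 := ⟨g - 1, by omega⟩
    have h := rotate _ (ih (by omega))
    rwa [finRotate_of_lt (by omega)] at h

namespace PolySurface

variable {g : ℕ}

theorem standard_rot_sameCycle (d d' : (standard g).Dart) : (standard g).rot.SameCycle d d' := by
  have step (x : (standard g).Dart) : (standard g).rot.SameCycle x ((standard g).rot x) :=
    Equiv.Perm.sameCycle_apply_right.2 (.refl _ x)
  have sameCycle_one (i : Fin g) (r : Fin 4) :
      (standard g).rot.SameCycle (i, r) (i, (1 : Fin 4)) := by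
    have one_two : (standard g).rot.SameCycle (i, (1 : Fin 4)) (i, (2 : Fin 4)) := step _
    have two_three : (standard g).rot.SameCycle (i, (2 : Fin 4)) (i, (3 : Fin 4)) := step _
    have three_zero : (standard g).rot.SameCycle (i, (3 : Fin 4)) (i, (0 : Fin 4)) := step _
    fin_cases r
    · exact (one_two.trans (two_three.trans three_zero)).symm
    · exact .refl _ _
    · exact one_two.symm
    · exact (one_two.trans two_three).symm
  have rotate (i : Fin g) : (standard g).rot.SameCycle (finRotate g i, (0 : Fin 4))
      (i, (1 : Fin 4)) := by
    have h : (standard g).rot (finRotate g i, (0 : Fin 4)) = (i, (1 : Fin 4)) :=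
      Prod.ext ((finRotate g).symm_apply_apply i) rfl
    exact h ▸ step _
  obtain ⟨i', r'⟩ := d'
  let i₀ : Fin g := ⟨0, i'.pos⟩
  have sameCycle_base (d : (standard g).Dart) :
      (standard g).rot.SameCycle d (i₀, (1 : Fin 4)) := by
    refine (sameCycle_one d.1 d.2).trans ?_
    refine finRotate_induction (P := fun i : Fin g => (standard g).rot.SameCycle
      (i, (1 : Fin 4)) (i₀, (1 : Fin 4))) (fun i hi => ?_) (fun i hi => ?_) d.1
    · rw [show i = i₀ from Fin.ext hi]
      exact .refl _ _
    · exact ((sameCycle_one _ 0).symm.trans (rotate i)).trans hi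
  exact (sameCycle_base d).trans (sameCycle_base (i', r')).symm

section Handle

variable {S : Type} {a b : Equiv.Perm S}

theorem handle_zero {i : Fin g} (hi : i.val = 0) (r : Fin 4) :
    handle g a b (i, r) = ![a, b, a⁻¹, b⁻¹] r := if_pos hi

theorem handle_ne_zero {i : Fin g} (hi : i.val ≠ 0) (r : Fin 4) : handle g a b (i, r) = 1 :=
  if_neg hi

section FaceInvariant

variable {A : Type*} {T : S → S} {u : (Fin g × Fin 4) × S → A}

theorem face_invariant_around_handle
    (hu : ∀ (d : Fin g × Fin 4) s, u ((standard g).face d, handle g a b d s) = u (d, s))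
    (i : Fin g) (s : S) :
    u ((finRotate g i, 0), handle g a b (i, 3) (handle g a b (i, 2) (handle g a b (i, 1)
      (handle g a b (i, 0) s)))) = u ((i, 0), s) :=
  (hu (i, 3) _).trans ((hu (i, 2) _).trans ((hu (i, 1) _).trans (hu (i, 0) s)))

-- The boundary of the polygon is one loop with monodromy `T`, and only the first handle moves
-- the fibre.
theorem face_invariant_first_side (hT : ∀ s, b⁻¹ (a⁻¹ (b (a s))) = T s)
    (hu : ∀ (d : Fin g × Fin 4) s, u ((standard g).face d, handle g a b d s) = u (d, s))
    (i : Fin g) (s : S) : u ((i, 0), T s) = u ((i, 0), s) := by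
  let i₀ : Fin g := ⟨0, i.pos⟩
  have around_ne (j : Fin g) (hj : j.val ≠ 0) (s : S) :
      u ((finRotate g j, 0), s) = u ((j, 0), s) := by
    simpa only [handle_ne_zero hj, Equiv.Perm.one_apply] using
      face_invariant_around_handle hu j s
  have around_zero (s : S) : u ((finRotate g i₀, 0), T s) = u ((i₀, 0), s) := by
    rw [← face_invariant_around_handle hu i₀ s, ← hT]
    simp only [handle_zero (show i₀.val = 0 from rfl)]
    rfl
  have rotate_eq (j : Fin g) : ∀ s, u ((finRotate g j, 0), s) = u ((finRotate g i₀, 0), s) := by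
    refine finRotate_induction
      (P := fun j => ∀ s, u ((finRotate g j, 0), s) = u ((finRotate g i₀, 0), s))
      (fun j hj s => ?_) (fun j ih s => ?_) j
    · rw [show j = i₀ from Fin.ext hj]
    · by_cases hj : (finRotate g j).val = 0
      · rw [show finRotate g j = i₀ from Fin.ext hj]
      · rw [around_ne _ hj, ih]
  have eq_first (j : Fin g) (s : S) : u ((j, 0), s) = u ((finRotate g i₀, 0), s) := by
    simpa only [Equiv.apply_symm_apply] using rotate_eq ((finRotate g).symm j) s
  rw [eq_first, around_zero, eq_first, eq_first i]

theorem face_invariant_apply (hT : ∀ s, b⁻¹ (a⁻¹ (b (a s))) = T s)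
    (hu : ∀ (d : Fin g × Fin 4) s, u ((standard g).face d, handle g a b d s) = u (d, s))
    (hTa : ∀ s, T (a s) = a (T s)) (hTb : ∀ s, T (b s) = b (T s))
    (d : Fin g × Fin 4) (s : S) : u (d, T s) = u (d, s) := by
  have step (d : Fin g × Fin 4) (hd : ∀ s, u (d, T s) = u (d, s)) (s : S) :
      u ((standard g).face d, T s) = u ((standard g).face d, s) := by
    obtain ⟨s, rfl⟩ := (handle g a b d).surjective s
    have comm : T (handle g a b d s) = handle g a b d (T s) := handle_comm hTa hTb d s
    rw [comm, hu, hu, hd]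
  obtain ⟨i, r⟩ := d
  have side_zero := face_invariant_first_side hT hu i
  have side_one : ∀ s, u ((i, 1), T s) = u ((i, 1), s) := step (i, 0) side_zero
  have side_two : ∀ s, u ((i, 2), T s) = u ((i, 2), s) := step (i, 1) side_one
  fin_cases r
  exacts [side_zero s, side_one s, side_two s, step (i, 2) side_two s]

end FaceInvariant

variable {k : Type} [CommRing k]

theorem rev_handle_eq_neg_iff {c : (Fin g × Fin 4) × S → k} :
    (∀ (d : Fin g × Fin 4) s, c ((standard g).rev d, handle g a b d s) = -c (d, s)) ↔
      (∀ i s, c ((i, 2), s) = -c ((i, 0), (handle g a b (i, 0))⁻¹ s)) ∧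
      ∀ i s, c ((i, 3), s) = -c ((i, 1), (handle g a b (i, 1))⁻¹ s) := by
  constructor
  · intro h
    refine ⟨fun i s => ?_, fun i s => ?_⟩
    · rw [← h (i, 0), ← Equiv.Perm.mul_apply, mul_inv_cancel]
      rfl
    · rw [← h (i, 1), ← Equiv.Perm.mul_apply, mul_inv_cancel]
      rfl
  · rintro ⟨h0, h1⟩ ⟨i, r⟩ s
    have handle_two : handle g a b (i, 2) = (handle g a b (i, 0))⁻¹ := handle_rev g a b (i, 0)
    have handle_three : handle g a b (i, 3) = (handle g a b (i, 1))⁻¹ := handle_rev g a b (i, 1)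
    fin_cases r
    · exact (h0 i _).trans (congrArg (fun s => -c ((i, 0), s)) (Equiv.symm_apply_apply _ s))
    · exact (h1 i _).trans (congrArg (fun s => -c ((i, 1), s)) (Equiv.symm_apply_apply _ s))
    · change c ((i, 0), handle g a b (i, 2) s) = -c ((i, 2), s)
      rw [handle_two, h0, neg_neg]
    · change c ((i, 1), handle g a b (i, 3) s) = -c ((i, 3), s)
      rw [handle_three, h1, neg_neg]

theorem sum_dart_handle {i₀ : Fin g} (hi₀ : i₀.val = 0) {c : (Fin g × Fin 4) × S → k}
    (h0 : ∀ i s, c ((i, 2), s) = -c ((i, 0), (handle g a b (i, 0))⁻¹ s))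
    (h1 : ∀ i s, c ((i, 3), s) = -c ((i, 1), (handle g a b (i, 1))⁻¹ s)) (s : S) :
    ∑ d, c (d, s) =
      c ((i₀, 0), s) - c ((i₀, 0), a⁻¹ s) + c ((i₀, 1), s) - c ((i₀, 1), b⁻¹ s) := by
  rw [Fintype.sum_prod_type, Finset.sum_eq_single i₀ _ (by simp)]
  · rw [Fin.sum_univ_four, h0, h1, handle_zero hi₀, handle_zero hi₀]
    change c ((i₀, 0), s) + c ((i₀, 1), s) + -c ((i₀, 0), a⁻¹ s) + -c ((i₀, 1), b⁻¹ s) = _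
    ring
  · intro i _ hi
    have hi' : i.val ≠ 0 := fun h => hi (Fin.ext (h.trans hi₀.symm))
    rw [Fin.sum_univ_four, h0, h1, handle_ne_zero hi', handle_ne_zero hi']
    simp

theorem mem_cycles_handle [Fintype S] {i₀ : Fin g} (hi₀ : i₀.val = 0)
    {c : (Fin g × Fin 4) × S → k} :
    c ∈ ((standard g).branchedCover (handle g a b) (handle_rev g a b)).cycles k ↔
      ((∀ i s, c ((i, 2), s) = -c ((i, 0), (handle g a b (i, 0))⁻¹ s)) ∧
        ∀ i s, c ((i, 3), s) = -c ((i, 1), (handle g a b (i, 1))⁻¹ s)) ∧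
      ∀ s, c ((i₀, 0), s) - c ((i₀, 0), a⁻¹ s) + c ((i₀, 1), s) - c ((i₀, 1), b⁻¹ s) = 0 := by
  have sum_rot (d : Fin g × Fin 4) (s : S) :
      ∑ j ∈ Finset.range ((standard g).deg d), c (((standard g).rot ^ j) d, s) =
        ∑ d : Fin g × Fin 4, c (d, s) :=
    sum_range_minimalPeriod _ standard_rot_sameCycle (fun d => c (d, s)) d
  refine (mem_cycles_branchedCover (M := standard g)).trans
    ((and_congr_left' rev_handle_eq_neg_iff).trans (and_congr_right fun ⟨h0, h1⟩ => ?_))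
  simp only [← sum_dart_handle hi₀ h0 h1]
  exact ⟨fun h s => (sum_rot (i₀, 0) s).symm.trans (h (i₀, (0 : Fin 4)) s),
    fun h d s => (sum_rot d s).trans (h s)⟩

theorem boundaries_handle_apply [Fintype S] {T : S → S} (hT : ∀ s, b⁻¹ (a⁻¹ (b (a s))) = T s)
    (hTa : ∀ s, T (a s) = a (T s)) (hTb : ∀ s, T (b s) = b (T s))
    {c : (standard g).Dart × S → k}
    (hc : c ∈ ((standard g).branchedCover (handle g a b) (handle_rev g a b)).boundaries k)
    (d : (standard g).Dart) (s : S) : c (d, T s) = c (d, s) := by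
  obtain ⟨u, hu, hcu⟩ := (mem_boundaries_branchedCover (M := standard g)).1 hc
  have invariant (d : (standard g).Dart) (s : S) : u (d, T s) = u (d, s) :=
    face_invariant_apply hT hu hTa hTb d s
  calc c (d, T s)
    _ = u (d, T s) - u ((standard g).rev d, handle g a b d (T s)) := hcu d (T s)
    _ = u (d, s) - u ((standard g).rev d, handle g a b d s) := by
      rw [← handle_comm hTa hTb, invariant, invariant]
    _ = c (d, s) := (hcu d s).symm

end Handle

end PolySurface

/-! ### The dimension of `N_m` -/

section Fourier

variable (m : ℕ) [NeZero m]

/-- The `ζ_m⁻¹`-component of the Fourier transform of a rational function on `ℤ/m`. -/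
noncomputable def charCoeff : (ZMod m → ℚ) →ₗ[ℚ] CyclotomicField m ℚ where
  toFun f := ∑ j, (f j : CyclotomicField m ℚ) * rootChar m (-j)
  map_add' f f' := by simp [add_mul, Finset.sum_add_distrib]
  map_smul' r f := by
    refine Eq.trans ?_ (Algebra.smul_def _ _).symm
    simp [Finset.mul_sum, mul_assoc]

theorem charCoeff_apply (f : ZMod m → ℚ) :
    charCoeff m f = ∑ j, (f j : CyclotomicField m ℚ) * rootChar m (-j) := rfl

theorem charCoeff_shift (f : ZMod m → ℚ) (a : ZMod m) :
    charCoeff m (fun j => f (j - a)) = rootChar m (-a) * charCoeff m f := by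
  rw [charCoeff_apply, charCoeff_apply, Finset.mul_sum]
  refine Fintype.sum_equiv (Equiv.subRight a) _ _ fun j => ?_
  rw [Equiv.subRight_apply, mul_left_comm, ← AddChar.map_add_eq_mul]
  congr 2
  ring

variable {m} in
theorem charCoeff_const (hm : 2 ≤ m) (r : ℚ) : charCoeff m (fun _ => r) = 0 := by
  have : Fact (1 < m) := ⟨hm⟩
  have h := sum_rootChar_mul m (-1)
  simp only [mul_neg, mul_one, neg_eq_zero, one_ne_zero, if_false] at h
  rw [charCoeff_apply, ← Finset.mul_sum, h, mul_zero]

/-- The inverse of `charCoeff` on the rational functions on `ℤ/m` on which the shift has order `m`;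
it is the adjoint of `charCoeff` for the trace form, up to the factor `m`. -/
noncomputable def ofCharCoeff : CyclotomicField m ℚ →ₗ[ℚ] (ZMod m → ℚ) :=
  LinearMap.pi fun j => (m : ℚ)⁻¹ • Algebra.trace ℚ (CyclotomicField m ℚ) ∘ₗ
    LinearMap.mulRight ℚ (rootChar m j)

theorem ofCharCoeff_apply (κ : CyclotomicField m ℚ) (j : ZMod m) :
    ofCharCoeff m κ j = (m : ℚ)⁻¹ * Algebra.trace ℚ (CyclotomicField m ℚ) (κ * rootChar m j) := rfl

theorem ofCharCoeff_shift (κ : CyclotomicField m ℚ) (j a : ZMod m) :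
    ofCharCoeff m κ (j - a) = ofCharCoeff m (rootChar m (-a) * κ) j := by
  rw [ofCharCoeff_apply, ofCharCoeff_apply, sub_eq_neg_add, AddChar.map_add_eq_mul, mul_left_comm,
    mul_assoc]

theorem charCoeff_ofCharCoeff (κ : CyclotomicField m ℚ) :
    charCoeff m (ofCharCoeff m κ) = κ := by
  simp only [charCoeff_apply, ofCharCoeff_apply, Rat.cast_mul, Rat.cast_inv, Rat.cast_natCast,
    mul_assoc, ← Finset.mul_sum, sum_trace_mul_rootChar]
  exact inv_mul_cancel_left₀ (natCast_cyclotomicField_ne_zero m) κ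

theorem sum_idemCoeff_mul (f : ZMod m → ℚ) (j : ZMod m) :
    ∑ q, idemCoeff m q * f (j - q) = ofCharCoeff m (charCoeff m f) j := by
  have charCoeff_eq_smul : charCoeff m f = ∑ q, f q • rootChar m (-q) :=
    Finset.sum_congr rfl fun q _ => (Rat.smul_def _ _).symm
  rw [charCoeff_eq_smul, map_sum, Finset.sum_apply]
  refine Fintype.sum_equiv (Equiv.subLeft j) _ _ fun q => ?_
  rw [Equiv.subLeft_apply, map_smul, Pi.smul_apply, smul_eq_mul, ofCharCoeff_apply,
    ← AddChar.map_add_eq_mul, neg_sub, sub_add_cancel, idemCoeff]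
  ring

end Fourier

section OrderPart

variable {m : ℕ} {k G V : Type} [CommRing k] [Group G] [AddCommGroup V] [Module k V]
  {ρ : Representation k G V} {z : G}

theorem coe_asAlgebraHom_orderRep (hz : ∀ g, g * z = z * g) (a : MonoidAlgebra k G)
    (x : orderPart ρ z m) :
    ((orderRep ρ z m hz).asAlgebraHom a x : V) = ρ.asAlgebraHom a x := by
  induction a using MonoidAlgebra.induction_linear with
  | zero => simp
  | add a b ha hb => simp [ha, hb]
  | single h r =>
    rw [Representation.asAlgebraHom_single, Representation.asAlgebraHom_single]
    rfl

theorem asAlgebraHom_mem_orderPart {a : MonoidAlgebra k G} (ha : a ∈ topFactor k z m) (x : V) :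
    ρ.asAlgebraHom a x ∈ orderPart ρ z m := by
  have h := congrArg (fun b => ρ.asAlgebraHom b x) (mem_topFactor_iff.1 ha)
  simp only [map_mul, map_zero, Module.End.mul_apply, LinearMap.zero_apply, ← aeval_algHom_apply,
    Representation.asAlgebraHom_of] at h
  exact h

end OrderPart

theorem sum_idemCoeff_smul_of_mem_orderPart {m : ℕ} [NeZero m] {G V : Type} [Group G]
    [AddCommGroup V] [Module ℚ V] {ρ : Representation ℚ G V} {z : G} {x : V}
    (hx : x ∈ orderPart ρ z m) : ∑ j : ZMod m, idemCoeff m j • ρ (z ^ j.val) x = x := by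
  have h := aeval_map_apply_eq_of_aeval_rootChar_eq (LinearMap.mem_ker.1 hx) (p := idemPoly m)
    (q := 1) (by rw [aeval_rootChar_idemPoly, map_one])
  simpa only [Algebra.algebraMap_self, Polynomial.map_id, aeval_idemPoly, map_one, ← map_pow,
    LinearMap.sum_apply, LinearMap.smul_apply, Module.End.one_apply] using h

section SurfaceZ

open PolySurface

variable {g m : ℕ}

theorem monodromyE_inv_apply (l j : ZMod m) : (monodromyE m)⁻¹ (l, j) = (l - 1, j) := by
  rw [Equiv.Perm.inv_eq_iff_eq]
  simp [monodromyE]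

theorem monodromyF_inv_apply (l j : ZMod m) : (monodromyF m)⁻¹ (l, j) = (l, j - l) := by
  rw [Equiv.Perm.inv_eq_iff_eq]
  simp [monodromyF, Equiv.prodShear]

theorem monodromy_commutator_apply (s : ZMod m × ZMod m) :
    (monodromyF m)⁻¹ ((monodromyE m)⁻¹ (monodromyF m (monodromyE m s))) = (s.1, s.2 + 1) := by
  obtain ⟨l, j⟩ := s
  change (monodromyF m)⁻¹ ((monodromyE m)⁻¹ (l + 1, j + (l + 1))) = (l, j + 1)
  rw [monodromyE_inv_apply, monodromyF_inv_apply]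
  ext <;> ring

variable [NeZero m]

theorem boundaries_surfaceZ_apply {c : (Fin g × Fin 4) × (ZMod m × ZMod m) → ℚ}
    (hc : c ∈ (surfaceZ g m).boundaries ℚ) (d : Fin g × Fin 4) (l j : ZMod m) :
    c (d, (l, j)) = c (d, (l, 0)) := by
  have shift (j : ZMod m) : c (d, (l, j + 1)) = c (d, (l, j)) :=
    boundaries_handle_apply monodromy_commutator_apply (fun _ => rfl)
      (fun s => by simp [monodromyF, Equiv.prodShear, add_right_comm]) hc d (l, j)
  have natCast_apply (n : ℕ) : c (d, (l, (n : ZMod m))) = c (d, (l, 0)) := by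
    induction n with
    | zero => rw [Nat.cast_zero]
    | succ n ih => rw [Nat.cast_succ, shift, ih]
  rw [← natCast_apply j.val, ZMod.natCast_zmod_val]

variable (g m) in
/-- The coefficients of a chain of `Z` on the lifts of the edges `e_i` and `f_i` (the directed
edges `(i, 0)` and `(i, 1)`), Fourier transformed along the orbits of `ζ`. -/
noncomputable def chainFourier : ((Fin g × Fin 4) × (ZMod m × ZMod m) → ℚ) →ₗ[ℚ]
    ((Fin g × Fin 2) × ZMod m → CyclotomicField m ℚ) :=
  LinearMap.pi fun p => charCoeff m ∘ₗ
    LinearMap.funLeft ℚ ℚ fun j => ((p.1.1, Fin.castLE (by decide) p.1.2), (p.2, j))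

theorem chainFourier_apply (c : (Fin g × Fin 4) × (ZMod m × ZMod m) → ℚ) (i : Fin g) (r : Fin 2)
    (l : ZMod m) : chainFourier g m c ((i, r), l) =
      charCoeff m fun j => c ((i, Fin.castLE (by decide) r), (l, j)) := rfl

theorem chainFourier_boundary (hm : 2 ≤ m) {c : (Fin g × Fin 4) × (ZMod m × ZMod m) → ℚ}
    (hc : c ∈ (surfaceZ g m).boundaries ℚ) : chainFourier g m c = 0 := by
  ext ⟨⟨i, r⟩, l⟩
  simp only [chainFourier_apply, boundaries_surfaceZ_apply hc _ _ _]
  exact charCoeff_const hm _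

/-- The map that `chainFourier` induces on `H₁(Z; ℚ)`. -/
noncomputable def homologyFourier (hm : 2 ≤ m) : (surfaceZ g m).H1 ℚ →ₗ[ℚ]
    ((Fin g × Fin 2) × ZMod m → CyclotomicField m ℚ) :=
  Submodule.liftQ _ (chainFourier g m ∘ₗ ((surfaceZ g m).cycles ℚ).subtype) fun _ hc =>
    chainFourier_boundary hm hc

theorem homologyFourier_mk (hm : 2 ≤ m) (c : (surfaceZ g m).cycles ℚ) :
    homologyFourier hm (Submodule.Quotient.mk c) = chainFourier g m c.1 := rfl

theorem exists_repZ_mk_eq (q : CycQ m) (c : (surfaceZ g m).cycles ℚ) :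
    ∃ c' : (surfaceZ g m).cycles ℚ,
      repZ g m ℚ q (Submodule.Quotient.mk c) = Submodule.Quotient.mk c' ∧
      ∀ (d : Fin g × Fin 4) (l j : ZMod m), c'.1 (d, (l, j)) = c.1 (d, (l, j - q.toAdd)) := by
  refine ⟨_, rfl, fun d l j => ?_⟩
  change c.1 (d, (l, -q.toAdd + j)) = _
  rw [neg_add_eq_sub]

theorem homologyFourier_repZ (hm : 2 ≤ m) (q : CycQ m) (x : (surfaceZ g m).H1 ℚ) :
    homologyFourier hm (repZ g m ℚ q x) = rootChar m (-q.toAdd) • homologyFourier hm x := by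
  obtain ⟨c, rfl⟩ := Submodule.Quotient.mk_surjective _ x
  obtain ⟨c', h, hc'⟩ := exists_repZ_mk_eq q c
  rw [h, homologyFourier_mk, homologyFourier_mk]
  ext ⟨⟨i, r⟩, l⟩
  rw [Pi.smul_apply, smul_eq_mul]
  refine (congrArg (charCoeff m) (funext fun j => hc' _ _ j)).trans ?_
  exact charCoeff_shift m (fun j => c.1 ((i, Fin.castLE (by decide) r), (l, j))) q.toAdd

theorem homologyFourier_asAlgebraHom (hm : 2 ≤ m) (a : MonoidAlgebra ℚ (CycQ m))
    (x : (surfaceZ g m).H1 ℚ) : homologyFourier hm ((repZ g m ℚ).asAlgebraHom a x) =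
      cycAlg m a • homologyFourier hm x := by
  induction a using MonoidAlgebra.induction_linear with
  | zero => simp
  | add a b ha hb => simp [ha, hb, add_smul]
  | single q r =>
    rw [Representation.asAlgebraHom_single, LinearMap.smul_apply, map_smul, homologyFourier_repZ,
      cycAlg_single, mul_smul]
    exact (algebraMap_smul (CyclotomicField m ℚ) r _).symm.trans (by rw [eq_ratCast])

theorem homologyFourier_cycAction (hm : 2 ≤ m)
    (hρ : aeval (topNRep g m ℚ (CycQ.zeta m)) (cyclotomic m ℚ) = 0) (κ : CyclotomicField m ℚ)
    (n : topN g m ℚ) :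
    homologyFourier hm (cycAction hρ κ n).1 = κ • homologyFourier hm n.1 := by
  obtain ⟨a, rfl⟩ := cycAlg_surjective m κ
  rw [cycAction_cycAlg, coe_asAlgebraHom_orderRep, homologyFourier_asAlgebraHom]

theorem exists_mk_eq_of_mem_topN {c : (surfaceZ g m).cycles ℚ}
    (hc : (Submodule.Quotient.mk c : (surfaceZ g m).H1 ℚ) ∈ topN g m ℚ) :
    ∃ c' : (surfaceZ g m).cycles ℚ,
      (Submodule.Quotient.mk c' : (surfaceZ g m).H1 ℚ) = Submodule.Quotient.mk c ∧
      ∀ (d : Fin g × Fin 4) (l j : ZMod m),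
        c'.1 (d, (l, j)) = ofCharCoeff m (charCoeff m fun j => c.1 (d, (l, j))) j := by
  choose c' hc' hc'_apply using fun q : ZMod m => exists_repZ_mk_eq (Multiplicative.ofAdd q) c
  refine ⟨∑ q, idemCoeff m q • c' q, ?_, fun d l j => ?_⟩
  · have h := sum_idemCoeff_smul_of_mem_orderPart hc
    simp only [CycQ.zeta_pow_val, hc'] at h
    exact (map_sum (Submodule.mkQ _) _ _).trans h
  · rw [← sum_idemCoeff_mul]
    refine (map_sum ((LinearMap.proj (R := ℚ) (φ := fun _ => ℚ) (d, (l, j))).comp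
      ((surfaceZ g m).cycles ℚ).subtype) (fun q => idemCoeff m q • c' q) Finset.univ).trans ?_
    exact Finset.sum_congr rfl fun q _ => congrArg (idemCoeff m q * ·) (hc'_apply q d l j)

theorem eq_zero_of_homologyFourier_eq_zero (hm : 2 ≤ m) {x : (surfaceZ g m).H1 ℚ}
    (hx : x ∈ topN g m ℚ) (h : homologyFourier hm x = 0) : x = 0 := by
  obtain ⟨c, rfl⟩ := Submodule.Quotient.mk_surjective _ x
  obtain ⟨c', hcc', hc'⟩ := exists_mk_eq_of_mem_topN hx
  have edge_eq_zero (i : Fin g) (r : Fin 2) (s : ZMod m × ZMod m) :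
      c'.1 ((i, Fin.castLE (by decide) r), s) = 0 := by
    have charCoeff_eq_zero :
        charCoeff m (fun j => c.1 ((i, Fin.castLE (by decide) r), (s.1, j))) = 0 :=
      congrFun h ((i, r), s.1)
    refine (hc' _ s.1 s.2).trans ?_
    rw [charCoeff_eq_zero, map_zero, Pi.zero_apply]
  have c'_eq_zero : c' = 0 := by
    refine Subtype.ext (funext fun ⟨⟨i, r⟩, s⟩ => ?_)
    have h_rev := ((mem_cycles_handle (i₀ := ⟨0, i.pos⟩) rfl).1 c'.2).1
    fin_cases r
    · exact edge_eq_zero i 0 s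
    · exact edge_eq_zero i 1 s
    · exact (h_rev.1 i s).trans (neg_eq_zero.2 (edge_eq_zero i 0 _))
    · exact (h_rev.2 i s).trans (neg_eq_zero.2 (edge_eq_zero i 1 _))
  rw [← hcc', c'_eq_zero, Submodule.Quotient.mk_zero]

/-- The vertex condition of a cycle of `Z`, Fourier transformed: `X` satisfies it if and only if
it belongs to the kernel. Here `i₀` is the handle around which the monodromy is nontrivial. -/
noncomputable def vertexMap (i₀ : Fin g) :
    ((Fin g × Fin 2) × ZMod m → CyclotomicField m ℚ) →ₗ[CyclotomicField m ℚ]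
      (ZMod m → CyclotomicField m ℚ) where
  toFun X l := X ((i₀, 0), l) - X ((i₀, 0), l - 1) + (1 - rootChar m (-l)) * X ((i₀, 1), l)
  map_add' X X' := by
    ext l
    simp only [Pi.add_apply]
    ring
  map_smul' r X := by
    ext l
    simp only [Pi.smul_apply, smul_eq_mul, RingHom.id_apply]
    ring

theorem vertexMap_apply (i₀ : Fin g) (X : (Fin g × Fin 2) × ZMod m → CyclotomicField m ℚ)
    (l : ZMod m) : vertexMap i₀ X l =
      X ((i₀, 0), l) - X ((i₀, 0), l - 1) + (1 - rootChar m (-l)) * X ((i₀, 1), l) := rfl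

-- For `l ≠ 0` solve for the coefficient of `f_{i₀}`, as `ζ_m^{-l} ≠ 1`; for `l = 0` use `e_{i₀}`.
theorem vertexMap_surjective (hm : 2 ≤ m) (i₀ : Fin g) :
    Function.Surjective (vertexMap (m := m) i₀) := by
  have : Fact (1 < m) := ⟨hm⟩
  intro w
  let u : ZMod m → CyclotomicField m ℚ := Pi.single 0 (w 0)
  refine ⟨fun p => ![u p.2, (w p.2 - u p.2 + u (p.2 - 1)) / (1 - rootChar m (-p.2))] p.1.2,
    funext fun l => ?_⟩
  change u l - u (l - 1) +
    (1 - rootChar m (-l)) * ((w l - u l + u (l - 1)) / (1 - rootChar m (-l))) = w l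
  by_cases hl : l = 0
  · subst hl
    simp [u]
  · have hne : 1 - rootChar m (-l) ≠ 0 := fun h =>
      hl (neg_eq_zero.1 ((rootChar_eq_one_iff m).1 (sub_eq_zero.1 h).symm))
    rw [mul_div_cancel₀ _ hne]
    ring

theorem finrank_ker_vertexMap (hm : 2 ≤ m) (i₀ : Fin g) :
    Module.finrank (CyclotomicField m ℚ) (LinearMap.ker (vertexMap (m := m) i₀)) =
      (2 * g - 1) * m := by
  have h := LinearMap.finrank_range_add_finrank_ker (vertexMap (m := m) i₀)
  rw [LinearMap.range_eq_top.2 (vertexMap_surjective hm i₀), finrank_top,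
    Module.finrank_fintype_fun_eq_card, Module.finrank_fintype_fun_eq_card, ZMod.card,
    Fintype.card_prod, Fintype.card_prod, Fintype.card_fin, Fintype.card_fin, ZMod.card] at h
  rw [Nat.sub_mul, one_mul, mul_comm 2 g]
  omega

theorem vertexMap_homologyFourier (hm : 2 ≤ m) {i₀ : Fin g} (hi₀ : i₀.val = 0)
    (x : (surfaceZ g m).H1 ℚ) : vertexMap i₀ (homologyFourier hm x) = 0 := by
  obtain ⟨c, rfl⟩ := Submodule.Quotient.mk_surjective _ x
  have vertex_eq := ((mem_cycles_handle hi₀).1 c.2).2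
  ext l
  have coeff_e (l : ZMod m) : chainFourier g m c.1 ((i₀, 0), l) =
      charCoeff m fun j => c.1 ((i₀, 0), (l, j)) := rfl
  have coeff_f : chainFourier g m c.1 ((i₀, 1), l) =
      charCoeff m fun j => c.1 ((i₀, 1), (l, j)) := rfl
  rw [homologyFourier_mk, vertexMap_apply, coeff_e, coeff_e, coeff_f, sub_mul, one_mul,
    ← charCoeff_shift m (fun j => c.1 ((i₀, 1), (l, j))), ← add_sub_assoc, ← map_sub, ← map_add,
    ← map_sub]
  refine (congrArg (charCoeff m) (funext fun j => ?_)).trans (map_zero _)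
  have h := vertex_eq (l, j)
  rwa [monodromyE_inv_apply, monodromyF_inv_apply] at h

/-- The chain of `Z` with Fourier coefficients `X` on the lifts of the edges `e_i` and `f_i`,
extended to the reversed edges by the sign rule for cycles. -/
noncomputable def chainOfFourier (X : (Fin g × Fin 2) × ZMod m → CyclotomicField m ℚ) :
    (Fin g × Fin 4) × (ZMod m × ZMod m) → ℚ :=
  let edge (i : Fin g) (r : Fin 2) (s : ZMod m × ZMod m) : ℚ := ofCharCoeff m (X ((i, r), s.1)) s.2
  let v := handle g (monodromyE m) (monodromyF m)
  fun p => ![edge p.1.1 0 p.2, edge p.1.1 1 p.2, -edge p.1.1 0 ((v (p.1.1, 0))⁻¹ p.2),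
    -edge p.1.1 1 ((v (p.1.1, 1))⁻¹ p.2)] p.1.2

theorem chainFourier_chainOfFourier (X : (Fin g × Fin 2) × ZMod m → CyclotomicField m ℚ) :
    chainFourier g m (chainOfFourier X) = X := by
  refine funext fun ⟨⟨i, r⟩, l⟩ => ?_
  fin_cases r
  · exact charCoeff_ofCharCoeff m (X ((i, 0), l))
  · exact charCoeff_ofCharCoeff m (X ((i, 1), l))

theorem chainOfFourier_mem_cycles {i₀ : Fin g} (hi₀ : i₀.val = 0)
    {X : (Fin g × Fin 2) × ZMod m → CyclotomicField m ℚ} (hX : vertexMap i₀ X = 0) :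
    chainOfFourier X ∈ (surfaceZ g m).cycles ℚ := by
  refine (mem_cycles_handle hi₀).2 ⟨⟨fun _ _ => rfl, fun _ _ => rfl⟩, fun ⟨l, j⟩ => ?_⟩
  rw [monodromyE_inv_apply, monodromyF_inv_apply]
  change ofCharCoeff m (X ((i₀, 0), l)) j - ofCharCoeff m (X ((i₀, 0), l - 1)) j +
    ofCharCoeff m (X ((i₀, 1), l)) j - ofCharCoeff m (X ((i₀, 1), l)) (j - l) = 0
  have h := congrFun hX l
  rw [vertexMap_apply, Pi.zero_apply, sub_mul, one_mul, ← add_sub_assoc] at h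
  rw [ofCharCoeff_shift, ← Pi.sub_apply, ← Pi.add_apply, ← Pi.sub_apply, ← map_sub, ← map_add,
    ← map_sub, h, map_zero, Pi.zero_apply]

theorem homologyFourier_bijOn (hm : 2 ≤ m) {i₀ : Fin g} (hi₀ : i₀.val = 0) :
    Set.BijOn (homologyFourier (g := g) hm) (topN g m ℚ : Set ((surfaceZ g m).H1 ℚ))
      (LinearMap.ker (vertexMap (m := m) i₀)) := by
  refine ⟨fun x _ => vertexMap_homologyFourier hm hi₀ x, fun x hx y hy hxy => ?_, fun X hX => ?_⟩
  · refine sub_eq_zero.1 (eq_zero_of_homologyFourier_eq_zero hm (Submodule.sub_mem _ hx hy) ?_)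
    rw [map_sub, hxy, sub_self]
  · obtain ⟨a, ha, ha1⟩ := (cycAlg_bijOn m).surjOn (Set.mem_univ 1)
    refine ⟨_, asAlgebraHom_mem_orderPart ha
      (Submodule.Quotient.mk ⟨_, chainOfFourier_mem_cycles hi₀ hX⟩), ?_⟩
    rw [homologyFourier_asAlgebraHom, ha1, one_smul, homologyFourier_mk,
      chainFourier_chainOfFourier]

theorem exists_bijective_sum_cycAction_topN (hg : 1 ≤ g) (hm : 2 ≤ m)
    (hρ : aeval (topNRep g m ℚ (CycQ.zeta m)) (cyclotomic m ℚ) = 0) :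
    ∃ y : Fin (2 * g - 1) × ZMod m → topN g m ℚ,
      Function.Bijective fun κ : Fin (2 * g - 1) × ZMod m → CyclotomicField m ℚ =>
        ∑ p, cycAction hρ (κ p) (y p) := by
  let i₀ : Fin g := ⟨0, hg⟩
  let _ : Module (CyclotomicField m ℚ) (topN g m ℚ) :=
    Module.compHom _ (cycAction hρ).toRingHom
  let fourierEquiv : topN g m ℚ ≃ₗ[CyclotomicField m ℚ] LinearMap.ker (vertexMap (m := m) i₀) :=
    { Set.BijOn.equiv _ (homologyFourier_bijOn hm rfl) with
      map_add' := fun n n' => Subtype.ext (map_add (homologyFourier hm) n.1 n'.1)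
      map_smul' := fun κ n => Subtype.ext (homologyFourier_cycAction hm hρ κ n) }
  have card_eq : Module.finrank (CyclotomicField m ℚ) (LinearMap.ker (vertexMap (m := m) i₀)) =
      Fintype.card (Fin (2 * g - 1) × ZMod m) := by
    rw [finrank_ker_vertexMap hm, Fintype.card_prod, Fintype.card_fin, ZMod.card]
  let b := ((Module.finBasisOfFinrankEq _ _ card_eq).map fourierEquiv.symm).reindex
    (Fintype.equivFin _).symm
  have equivFun_symm_eq : ⇑b.equivFun.symm = fun κ => ∑ p, cycAction hρ (κ p) (b p) :=
    funext fun κ => b.equivFun_symm_apply κ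
  exact ⟨b, equivFun_symm_eq ▸ b.equivFun.symm.bijective⟩

end SurfaceZ

/-! ### Naturality, and freeness of `M_m` -/

theorem transfer_eq_of_restricts {g m : ℕ} {k : Type} [NeZero m] [CommRing k] [Algebra ℚ k]
    {f : topM g m k → topM g m k} {f' : topN g m k → topN g m k}
    (hf : ∀ n, topTransfer g m k (f' n) = f (topTransfer g m k n)) {n : topN g m k}
    {x : topM g m k} (hx : (x : (surfaceW g m).H1 k) = (coverWZ g m).transfer k n) :
    (coverWZ g m).transfer k (f' n) = f x := by
  obtain rfl : x = topTransfer g m k n := Subtype.ext hx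
  exact congrArg Subtype.val (hf n)

theorem mapCoeff_eq_of_restricts {g m : ℕ} {k k' : Type} [NeZero m] [CommRing k] [Algebra ℚ k]
    [CommRing k'] [Algebra ℚ k'] (φ : k →+* k')
    {f₁ : topM g m k → topM g m k} {f₁' : topN g m k → topN g m k}
    {f₂ : topM g m k' → topM g m k'} {f₂' : topN g m k' → topN g m k'}
    (h₁ : ∀ n, topTransfer g m k (f₁' n) = f₁ (topTransfer g m k n))
    (h₂ : ∀ n, topTransfer g m k' (f₂' n) = f₂ (topTransfer g m k' n))
    (hf : ∀ (x : topM g m k) (x' : topM g m k'),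
      (x' : (surfaceW g m).H1 k') = (surfaceW g m).mapCoeff φ x →
      (f₂ x' : (surfaceW g m).H1 k') = (surfaceW g m).mapCoeff φ (f₁ x))
    {n : topN g m k} {n' : topN g m k'}
    (hn : (n' : (surfaceZ g m).H1 k') = (surfaceZ g m).mapCoeff φ n) :
    (f₂' n' : (surfaceZ g m).H1 k') = (surfaceZ g m).mapCoeff φ (f₁' n) := by
  apply transferWZ_injective g m k'
  rw [← coe_topTransfer, h₂, ← PolySurface.mapCoeff_transfer, ← coe_topTransfer, h₁]
  refine hf _ _ ?_
  rw [coe_topTransfer, coe_topTransfer, hn, PolySurface.mapCoeff_transfer]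

theorem exists_isFactorBasis_topM {g m : ℕ} [NeZero m] (hg : 1 ≤ g) (hm : 2 ≤ m) :
    ∃ x : Fin (2 * g - 1) → topM g m ℚ, IsFactorBasis (topMRep g m ℚ) (Heis.zeta m) m x := by
  have H := isTauDescent_topTransfer g m ℚ
  obtain ⟨y, hy⟩ := exists_bijective_sum_cycAction_topN hg hm H.cyclotomic_zeta'
  exact ⟨_, (H.isFactorBasis_heis_iff _).2 (H.bijective_sum_matAction hy)⟩

theorem mainTheorem7_general (g m : ℕ) [NeZero m] (hg : 1 ≤ g) (hm : 2 ≤ m) :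
    (∀ (k : Type) [CommRing k] [Algebra ℚ k],
      Set.BijOn ((coverWZ g m).transfer k) (topN g m k)
        {x | x ∈ topM g m k ∧ repW g m k (Heis.tau m) x = x}) ∧
    ∃ α : ∀ (k : Type) [CommRing k] [Algebra ℚ k], GroupG g m k ≃* GroupGnn g m k,
      (∀ (k : Type) [CommRing k] [Algebra ℚ k] (f : GroupG g m k) (n : topN g m k)
        (x : topM g m k), (x : (surfaceW g m).H1 k) = (coverWZ g m).transfer k n →
          (coverWZ g m).transfer k ((α k f).1 n) = f.1 x) ∧
      (∀ (k k' : Type) [CommRing k] [Algebra ℚ k] [CommRing k'] [Algebra ℚ k'] (φ : k →ₐ[ℚ] k')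
        (f : GroupG g m k) (f' : GroupG g m k'),
        (∀ (x : topM g m k) (x' : topM g m k'),
          (x' : (surfaceW g m).H1 k') = (surfaceW g m).mapCoeff φ.toRingHom x →
          (f'.1 x' : (surfaceW g m).H1 k') = (surfaceW g m).mapCoeff φ.toRingHom (f.1 x)) →
        ∀ (n : topN g m k) (n' : topN g m k'),
          (n' : (surfaceZ g m).H1 k') = (surfaceZ g m).mapCoeff φ.toRingHom n →
          ((α k' f').1 n' : (surfaceZ g m).H1 k') =
            (surfaceZ g m).mapCoeff φ.toRingHom ((α k f).1 n)) ∧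
      Set.BijOn (heisAlg m) (topFactor ℚ (Heis.zeta m) m) Set.univ ∧
      Set.BijOn (cycAlg m) (topFactor ℚ (CycQ.zeta m) m) Set.univ ∧
      (∃ x : Fin (2 * g - 1) → topM g m ℚ, IsFactorBasis (topMRep g m ℚ) (Heis.zeta m) m x) ∧
      ∀ x : Fin (2 * g - 1) → topM g m ℚ, IsFactorBasis (topMRep g m ℚ) (Heis.zeta m) m x →
        ∃ y : Fin (2 * g - 1) × ZMod m → topN g m ℚ,
          (∀ a i, ∀ e ∈ topFactor ℚ (Heis.zeta m) m, heisAlg m e = Matrix.single 0 i 1 →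
            (coverWZ g m).transfer ℚ (y (a, i)) = (topMRep g m ℚ).asAlgebraHom e (x a)) ∧
          IsFactorBasis (topNRep g m ℚ) (CycQ.zeta m) m y ∧
          (∃ c : ℚ, c ≠ 0 ∧ gramH m g x = c • gramQ m g y) ∧
          matrixUnitary m (gramH m g x) = matrixUnitary m (gramQ m g y) ∧
          ∃ (μ : GroupG g m ℚ ≃* matrixUnitary m (gramH m g x))
            (ν : GroupGnn g m ℚ ≃* matrixUnitary m (gramQ m g y)),
            (∀ f : GroupG g m ℚ,
              ∃ γ : Fin (2 * g - 1) → Fin (2 * g - 1) → topFactor ℚ (Heis.zeta m) m,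
                (∀ b, f.1 (x b) = ∑ a, (topMRep g m ℚ).asAlgebraHom (γ a b).1 (x a)) ∧
                ∀ p q, (μ f).1.1 p q = heisAlg m (γ p.1 q.1).1 q.2 p.2) ∧
            (∀ f : GroupGnn g m ℚ,
              ∃ η : Fin (2 * g - 1) × ZMod m → Fin (2 * g - 1) × ZMod m →
                  topFactor ℚ (CycQ.zeta m) m,
                (∀ q, f.1 (y q) = ∑ p, (topNRep g m ℚ).asAlgebraHom (η p q).1 (y p)) ∧
                ∀ p q, (ν f).1.1 p q = cycAlg m (η p q).1) ∧
            ∀ f : GroupG g m ℚ, (ν (α ℚ f)).1 = (μ f).1 := by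
  choose α hα using fun (k : Type) (_ : CommRing k) (_ : Algebra ℚ k) =>
    (isTauDescent_topTransfer g m k).exists_mulEquiv (topMForm_invariant g m k)
      (topMForm_topTransfer g m k)
  refine ⟨fun k _ _ => transferWZ_bijOn g m k, fun k _ _ => α k _ _,
    fun k _ _ f n x hx => transfer_eq_of_restricts (hα k _ _ f) hx,
    fun k k' _ _ _ _ φ f f' hff' n n' hn =>
      mapCoeff_eq_of_restricts φ.toRingHom (hα k _ _ f) (hα k' _ _ f') hff' hn,
    heisAlg_bijOn m, cycAlg_bijOn m, exists_isFactorBasis_topM hg hm, fun x hx => ?_⟩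
  have H := isTauDescent_topTransfer g m ℚ
  choose y hxy using fun a i => H.exists_eq_matAction_single i (x a)
  let y' (p : Fin (2 * g - 1) × ZMod m) : topN g m ℚ := y p.1 p.2
  have hm₀ : (m : ℚ) ^ 2 ≠ 0 := pow_ne_zero 2 (Nat.cast_ne_zero.2 (NeZero.ne m))
  have hy := H.bijective_sum_cycAction (y := y') hxy ((H.isFactorBasis_heis_iff x).1 hx)
  have gram_eq : gramH m g x = (m : ℚ) ^ 2 • gramQ m g y' :=
    H.heisGram_eq_smul_cycGram (topMForm_invariant g m ℚ) (topMForm_topTransfer g m ℚ) hxy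
  have unitary_eq : matrixUnitary m (gramH m g x) = matrixUnitary m (gramQ m g y') := by
    rw [gram_eq, matrixUnitary_rat_smul hm₀]
  obtain ⟨ν, hνα, hν⟩ := H.exists_mulEquiv_matrixUnitary_cycGram (topMForm_invariant g m ℚ)
    (topMForm_topTransfer g m ℚ) (hα ℚ _ _) hx (y := y') hxy
  refine ⟨y', fun a i e _ he => ?_, (H.isFactorBasis_cyc_iff y').2 hy, ⟨(m : ℚ) ^ 2, hm₀, gram_eq⟩,
    unitary_eq, ((α ℚ _ _).trans ν).trans (MulEquiv.subgroupCongr unitary_eq.symm), ν, hνα, hν,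
    fun f => (MulEquiv.subgroupCongr_apply unitary_eq.symm (ν (α ℚ _ _ f))).symm⟩
  rw [← H.matAction_heisAlg, he, ← hxy, coe_topTransfer]

theorem mainTheorem7 (g m : ℕ) [NeZero m] (hg : 2 ≤ g) (hm : 2 ≤ m) :
    (∀ (k : Type) [CommRing k] [Algebra ℚ k],
      Set.BijOn ((coverWZ g m).transfer k) (topN g m k)
        {x | x ∈ topM g m k ∧ repW g m k (Heis.tau m) x = x}) ∧
    ∃ α : ∀ (k : Type) [CommRing k] [Algebra ℚ k], GroupG g m k ≃* GroupGnn g m k,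
      -- `α` is the restriction to the `τ`-invariants
      (∀ (k : Type) [CommRing k] [Algebra ℚ k] (f : GroupG g m k) (n : topN g m k)
        (x : topM g m k), (x : (surfaceW g m).H1 k) = (coverWZ g m).transfer k n →
          (coverWZ g m).transfer k ((α k f).1 n) = f.1 x) ∧
      -- `α` is natural in the `ℚ`-algebra `k`
      (∀ (k k' : Type) [CommRing k] [Algebra ℚ k] [CommRing k'] [Algebra ℚ k'] (φ : k →ₐ[ℚ] k')
        (f : GroupG g m k) (f' : GroupG g m k'),
        (∀ (x : topM g m k) (x' : topM g m k'),
          (x' : (surfaceW g m).H1 k') = (surfaceW g m).mapCoeff φ.toRingHom x →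
          (f'.1 x' : (surfaceW g m).H1 k') = (surfaceW g m).mapCoeff φ.toRingHom (f.1 x)) →
        ∀ (n : topN g m k) (n' : topN g m k'),
          (n' : (surfaceZ g m).H1 k') = (surfaceZ g m).mapCoeff φ.toRingHom n →
          ((α k' f').1 n' : (surfaceZ g m).H1 k') =
            (surfaceZ g m).mapCoeff φ.toRingHom ((α k f).1 n)) ∧
      -- the simple factors of the group algebras
      Set.BijOn (heisAlg m) (topFactor ℚ (Heis.zeta m) m) Set.univ ∧
      Set.BijOn (cycAlg m) (topFactor ℚ (CycQ.zeta m) m) Set.univ ∧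
      -- `M_m` is free of rank `2 g - 1`, and the two Gram matrices define the same unitary group
      (∃ x : Fin (2 * g - 1) → topM g m ℚ, IsFactorBasis (topMRep g m ℚ) (Heis.zeta m) m x) ∧
      ∀ x : Fin (2 * g - 1) → topM g m ℚ, IsFactorBasis (topMRep g m ℚ) (Heis.zeta m) m x →
        ∃ y : Fin (2 * g - 1) × ZMod m → topN g m ℚ,
          (∀ a i, ∀ e ∈ topFactor ℚ (Heis.zeta m) m, heisAlg m e = Matrix.single 0 i 1 →
            (coverWZ g m).transfer ℚ (y (a, i)) = (topMRep g m ℚ).asAlgebraHom e (x a)) ∧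
          IsFactorBasis (topNRep g m ℚ) (CycQ.zeta m) m y ∧
          (∃ c : ℚ, c ≠ 0 ∧ gramH m g x = c • gramQ m g y) ∧
          matrixUnitary m (gramH m g x) = matrixUnitary m (gramQ m g y) ∧
          ∃ (μ : GroupG g m ℚ ≃* matrixUnitary m (gramH m g x))
            (ν : GroupGnn g m ℚ ≃* matrixUnitary m (gramQ m g y)),
            (∀ f : GroupG g m ℚ,
              ∃ γ : Fin (2 * g - 1) → Fin (2 * g - 1) → topFactor ℚ (Heis.zeta m) m,
                (∀ b, f.1 (x b) = ∑ a, (topMRep g m ℚ).asAlgebraHom (γ a b).1 (x a)) ∧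
                ∀ p q, (μ f).1.1 p q = heisAlg m (γ p.1 q.1).1 q.2 p.2) ∧
            (∀ f : GroupGnn g m ℚ,
              ∃ η : Fin (2 * g - 1) × ZMod m → Fin (2 * g - 1) × ZMod m →
                  topFactor ℚ (CycQ.zeta m) m,
                (∀ q, f.1 (y q) = ∑ p, (topNRep g m ℚ).asAlgebraHom (η p q).1 (y p)) ∧
                ∀ p q, (ν f).1.1 p q = cycAlg m (η p q).1) ∧
            ∀ f : GroupG g m ℚ, (ν (α ℚ f)).1 = (μ f).1 :=
  mainTheorem7_general g m (one_le_two.trans hg) hm
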